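/- **Setting.** Let $d\ge 1$. A function $f:\mathbb R^d\to\mathbb R$ has $L$-Lipschitz $p$-th derivatives if for all $x$, all $s$ with $\|s\|\le 1$ and all $\theta\in\mathbb R$ the function $q(\theta)=f(x+\theta s)$ satisfies $|q^{(p)}(0)-q^{(p)}(\theta)|\le L|\theta|$. Write $B_R(x)$ for the closed Euclidean ball, $\log^+\theta=\max\{1,\log\theta\}$. *Cutting plane method* for a differentiable $h$, from $x_0$ with radius $R$: for a vector $g$ and a point $c$ let $H(g,c)=\{x: g^T(x-c)\le 0\}$ if $g\ne0$ and $H(0,c)=\{c\}$. Put $S_0=B_R(x_0)\cap H(\nabla h(x_0),x_0)$ and, for $t\ge1$, $x_t=\mathrm{Centre}(S_{t-1})$, $S_t=S_{t-1}\cap H(\nabla h(x_t),x_t)$. *Assumption on Centre* (with parameter $\tau\in(0,1/2]$): Centre is measurable in the data (ball and cuts) describing the region, and for all differentiable $h$, all $x_0$, $R>0$ and $N\ge1$ one has $x_N\in S_{N-1}$ and $\mathrm{vol}(S_N)\le(1-\tau)^N\mathrm{vol}(B_R(0))$. A call of Centre takes time $T_C$. *Trust-region routine* with data $(f,z,\epsilon,L_1,L_3,R)$.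 Put $\alpha=21L_3R^2$, $\hat f(x)=f(x)+\frac\alpha2\|z-x\|^2$, $\hat\epsilon=\epsilon/2$, $\hat L_1=L_1+\alpha$, $N=\lceil\frac d\tau\log(16\hat L_1R/\hat\epsilon)\rceil$, and run $N$ steps of the cutting plane method on $\hat f$ from $x_0=z$ with radius $R$. Let $x_{\rm best}$ be the first minimizer of $\hat f$ among $x_0,\dots,x_N$. If $\|\nabla\hat f(x_{\rm best})\|\le\hat\epsilon$, set $u=x_{\rm best}$, $v=\emptyset$. Otherwise draw independent uniform points of the ball of radius $\hat\epsilon/(8\hat L_1)$ around $x_{\rm best}-\nabla\hat f(x_{\rm best})/\hat L_1$ until a point $u\notin S_N$ is drawn; if $\|u-x_0\|\le R$, let $v$ be the first $x_t$ with $\hat f(u)<\hat f(x_t)+\nabla\hat f(x_t)^T(u-x_t)$, and otherwise $v=\emptyset$. For a point $c$ and a unit vector $s$ let $\mathrm{Exploit}(c,s)=c+\theta_*s$, where $\theta_*$ minimizes $f(c+\theta s)$ over $\theta\in\{12R,9R,-9R,-12R\}$. If $\|\nabla f(u)\|\le\epsilon$, let $p$ be a unit vector minimizing $s^T\nabla^2f(u)s$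 (computed by a singular value decomposition, measurably in the matrix); return $u$ if $p^T\nabla^2f(u)p\ge-\alpha$ and $\mathrm{Exploit}(u,p)$ otherwise. If $\|\nabla f(u)\|>\epsilon$, return $u$ if $v=\emptyset$ and $\mathrm{Exploit}\big(\frac{u+v}2,\frac{v-u}{\|u-v\|}\big)$ otherwise. *Procedure.* Given $z^{(t)}$, let $\bar f^{(t)}$ be the third-order Taylor polynomial of $f$ at $z^{(t)}$ plus $\frac{2L_3}{4!}\|x-z^{(t)}\|^4$, and let $z^{(t+1)}$ be the output of the trust-region routine (with fresh independent random points) for the data $(\bar f^{(t)},z^{(t)},\epsilon/2,2L_1,2L_3,\;L_3^{-1/3}\epsilon^{1/3}/24)$. *Time.* Evaluating $f$ and its first three derivatives at a point takes time $T_3\ge 0$ and is done once per iterate; a call of Centre takes $T_C\ge 0$; an operation on vectors of length $d$ (linear combination, inner product, test of a point against one half-space or ball, random draw from a ball) takes $\kappa d$; an evaluation of $\bar f^{(t)}$ with its gradient and Hessian, and a singular value decomposition, take $\kappa d^3$ each. **Theorem.** For every $\kappa>0$ there is a constant $C>0$, depending only on $\kappa$, such that the following holds. Suppose the assumption on Centre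 holds. Let $L_1,L_3\in(0,\infty)$, $\epsilon\in(0,L_1^{3/2}/L_3^{1/2}]$, and let $f:\mathbb R^d\to\mathbb R$ be $C^3$ and bounded below, with $L_1$-Lipschitz first derivatives and $L_3$-Lipschitz third derivatives. Let $z^{(0)}\in\mathbb R^d$ and $f(z^{(0)})-\inf f\le\Delta$. Then there is a positive random variable $\bar K$ with $\mathbf P(\bar K\ge y)\le e^{(1-y)/10}$ for all $y\in\mathbb R$ such that, almost surely, the procedure reaches a point $z^{(m)}$ with $$\|\nabla f(z^{(m)})\|\le\epsilon,\qquad \lambda_{\min}(\nabla^2f(z^{(m)}))\ge-L_3^{1/3}\epsilon^{2/3},$$ and the total time, including an evaluation of $f$ and its derivatives at $z^{(m)}$, is at most $$C\,\big(\Delta L_3^{1/3}\epsilon^{-4/3}+1\big)\Big(T_3+\frac{(T_C+d^3+\bar Kd)\,d}{\tau}\log^+\!\Big(\frac{L_1^3}{\epsilon^2L_3}\Big)\Big).$$ -/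

import Mathlib

noncomputable section

/-- Euclidean space of dimension `d`. -/
abbrev Vec (d : ℕ) : Type := EuclideanSpace ℝ (Fin d)

/-! ### Smoothness -/

/-- `f` has `L`-Lipschitz `p`-th derivatives on `Q`: along every line `q(θ) = f (x + θ s)` with
`‖s‖ ≤ 1`, one has `|q⁽ᵖ⁾(0) - q⁽ᵖ⁾(θ)| ≤ L |θ|` as long as both points lie in `Q`. -/
def HasLipschitzDerivs {d : ℕ} (p : ℕ) (L : ℝ) (f : Vec d → ℝ) (Q : Set (Vec d)) : Prop :=
  ∀ x ∈ Q, ∀ s ∈ Metric.closedBall (0 : Vec d) 1, ∀ θ : ℝ, x + θ • s ∈ Q →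
    |iteratedDeriv p (fun t : ℝ => f (x + t • s)) 0
      - iteratedDeriv p (fun t : ℝ => f (x + t • s)) θ| ≤ L * |θ|

/-- The Hessian matrix of `f` at `x`. -/
def hessian {d : ℕ} (f : Vec d → ℝ) (x : Vec d) : Matrix (Fin d) (Fin d) ℝ :=
  Matrix.of fun i j =>
    iteratedFDeriv ℝ 2 f x ![EuclideanSpace.single i 1, EuclideanSpace.single j 1]

/-- The smallest (real) eigenvalue of a matrix. -/
def lambdaMin {d : ℕ} (A : Matrix (Fin d) (Fin d) ℝ) : ℝ := sInf (spectrum ℝ A)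

/-- The quadratic form `sᵀ A s`. -/
def quadForm {d : ℕ} (A : Matrix (Fin d) (Fin d) ℝ) (s : Vec d) : ℝ :=
  (fun i => s i) ⬝ᵥ A.mulVec (fun i => s i)

/-- The regularized `p`-th order Taylor model of `f` at `z`:
`∑_{k ≤ p} Dᵏf(z)[x - z]ᵏ / k! + 2 L / (p + 1)! ‖x - z‖ᵖ⁺¹`. -/
def taylorModel {d : ℕ} (p : ℕ) (L : ℝ) (f : Vec d → ℝ) (z x : Vec d) : ℝ :=
  (∑ k ∈ Finset.range (p + 1),
      (iteratedFDeriv ℝ k f z fun _ => x - z) / (Nat.factorial k : ℝ))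
    + 2 * L / (Nat.factorial (p + 1) : ℝ) * ‖x - z‖ ^ (p + 1)

/-! ### The cutting plane method -/

/-- The part kept by a cut through `c` with normal `g`: the half-space `gᵀ (x - c) ≤ 0`.
If `g = 0` the inequality cuts off nothing; then only the stationary point `c` is kept. -/
def cut {d : ℕ} (g c : Vec d) : Set (Vec d) :=
  {x | inner ℝ g (x - c) ≤ 0 ∧ (g = 0 → x = c)}

/-- The cutting plane method for `h` started at `x₀` with radius `R`: after `t` steps, the pair
of the region `Sₜ` and the query point `xₜ`, where `xₜ₊₁ = centre Sₜ`. -/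
def cuttingPlane {d : ℕ} (centre : Set (Vec d) → Vec d) (h : Vec d → ℝ) (x₀ : Vec d) (R : ℝ) :
    ℕ → Set (Vec d) × Vec d
  | 0 => (Metric.closedBall x₀ R ∩ cut (gradient h x₀) x₀, x₀)
  | t + 1 =>
    let S := (cuttingPlane centre h x₀ R t).1
    let c := centre S
    (S ∩ cut (gradient h c) c, c)

/-- The assumption on the routine `centre`: it selects a point of the current region, and on
every differentiable function the volume of the region after `N` steps is at most `(1 - τ)ᴺ`
times the volume of the initial ball.  `centre` is a measurable function of the data (centre of
the ball, base points and normals of the cuts) that describe the region. -/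
structure IsCuttingPlaneCentre {d : ℕ} (centre : Set (Vec d) → Vec d) (τ : ℝ) : Prop where
  tau_pos : 0 < τ
  tau_le : τ ≤ 1 / 2
  mem : ∀ (h : Vec d → ℝ), Differentiable ℝ h → ∀ (x₀ : Vec d) (R : ℝ), 0 < R → ∀ t : ℕ,
    (cuttingPlane centre h x₀ R (t + 1)).2 ∈ (cuttingPlane centre h x₀ R t).1
  volume_le : ∀ (h : Vec d → ℝ), Differentiable ℝ h → ∀ (x₀ : Vec d) (R : ℝ), 0 < R →
    ∀ N : ℕ, 0 < N →
      MeasureTheory.volume (cuttingPlane centre h x₀ R N).1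
        ≤ ENNReal.ofReal ((1 - τ) ^ N) * MeasureTheory.volume (Metric.closedBall (0 : Vec d) R)
  measurable : ∀ (n : ℕ) (R : ℝ), 0 < R →
    Measurable fun q : Vec d × (Fin (n + 1) → Vec d × Vec d) =>
      centre (Metric.closedBall q.1 R ∩ ⋂ i, cut (q.2 i).2 (q.2 i).1)

/-- The routine `svd` returns, for a symmetric matrix `A`, a minimizer of `sᵀ A s` over the
unit sphere, in a measurable way. -/
structure IsMinDirection {d : ℕ} (svd : Matrix (Fin d) (Fin d) ℝ → Vec d) : Prop where
  measurable : Measurable fun A : Fin d → Fin d → ℝ => svd (Matrix.of A)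
  norm_eq : ∀ A : Matrix (Fin d) (Fin d) ℝ, A.IsSymm → ‖svd A‖ = 1
  isMin : ∀ A : Matrix (Fin d) (Fin d) ℝ, A.IsSymm → ∀ s : Vec d, ‖s‖ = 1 →
    quadForm A (svd A) ≤ quadForm A s

/-! ### Computations with a clock -/

/-- A computation either diverges (`none`) or returns a value together with the time used. -/
def Comp (α : Type) : Type := Option (α × ℝ)

/-- Sequential composition adds the times. -/
instance : Monad Comp where
  pure a := some (a, 0)
  bind x g := Option.bind x fun p => Option.bind (g p.1) fun q => some (q.1, p.2 + q.2)

/-- The computation `x` terminates and returns `a` after time `t`. -/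
def Comp.Returns {α : Type} (x : Comp α) (a : α) (t : ℝ) : Prop := x = some (a, t)

/-- Spend time `c`. -/
def tick (c : ℝ) : Comp Unit := some ((), c)

/-- The times of the primitive operations: one call of `centre`; one evaluation of the objective
with its gradient and Hessian; one singular value decomposition of a `d × d` matrix (with the
evaluation of a quadratic form); one operation on vectors of length `d` (linear combination,
inner product, test of a point against one half-space or a ball, drawing a uniform point of a
ball, ...). -/
structure Costs where
  centre : ℝ
  eval : ℝ
  svd : ℝ
  vec : ℝ

/-- The first minimizer of `φ` in the list `a :: l`. -/
def argminFirst {α : Type} (φ : α → ℝ) (a : α) (l : List α) : α :=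
  open Classical in l.foldl (fun b x => if φ x < φ b then x else b) a

/-- Draw `y + r • U 0`, `y + r • U 1`, ... until a point is outside `S`; returns that point and
the number of draws.  Each draw costs `c`.  Diverges if every point is in `S`. -/
def sampleOutside {d : ℕ} (c : ℝ) (S : Set (Vec d)) (y : Vec d) (r : ℝ) (U : ℕ → Vec d) :
    Comp (Vec d × ℕ) :=
  open Classical in
  if h : ∃ k, y + r • U k ∉ S then
    some ((y + r • U (Nat.find h), Nat.find h + 1), ((Nat.find h + 1 : ℕ) : ℝ) * c)
  else none

/-- The search for a certificate of nonconvexity of `h` after `N` steps of the cutting plane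
method with regions and points `run`; `U` is a stream of points of the unit ball, so that
`y + r • U k` is a point of the ball of radius `r` around `y`.  Returns `u`, `v` (`none` for
"no point") and the number `K` of draws. -/
def nonconvexityCertificate {d : ℕ} (T : Costs) (h : Vec d → ℝ) (N : ℕ)
    (run : ℕ → Set (Vec d) × Vec d) (L ε R : ℝ) (U : ℕ → Vec d) :
    Comp (Vec d × Option (Vec d) × ℕ) :=
  open Classical in do
  let x := fun t => (run t).2
  let S := (run N).1
  tick ((N + 1) * T.vec)
  let xbest := argminFirst h (x 0) ((List.range N).map fun t => x (t + 1))
  tick T.vec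
  if ‖gradient h xbest‖ ≤ ε then
    return (xbest, none, 0)
  else
    tick T.vec
    let y := xbest - (1 / L) • gradient h xbest
    let r := ε / (8 * L)
    -- one draw, then the ball and the `N + 1` half-spaces that make up `S`
    let (u, K) ← sampleOutside (T.vec + (N + 2) * T.vec) S y r U
    tick T.vec
    if ‖u - x 0‖ ≤ R then
      tick (T.eval + T.vec + (N + 1) * T.vec)
      let v := ((List.range (N + 1)).map x).find?
        fun v => decide (h u < h v + inner ℝ (gradient h v) (u - v))
      return (u, v, K)
    else
      return (u, none, K)

/-- Exploiting a direction `s` of negative curvature of `f` near `c`. -/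
def exploitNC {d : ℕ} (T : Costs) (f : Vec d → ℝ) (c s : Vec d) (R : ℝ) : Comp (Vec d) := do
  tick (4 * (T.eval + T.vec))
  let θ := argminFirst (fun θ : ℝ => f (c + θ • s)) (12 * R) [9 * R, -9 * R, -12 * R]
  return c + θ • s

/-- The cutting plane trust-region routine: returns the new point and the number of draws. -/
def cuttingTrustRegion {d : ℕ} (T : Costs) (centre : Set (Vec d) → Vec d) (τ : ℝ)
    (svd : Matrix (Fin d) (Fin d) ℝ → Vec d) (f : Vec d → ℝ) (z : Vec d) (ε L₁ L₃ R : ℝ)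
    (U : ℕ → Vec d) : Comp (Vec d × ℕ) :=
  open Classical in do
  let α := 21 * L₃ * R ^ 2
  let fhat := fun x => f x + α / 2 * ‖z - x‖ ^ 2
  let εhat := ε / 2
  let Lhat := L₁ + α
  let N := ⌈(d : ℝ) / τ * Real.log (16 * Lhat * R / εhat)⌉₊
  -- the cutting plane method: `N + 1` evaluations and `N` centres
  tick ((T.eval + T.vec) + N * (T.centre + T.eval + T.vec))
  let (u, v, K) ← nonconvexityCertificate T fhat N (cuttingPlane centre fhat z R) Lhat εhat R U
  tick (T.eval + T.vec)
  if ‖gradient f u‖ ≤ ε then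
    tick T.svd
    let p := svd (hessian f u)
    if -α ≤ quadForm (hessian f u) p then
      return (u, K)
    else
      let z' ← exploitNC T f u p R
      return (z', K)
  else
    match v with
    | none => return (u, K)
    | some v =>
      let z' ← exploitNC T f ((1 / 2 : ℝ) • (u + v)) ((1 / ‖u - v‖) • (v - u)) R
      return (z', K)

/-- The iterates `z_t` of the cutting plane method on quartic regularized models, together with
the time spent on computing them.  In pass `t` the function `f` and its first three derivatives
are evaluated once, at `z_t` (time `T₃`); then the trust-region routine is run on the regularized
third order model, with the stream `U t` of random points.  An evaluation of the model, with its
gradient and Hessian, and a singular value decomposition take time `κ d³` each, a vector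
operation takes time `κ d`, and a call of `centre` takes time `TC`. -/
def quarticIterates {d : ℕ} (κ T₃ TC : ℝ) (centre : Set (Vec d) → Vec d) (τ : ℝ)
    (svd : Matrix (Fin d) (Fin d) ℝ → Vec d) (f : Vec d → ℝ) (z₀ : Vec d) (ε L₁ L₃ : ℝ)
    (U : ℕ → ℕ → Vec d) : ℕ → Comp (Vec d)
  | 0 => pure z₀
  | t + 1 => do
    let z ← quarticIterates κ T₃ TC centre τ svd f z₀ ε L₁ L₃ U t
    tick T₃
    let T : Costs :=
      { centre := TC, eval := κ * (d : ℝ) ^ 3, svd := κ * (d : ℝ) ^ 3, vec := κ * (d : ℝ) }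
    let (z', _) ← cuttingTrustRegion T centre τ svd (taylorModel 3 L₃ f z) z
      (ε / 2) (2 * L₁) (2 * L₃) (L₃ ^ (-(1 / 3) : ℝ) * ε ^ (1 / 3 : ℝ) / 24) (U t)
    return z'

/-- `log⁺ θ = max {1, log θ}`. -/
def logPlus (θ : ℝ) : ℝ := max 1 (Real.log θ)

/-- `(Δ L₃^{1/3} ε^{-4/3} + 1) (T₃ + (TC + d³ + K d) d / τ · log⁺(L₁³ / (ε² L₃)))`. -/
def timeBound (d : ℕ) (T₃ TC τ L₁ L₃ ε Δ K : ℝ) : ℝ :=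
  (Δ * L₃ ^ (1 / 3 : ℝ) * ε ^ (-(4 / 3) : ℝ) + 1) *
    (T₃ + (TC + (d : ℝ) ^ 3 + K * d) * d / τ * logPlus (L₁ ^ 3 / (ε ^ 2 * L₃)))

end

/-!
Along every line the regularized model of `f` is a quartic polynomial, so a point of negative
curvature can be exploited with evaluations only: at the four points at distance `± 9 R` and
`± 12 R`, suitable weights match the low moments of the line, and the best of the four decreases the
model by a multiple of `L₃ R⁴`.

If no query point of the cutting plane method is almost stationary for the penalized model, then a
gradient step from the best query point decreases the penalized model, and so does every point of a
small ball around its end (after a step longer than `3 R` the gradient is so large that the model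
itself drops). The final region has at most half the volume of this ball, so each draw
escapes from it with probability at least `1 / 2`, whatever the past. An escaped point `u` at
distance at most `R` was cut off at some query point `v` although its value is smaller than at `v`:
the penalized model is not convex on the segment from `v` to `u`, and the curvature of the model at
the midpoint is negative enough to be exploited. If `u` is further away, the penalty forces a
decrease of the model. Hence every pass ends at an approximately stationary point or decreases `f`
by `21 L₃ R⁴`, which can happen only `O(Δ L₃^(1/3) ε^(-4/3))` times.

The numbers of draws of the passes have geometric tails, hence exponential moments at most `2`;
convexity of `exp` passes this bound to their average without any independence between passes.
-/

noncomputable section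

variable {d : ℕ}

/-! ### Taylor expansions along lines -/

section Lines

variable {E F : Type*} [NormedAddCommGroup E] [NormedSpace ℝ E] [NormedAddCommGroup F]
  [NormedSpace ℝ F]

theorem iteratedDeriv_comp_add_smul {n : WithTop ℕ∞} {k : ℕ} {f : E → F} (hf : ContDiff ℝ n f)
    (hk : (k : WithTop ℕ∞) ≤ n) (x s : E) (t : ℝ) :
    iteratedDeriv k (fun t : ℝ => f (x + t • s)) t
      = iteratedFDeriv ℝ k f (x + t • s) fun _ => s := by
  have hcomp : (fun t : ℝ => f (x + t • s))
      = (fun y => f (x + y)) ∘ ContinuousLinearMap.toSpanSingleton ℝ s := by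
    ext t
    simp only [Function.comp_apply, ContinuousLinearMap.toSpanSingleton_apply]
  have hshift : ContDiff ℝ n fun y => f (x + y) := by fun_prop
  rw [iteratedDeriv_eq_iteratedFDeriv, hcomp,
    ContinuousLinearMap.iteratedFDeriv_comp_right _ hshift t hk, iteratedFDeriv_comp_add_left]
  simp only [ContinuousMultilinearMap.compContinuousLinearMap_apply,
    ContinuousLinearMap.toSpanSingleton_apply, one_smul]

theorem iteratedDeriv_comp_add_smul_zero {n : WithTop ℕ∞} {k : ℕ} {f : E → F}
    (hf : ContDiff ℝ n f) (hk : (k : WithTop ℕ∞) ≤ n) (x s : E) :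
    iteratedDeriv k (fun t : ℝ => f (x + t • s)) 0 = iteratedFDeriv ℝ k f x fun _ => s := by
  rw [iteratedDeriv_comp_add_smul hf hk, zero_smul, add_zero]

theorem iteratedFDeriv_apply_const_smul (k : ℕ) (f : E → F) (x s : E) (t : ℝ) :
    (iteratedFDeriv ℝ k f x fun _ => t • s) = t ^ k • iteratedFDeriv ℝ k f x fun _ => s := by
  simp only [ContinuousMultilinearMap.map_smul_univ, Finset.prod_const, Finset.card_univ,
    Fintype.card_fin]

theorem norm_sub_taylor_le {q : ℝ → F} {p : ℕ} {L : ℝ} (hq : ContDiff ℝ p q)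
    (hL : ∀ t, 0 ≤ t → ‖iteratedDeriv p q t - iteratedDeriv p q 0‖ ≤ L * t) {t : ℝ}
    (ht : 0 ≤ t) :
    ‖q t - ∑ k ∈ Finset.range (p + 1), (t ^ k / (k.factorial : ℝ)) • iteratedDeriv k q 0‖
      ≤ L / ((p + 1).factorial : ℝ) * t ^ (p + 1) := by
  induction p generalizing q t with
  | zero => simpa using hL t ht
  | succ p ih =>
    have hqd : Differentiable ℝ q := hq.differentiable (by simp)
    have hq' : ContDiff ℝ p (deriv q) := (contDiff_succ_iff_deriv.1 (by exact_mod_cast hq)).2.2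
    have hmono (c : ℝ) (n : ℕ) (t : ℝ) : HasDerivAt
        (fun t : ℝ => c / ((n + 1).factorial : ℝ) * t ^ (n + 1))
        (c / (n.factorial : ℝ) * t ^ n) t := by
      refine ((hasDerivAt_pow (n + 1) t).const_mul _).congr_deriv ?_
      rw [Nat.factorial_succ, Nat.add_sub_cancel]
      push_cast
      field_simp
    have hpoly (t : ℝ) : HasDerivAt
        (fun t : ℝ => ∑ k ∈ Finset.range (p + 2), (t ^ k / (k.factorial : ℝ)) • iteratedDeriv k q 0)
        (∑ k ∈ Finset.range (p + 1),
          (t ^ k / (k.factorial : ℝ)) • iteratedDeriv k (deriv q) 0) t := by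
      simp only [Finset.sum_range_succ' _ (p + 1), iteratedDeriv_succ', pow_zero]
      refine HasDerivAt.add_const _ (HasDerivAt.fun_sum fun k _ => ?_)
      simpa only [one_div_mul_eq_div] using (hmono 1 k t).smul_const (iteratedDeriv k (deriv q) 0)
    have hrem (t : ℝ) := (hqd t).hasDerivAt.sub (hpoly t)
    refine image_norm_le_of_norm_deriv_right_le_deriv_boundary (a := 0) (b := t)
      (fun s _ => (hrem s).continuousAt.continuousWithinAt)
      (fun s _ => (hrem s).hasDerivWithinAt) ?_ (hmono L (p + 1)) (fun s hs => ?_) ⟨ht, le_rfl⟩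
    · simp [Finset.sum_range_succ']
    · exact ih hq' (by simpa only [← iteratedDeriv_succ'] using hL) hs.1

end Lines

theorem hasDerivAt_comp_add_smul {E : Type*} [NormedAddCommGroup E] [InnerProductSpace ℝ E]
    [CompleteSpace E] {f : E → ℝ} (hf : Differentiable ℝ f) (x s : E) (t : ℝ) :
    HasDerivAt (fun t : ℝ => f (x + t • s)) (inner ℝ (gradient f (x + t • s)) s) t := by
  have hline : HasDerivAt (fun t : ℝ => x + t • s) s t := by
    simpa only [id, one_smul] using ((hasDerivAt_id t).smul_const s).const_add x
  exact (hf (x + t • s)).hasGradientAt.hasFDerivAt.comp_hasDerivAt t hline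

theorem iteratedFDeriv_one_apply_eq_inner {E : Type*} [NormedAddCommGroup E]
    [InnerProductSpace ℝ E] [CompleteSpace E] {f : E → ℝ} {x : E} (hf : DifferentiableAt ℝ f x)
    (s : E) : (iteratedFDeriv ℝ 1 f x fun _ => s) = inner ℝ (gradient f x) s := by
  rw [iteratedFDeriv_one_apply, hf.hasGradientAt.hasFDerivAt.fderiv,
    InnerProductSpace.toDual_apply_apply]

theorem quadForm_hessian (f : Vec d → ℝ) (x s : Vec d) :
    quadForm (hessian f x) s = iteratedFDeriv ℝ 2 f x fun _ => s := by
  have hs : s = ∑ i, s i • EuclideanSpace.single i (1 : ℝ) := by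
    simpa using ((EuclideanSpace.basisFun (Fin d) ℝ).sum_repr s).symm
  rw [iteratedFDeriv_two_apply]
  conv_rhs => rw [hs]
  simp only [map_sum, map_smul, sum_apply, smul_apply, quadForm, dotProduct, Matrix.mulVec,
    hessian, Matrix.of_apply, iteratedFDeriv_two_apply, smul_eq_mul, Matrix.cons_val_zero,
    Matrix.cons_val_one, Finset.mul_sum]
  rw [Finset.sum_comm]
  exact Finset.sum_congr rfl fun i _ => Finset.sum_congr rfl fun j _ => by ring

theorem hessian_isSymm {f : Vec d → ℝ} (hf : ContDiff ℝ 2 f) (x : Vec d) :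
    (hessian f x).IsSymm := by
  have hsymm : IsSymmSndFDerivAt ℝ f x := hf.contDiffAt.isSymmSndFDerivAt (by simp)
  ext i j
  simp only [hessian, Matrix.transpose_apply, Matrix.of_apply, iteratedFDeriv_two_apply,
    Matrix.cons_val_zero, Matrix.cons_val_one]
  exact hsymm _ _

theorem quadForm_smul (A : Matrix (Fin d) (Fin d) ℝ) (c : ℝ) (s : Vec d) :
    quadForm A (c • s) = c ^ 2 * quadForm A s := by
  have hcoord : (fun i => (c • s) i) = c • fun i => s i := rfl
  unfold quadForm
  rw [hcoord, Matrix.mulVec_smul, smul_dotProduct, dotProduct_smul, smul_eq_mul, smul_eq_mul]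
  ring

theorem quadForm_eq_norm_sq_mul (A : Matrix (Fin d) (Fin d) ℝ) (s : Vec d) :
    quadForm A s = ‖s‖ ^ 2 * quadForm A (NormedSpace.normalize s) := by
  rw [← quadForm_smul, NormedSpace.norm_smul_normalize]

/-! ### Functions with Lipschitz derivatives along lines -/

theorem normalize_mem_closedBall (s : Vec d) :
    NormedSpace.normalize s ∈ Metric.closedBall (0 : Vec d) 1 := by
  rcases eq_or_ne s 0 with rfl | hs
  · simp
  · simp [NormedSpace.norm_normalize_eq_one_iff.2 hs]

namespace HasLipschitzDerivs

variable {p : ℕ} {L : ℝ} {f : Vec d → ℝ}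

theorem abs_sub_taylor_le (hL : HasLipschitzDerivs p L f Set.univ) (hf : ContDiff ℝ p f)
    (x s : Vec d) :
    |f (x + s) - ∑ k ∈ Finset.range (p + 1),
      (iteratedFDeriv ℝ k f x fun _ => s) / (k.factorial : ℝ)|
      ≤ L / ((p + 1).factorial : ℝ) * ‖s‖ ^ (p + 1) := by
  set e := NormedSpace.normalize s
  have hs : ‖s‖ • e = s := NormedSpace.norm_smul_normalize s
  have hq : ContDiff ℝ p fun t : ℝ => f (x + t • e) := by fun_prop
  have key := norm_sub_taylor_le (L := L) hq (fun t ht => by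
    have hlip := hL x (Set.mem_univ _) e (normalize_mem_closedBall s) t (Set.mem_univ _)
    rwa [abs_sub_comm, abs_of_nonneg ht] at hlip) (norm_nonneg s)
  rw [hs] at key
  refine (congrArg abs (congrArg _ (Finset.sum_congr rfl fun k hk => ?_))).trans_le key
  have hkp : (k : WithTop ℕ∞) ≤ p := by exact_mod_cast Nat.le_of_lt_succ (Finset.mem_range.1 hk)
  rw [iteratedDeriv_comp_add_smul_zero hf hkp, smul_eq_mul, div_mul_eq_mul_div,
    ← smul_eq_mul (‖s‖ ^ k), ← iteratedFDeriv_apply_const_smul, hs]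

theorem le_quadratic (hL : HasLipschitzDerivs 1 L f Set.univ) (hf : ContDiff ℝ 1 f)
    (x s : Vec d) : f (x + s) ≤ f x + inner ℝ (gradient f x) s + L / 2 * ‖s‖ ^ 2 := by
  have h := (abs_le.1 (hL.abs_sub_taylor_le (by exact_mod_cast hf) x s)).2
  simp only [Finset.sum_range_succ, Finset.sum_range_zero, iteratedFDeriv_zero_apply,
    iteratedFDeriv_one_apply_eq_inner (hf.differentiable (by simp) x), zero_add, div_one,
    Nat.reduceAdd, Nat.factorial_zero, Nat.factorial_one, Nat.factorial_two, Nat.cast_one,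
    Nat.cast_ofNat] at h
  linarith

theorem quadForm_hessian_le (hL : HasLipschitzDerivs 1 L f Set.univ) (hf : ContDiff ℝ 2 f)
    (hL0 : 0 ≤ L) (x s : Vec d) : quadForm (hessian f x) s ≤ L * ‖s‖ ^ 2 := by
  set e := NormedSpace.normalize s
  have hq : ContDiff ℝ 2 fun t : ℝ => f (x + t • e) := by fun_prop
  have hderiv := (hq.differentiable_iteratedDeriv 1 (by norm_cast) 0).hasDerivAt
  have hcurv : |quadForm (hessian f x) e| ≤ L := by
    rw [quadForm_hessian, ← iteratedDeriv_comp_add_smul_zero hf (by norm_cast),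
      iteratedDeriv_succ (n := 1)]
    refine hderiv.le_of_lip' hL0 (Filter.Eventually.of_forall fun t => ?_)
    rw [Real.norm_eq_abs, Real.norm_eq_abs, abs_sub_comm, sub_zero]
    exact hL x (Set.mem_univ _) e (normalize_mem_closedBall s) t (Set.mem_univ _)
  rw [quadForm_eq_norm_sq_mul, mul_comm]
  gcongr
  exact (le_abs_self _).trans hcurv

theorem abs_sub_cubic_le (hL : HasLipschitzDerivs 3 L f Set.univ) (hf : ContDiff ℝ 3 f)
    (x s : Vec d) (t : ℝ) :
    |f (x + t • s) - (f x + inner ℝ (gradient f x) s * t + quadForm (hessian f x) s / 2 * t ^ 2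
      + (iteratedFDeriv ℝ 3 f x fun _ => s) / 6 * t ^ 3)| ≤ L / 24 * ‖s‖ ^ 4 * t ^ 4 := by
  have h := hL.abs_sub_taylor_le hf x (t • s)
  simp only [iteratedFDeriv_apply_const_smul, Finset.sum_range_succ, Finset.sum_range_zero,
    iteratedFDeriv_one_apply_eq_inner (hf.differentiable (by simp) x), ← quadForm_hessian,
    iteratedFDeriv_zero_apply, norm_smul, mul_pow, Real.norm_eq_abs, Nat.reduceAdd,
    Even.pow_abs (show Even 4 by decide) t, Nat.factorial, smul_eq_mul] at h
  calc _ = _ := by congr 1; push_cast; ring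
    _ ≤ _ := h
    _ = _ := by push_cast; ring

theorem le_taylorModel (hL : HasLipschitzDerivs p L f Set.univ) (hf : ContDiff ℝ p f)
    (hL0 : 0 ≤ L) (z x : Vec d) : f x ≤ taylorModel p L f z x := by
  have h := (abs_le.1 (hL.abs_sub_taylor_le hf z (x - z))).2
  rw [add_sub_cancel] at h
  have hnonneg : 0 ≤ L / ((p + 1).factorial : ℝ) * ‖x - z‖ ^ (p + 1) := by positivity
  rw [taylorModel, mul_div_assoc]
  linarith

theorem taylorModel_le (hL : HasLipschitzDerivs p L f Set.univ) (hf : ContDiff ℝ p f)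
    (z x : Vec d) :
    taylorModel p L f z x ≤ f x + 3 * L / ((p + 1).factorial : ℝ) * ‖x - z‖ ^ (p + 1) := by
  have h := (abs_le.1 (hL.abs_sub_taylor_le hf z (x - z))).1
  rw [add_sub_cancel] at h
  rw [taylorModel, mul_div_assoc, mul_div_assoc]
  linarith

end HasLipschitzDerivs

theorem taylorModel_self (p : ℕ) (L : ℝ) (f : Vec d → ℝ) (z : Vec d) :
    taylorModel p L f z z = f z := by
  have hzero (k : ℕ) : (iteratedFDeriv ℝ (k + 1) f z fun _ => (0 : Vec d)) = 0 :=
    ContinuousMultilinearMap.map_zero _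
  simp [taylorModel, Finset.sum_range_succ', hzero]

/-! ### Functions that are quartic on lines -/

open Polynomial in
/-- `F` restricts to a polynomial of degree at most four on every line, with leading coefficient
`c ‖s‖⁴` in direction `s`.  The regularized third order Taylor model has this property. -/
structure IsQuarticOnLines (c : ℝ) (F : Vec d → ℝ) : Prop where
  contDiff : ContDiff ℝ 3 F
  exists_polynomial : ∀ x s : Vec d, ∃ p : ℝ[X], p.natDegree ≤ 4 ∧ p.coeff 4 = c * ‖s‖ ^ 4 ∧
    ∀ t, F (x + t • s) = p.eval t

section Polynomial

open Polynomial

theorem iteratedDeriv_polynomial_eval_zero (p : ℝ[X]) (k : ℕ) :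
    iteratedDeriv k (fun t => p.eval t) 0 = k.factorial * p.coeff k := by
  have hiter (k : ℕ) :
      iteratedDeriv k (fun t => p.eval t) = fun t => (derivative^[k] p).eval t := by
    induction k with
    | zero => rfl
    | succ k ih =>
      funext t
      rw [iteratedDeriv_succ, ih, Polynomial.deriv, Function.iterate_succ_apply']
  simp [hiter, ← coeff_zero_eq_eval_zero, coeff_iterate_derivative, Nat.descFactorial_self]

theorem exists_polynomial_multilinear_line {E : Type*} [AddCommGroup E] [Module ℝ E] {k : ℕ}
    (A : MultilinearMap ℝ (fun _ : Fin k => E) ℝ) (a s : E) :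
    ∃ p : ℝ[X], p.natDegree ≤ k ∧ ∀ t : ℝ, (A fun _ => a + t • s) = p.eval t := by
  classical
  refine ⟨∑ S : Finset (Fin k), C (A (S.piecewise (fun _ => s) fun _ => a)) * X ^ S.card,
    natDegree_sum_le_of_forall_le _ _ fun S _ => ?_, fun t => ?_⟩
  · exact (natDegree_C_mul_X_pow_le _ _).trans (by simpa using S.card_le_univ)
  · have hsplit : (fun _ : Fin k => a + t • s) = (fun _ => t • s) + fun _ => a := by
      funext i
      simp [add_comm]
    rw [hsplit, A.map_add_univ, eval_finsetSum]
    refine Finset.sum_congr rfl fun S _ => ?_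
    have hscale := A.map_piecewise_smul (fun _ => t) (S.piecewise (fun _ => s) fun _ => a) S
    rw [Finset.prod_const, smul_eq_mul] at hscale
    rw [eval_mul, eval_C, eval_pow, eval_X, mul_comm, ← hscale]
    congr 1
    funext i
    by_cases hi : i ∈ S <;> simp [hi]

theorem exists_polynomial_norm_pow_four_line {E : Type*} [NormedAddCommGroup E]
    [InnerProductSpace ℝ E] (a s : E) :
    ∃ p : ℝ[X], p.natDegree ≤ 4 ∧ p.coeff 4 = ‖s‖ ^ 4 ∧ ∀ t : ℝ, ‖a + t • s‖ ^ 4 = p.eval t := by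
  set q : ℝ[X] := C (‖s‖ ^ 2) * X ^ 2 + C (2 * inner ℝ a s) * X + C (‖a‖ ^ 2)
  have hdeg : q.natDegree ≤ 2 := natDegree_quadratic_le
  refine ⟨q ^ 2, natDegree_pow_le_of_le 2 hdeg, ?_, fun t => ?_⟩
  · rw [show 4 = 2 * 2 from rfl, coeff_pow_of_natDegree_le hdeg, pow_mul]
    have hlead : q.coeff 2 = ‖s‖ ^ 2 := by
      simp only [q, coeff_add, coeff_C_mul, coeff_X_pow, coeff_X, coeff_C]
      norm_num
    rw [hlead]
  · rw [show ‖a + t • s‖ ^ 4 = (‖a + t • s‖ ^ 2) ^ 2 by ring, norm_add_sq_real, inner_smul_right,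
      norm_smul, mul_pow, Real.norm_eq_abs, sq_abs]
    simp only [q, eval_pow, eval_add, eval_mul, eval_C, eval_X]
    ring

theorem contDiff_taylorModel_three (L : ℝ) (f : Vec d → ℝ) (z : Vec d) :
    ContDiff ℝ 3 (taylorModel 3 L f z) := by
  have hterm (k : ℕ) : ContDiff ℝ 3 fun x : Vec d => iteratedFDeriv ℝ k f z fun _ => x - z :=
    (iteratedFDeriv ℝ k f z).contDiff.comp (by fun_prop)
  have hnorm : ContDiff ℝ 3 fun x : Vec d => ‖x - z‖ ^ (3 + 1) := by
    simp only [show ∀ x : Vec d, ‖x - z‖ ^ (3 + 1) = (‖x - z‖ ^ 2) ^ 2 by intro x; ring]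
    exact ((contDiff_norm_sq ℝ).comp (contDiff_id.sub contDiff_const)).pow 2
  exact (ContDiff.sum fun k _ => (hterm k).div_const _).add (contDiff_const.mul hnorm)

theorem isQuarticOnLines_taylorModel (L : ℝ) (f : Vec d → ℝ) (z : Vec d) :
    IsQuarticOnLines (L / 12) (taylorModel 3 L f z) where
  contDiff := contDiff_taylorModel_three L f z
  exists_polynomial x s := by
    choose p hpdeg hpeval using fun k : ℕ =>
      exists_polynomial_multilinear_line (iteratedFDeriv ℝ k f z).toMultilinearMap (x - z) s
    obtain ⟨r, hrdeg, hrcoeff, hreval⟩ := exists_polynomial_norm_pow_four_line (x - z) s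
    set P : ℝ[X] := ∑ k ∈ Finset.range 4, C (k.factorial : ℝ)⁻¹ * p k
    have hPdeg : P.natDegree ≤ 3 := natDegree_sum_le_of_forall_le _ _ fun k hk =>
      (natDegree_C_mul_le _ _).trans
        ((hpdeg k).trans (Nat.le_of_lt_succ (Finset.mem_range.1 hk)))
    refine ⟨P + C (L / 12) * r, ?_, ?_, fun t => ?_⟩
    · exact natDegree_add_le_of_degree_le (hPdeg.trans (by norm_num))
        ((natDegree_C_mul_le _ _).trans hrdeg)
    · rw [coeff_add, coeff_eq_zero_of_natDegree_lt (hPdeg.trans_lt (by norm_num)), coeff_C_mul,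
        hrcoeff, zero_add]
    · rw [taylorModel, show x + t • s - z = x - z + t • s by abel, hreval, eval_add, eval_mul,
        eval_C, eval_finsetSum]
      congr 1
      · exact Finset.sum_congr rfl fun k _ => by
          rw [eval_mul, eval_C, ← hpeval, div_eq_inv_mul]; rfl
      · simp only [Nat.factorial]
        push_cast
        ring

end Polynomial

theorem IsQuarticOnLines.expansion {c : ℝ} {F : Vec d → ℝ} (hF : IsQuarticOnLines c F)
    (x s : Vec d) (t : ℝ) : F (x + t • s) = F x + inner ℝ (gradient F x) s * t
      + quadForm (hessian F x) s / 2 * t ^ 2 + (iteratedFDeriv ℝ 3 F x fun _ => s) / 6 * t ^ 3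
      + c * ‖s‖ ^ 4 * t ^ 4 := by
  obtain ⟨p, hdeg, hlead, hp⟩ := hF.exists_polynomial x s
  have hcoeff (k : ℕ) (hk : k ≤ 3) :
      (iteratedFDeriv ℝ k F x fun _ => s) = k.factorial * p.coeff k := by
    rw [← iteratedDeriv_comp_add_smul_zero hF.contDiff (by exact_mod_cast hk), funext hp,
      iteratedDeriv_polynomial_eval_zero]
  have hgrad := iteratedFDeriv_one_apply_eq_inner (hF.contDiff.differentiable (by simp) x) s
  have hvalue : F x = p.coeff 0 := by
    rw [Polynomial.coeff_zero_eq_eval_zero, ← hp, zero_smul, add_zero]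
  rw [quadForm_hessian, ← hgrad, hp, hvalue, hcoeff 1 (by simp), hcoeff 2 (by simp),
    hcoeff 3 le_rfl, ← hlead, p.eval_eq_sum_range' (Nat.lt_succ_of_le hdeg)]
  simp only [Finset.sum_range_succ, Finset.sum_range_zero, Nat.factorial]
  push_cast
  ring

theorem IsQuarticOnLines.le_quadratic {c : ℝ} {F : Vec d → ℝ} (hF : IsQuarticOnLines c F)
    {x w : Vec d} {B : ℝ} (hstart : quadForm (hessian F x) w ≤ B)
    (hmid : quadForm (hessian F (x + (1 / 2 : ℝ) • w)) w ≤ B) :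
    F (x + w) ≤ F x + inner ℝ (gradient F x) w + B / 2 := by
  have hend := hF.expansion x w 1
  have hhalf := hF.expansion x w (1 / 2)
  have hmid_end := hF.expansion (x + (1 / 2 : ℝ) • w) w (1 / 2)
  have hmid_start := hF.expansion (x + (1 / 2 : ℝ) • w) w (-(1 / 2))
  rw [one_smul] at hend
  rw [show x + (1 / 2 : ℝ) • w + (1 / 2 : ℝ) • w = x + w by module] at hmid_end
  rw [show x + (1 / 2 : ℝ) • w + (-(1 / 2) : ℝ) • w = x by module] at hmid_start
  linarith

/-! ### Comparison of a function with its quartic model -/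

/-- The first-order bound combines the values at `±ρ` and `±2ρ` with weights `8` and `-1` so that
the cubic term cancels; the second-order bound is a centred second difference. -/
theorem abs_coeff_le_of_cubic_bounds {a b c e L ρ : ℝ} (hL : 0 ≤ L) (hρ : 0 < ρ)
    (hlo : ∀ t, -(L / 8 * t ^ 4) ≤ a + b * t + c * t ^ 2 + e * t ^ 3)
    (hhi : ∀ t, a + b * t + c * t ^ 2 + e * t ^ 3 ≤ L / 8 * (ρ + |t|) ^ 4 - L / 24 * t ^ 4) :
    |b| ≤ 3 * L * ρ ^ 3 ∧ 2 * |c| ≤ 5 * L * ρ ^ 2 := by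
  have hpos : |ρ| = ρ := abs_of_pos hρ
  have hpos' : |2 * ρ| = 2 * ρ := abs_of_pos (by positivity)
  have hhi₀ := hhi 0
  have hhi₁ := hhi ρ
  have hhi₁' := hhi (-ρ)
  have hhi₂ := hhi (2 * ρ)
  have hhi₂' := hhi (-(2 * ρ))
  rw [abs_neg] at hhi₁' hhi₂'
  rw [hpos] at hhi₁ hhi₁'
  rw [hpos'] at hhi₂ hhi₂'
  rw [abs_zero] at hhi₀
  have hnonneg : 0 ≤ L * ρ ^ 4 := by positivity
  have hb : |b| * ρ ≤ 3 * L * ρ ^ 3 * ρ := by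
    rw [← abs_of_pos hρ, ← abs_mul, hpos, abs_le]
    constructor <;> linarith [hlo ρ, hlo (-ρ), hlo (2 * ρ), hlo (-(2 * ρ))]
  have hc : 2 * |c| * ρ ^ 2 ≤ 5 * L * ρ ^ 2 * ρ ^ 2 := by
    rw [mul_assoc, ← abs_of_pos (pow_pos hρ 2), ← abs_mul, abs_of_pos (pow_pos hρ 2),
      ← le_div_iff₀' two_pos, abs_le]
    constructor <;> linarith [hlo 0, hlo ρ, hlo (-ρ)]
  exact ⟨le_of_mul_le_mul_right hb hρ, le_of_mul_le_mul_right hc (by positivity)⟩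

theorem norm_le_of_forall_inner_le {E : Type*} [NormedAddCommGroup E] [InnerProductSpace ℝ E]
    {v : E} {c : ℝ} (hc : 0 ≤ c) (h : ∀ s : E, ‖s‖ = 1 → inner ℝ v s ≤ c) : ‖v‖ ≤ c := by
  rcases eq_or_ne v 0 with rfl | hv
  · simpa using hc
  · have hunit := h _ (NormedSpace.norm_normalize_eq_one_iff.2 hv)
    nth_rw 1 [← NormedSpace.norm_smul_normalize v] at hunit
    rwa [real_inner_smul_left, real_inner_self_eq_norm_sq,
      NormedSpace.norm_normalize_eq_one_iff.2 hv, one_pow, mul_one] at hunit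

namespace HasLipschitzDerivs

variable {L : ℝ} {f : Vec d → ℝ}

theorem abs_gradient_hessian_sub_le (hL : HasLipschitzDerivs 3 L f Set.univ)
    (hf : ContDiff ℝ 3 f) (hL0 : 0 ≤ L) {z u : Vec d} {ρ : ℝ} (hρ : 0 < ρ) (hu : ‖u - z‖ ≤ ρ)
    {s : Vec d} (hs : ‖s‖ = 1) :
    |inner ℝ (gradient (taylorModel 3 L f z) u) s - inner ℝ (gradient f u) s| ≤ 3 * L * ρ ^ 3 ∧
    |quadForm (hessian (taylorModel 3 L f z) u) s - quadForm (hessian f u) s|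
      ≤ 5 * L * ρ ^ 2 := by
  set F := taylorModel 3 L f z
  have hline (t : ℝ) := abs_le.1 (hL.abs_sub_cubic_le hf u s t)
  have hexp (t : ℝ) := (isQuarticOnLines_taylorModel L f z).expansion u s t
  rw [hs] at hline hexp
  have hlo (t : ℝ) := hL.le_taylorModel hf hL0 z (u + t • s)
  have hhi (t : ℝ) : F (u + t • s) ≤ f (u + t • s) + L / 8 * (ρ + |t|) ^ 4 := by
    have hdist : ‖u + t • s - z‖ ≤ ρ + |t| := by
      calc ‖u + t • s - z‖ = ‖(u - z) + t • s‖ := by congr 1; abel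
        _ ≤ ‖u - z‖ + ‖t • s‖ := norm_add_le _ _
        _ ≤ ρ + |t| := by rw [norm_smul, hs, mul_one, Real.norm_eq_abs]; gcongr
    calc F (u + t • s) ≤ f (u + t • s) + L / 8 * ‖u + t • s - z‖ ^ 4 :=
          (hL.taylorModel_le hf z _).trans_eq (by simp only [Nat.factorial]; push_cast; ring)
      _ ≤ _ := by gcongr
  have hcoeff := abs_coeff_le_of_cubic_bounds hL0 hρ (a := F u - f u)
    (b := inner ℝ (gradient F u) s - inner ℝ (gradient f u) s)
    (c := (quadForm (hessian F u) s - quadForm (hessian f u) s) / 2)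
    (e := ((iteratedFDeriv ℝ 3 F u fun _ => s) - iteratedFDeriv ℝ 3 f u fun _ => s) / 6)
    (fun t => by linarith [hlo t, hexp t, hline t]) fun t => by linarith [hhi t, hexp t, hline t]
  rwa [abs_div, abs_two, mul_div_cancel₀ _ two_ne_zero] at hcoeff

theorem norm_gradient_sub_le (hL : HasLipschitzDerivs 3 L f Set.univ) (hf : ContDiff ℝ 3 f)
    (hL0 : 0 ≤ L) {z u : Vec d} {ρ : ℝ} (hρ : 0 < ρ) (hu : ‖u - z‖ ≤ ρ) :
    ‖gradient f u - gradient (taylorModel 3 L f z) u‖ ≤ 3 * L * ρ ^ 3 := by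
  rw [norm_sub_rev]
  refine norm_le_of_forall_inner_le (by positivity) fun s hs => ?_
  rw [inner_sub_left]
  exact (abs_le.1 (hL.abs_gradient_hessian_sub_le hf hL0 hρ hu hs).1).2

theorem abs_quadForm_hessian_sub_le (hL : HasLipschitzDerivs 3 L f Set.univ)
    (hf : ContDiff ℝ 3 f) (hL0 : 0 ≤ L) {z u : Vec d} {ρ : ℝ} (hρ : 0 < ρ) (hu : ‖u - z‖ ≤ ρ)
    (s : Vec d) :
    |quadForm (hessian (taylorModel 3 L f z) u) s - quadForm (hessian f u) s|
      ≤ 5 * L * ρ ^ 2 * ‖s‖ ^ 2 := by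
  rw [quadForm_eq_norm_sq_mul _ s, quadForm_eq_norm_sq_mul (hessian f u) s, ← mul_sub, abs_mul,
    abs_of_nonneg (by positivity), mul_comm]
  rcases eq_or_ne s 0 with rfl | hs
  · simp
  · gcongr
    exact (hL.abs_gradient_hessian_sub_le hf hL0 hρ hu
      (NormedSpace.norm_normalize_eq_one_iff.2 hs)).2

theorem taylorModel_le_quadratic {L₁ : ℝ} (hL : HasLipschitzDerivs 3 L f Set.univ)
    (hL₁ : HasLipschitzDerivs 1 L₁ f Set.univ) (hf : ContDiff ℝ 3 f) (hL0 : 0 ≤ L)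
    (hL₁0 : 0 ≤ L₁) {z x w : Vec d} {ρ : ℝ} (hρ : 0 < ρ) (hx : ‖x - z‖ + ‖w‖ ≤ ρ)
    (hρL : 5 * L * ρ ^ 2 ≤ L₁) :
    taylorModel 3 L f z (x + w) ≤ taylorModel 3 L f z x
      + inner ℝ (gradient (taylorModel 3 L f z) x) w + L₁ * ‖w‖ ^ 2 := by
  have hcurv (y : Vec d) (hy : ‖y - z‖ ≤ ρ) :
      quadForm (hessian (taylorModel 3 L f z) y) w ≤ 2 * L₁ * ‖w‖ ^ 2 := by
    have hmodel := (abs_le.1 (hL.abs_quadForm_hessian_sub_le hf hL0 hρ hy w)).2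
    have hfun := hL₁.quadForm_hessian_le (hf.of_le (by norm_cast)) hL₁0 y w
    have hρw : 5 * L * ρ ^ 2 * ‖w‖ ^ 2 ≤ L₁ * ‖w‖ ^ 2 := by gcongr
    linarith
  have hmid : ‖x + (1 / 2 : ℝ) • w - z‖ ≤ ρ := by
    calc ‖x + (1 / 2 : ℝ) • w - z‖ = ‖(x - z) + (1 / 2 : ℝ) • w‖ := by congr 1; abel
      _ ≤ ‖x - z‖ + ‖(1 / 2 : ℝ) • w‖ := norm_add_le _ _
      _ ≤ ρ := by rw [norm_smul]; norm_num; linarith [norm_nonneg w]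
  have := (isQuarticOnLines_taylorModel L f z).le_quadratic
    (hcurv x (by linarith [norm_nonneg w])) (hcurv _ hmid)
  linarith

end HasLipschitzDerivs

/-! ### Exploiting negative curvature -/

section ArgminFirst

variable {ι : Type} (φ : ι → ℝ)

theorem argminFirst_cons (a x : ι) (l : List ι) : argminFirst φ a (x :: l)
    = argminFirst φ (open Classical in if φ x < φ a then x else a) l := rfl

theorem argminFirst_mem (a : ι) (l : List ι) : argminFirst φ a l ∈ a :: l := by
  induction l generalizing a with
  | nil => exact List.mem_singleton_self a
  | cons x l ih =>
    rw [argminFirst_cons]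
    split_ifs with hx
    · exact List.mem_cons_of_mem _ (ih x)
    · exact List.cons_subset_cons _ (List.subset_cons_self x l) (ih a)

theorem argminFirst_le {a b : ι} {l : List ι} (hb : b ∈ a :: l) :
    φ (argminFirst φ a l) ≤ φ b := by
  induction l generalizing a b with
  | nil => rw [List.mem_singleton.1 hb]; rfl
  | cons x l ih =>
    rw [argminFirst_cons]
    rcases List.mem_cons.1 hb with rfl | hb
    · split_ifs with hx
      · exact (ih List.mem_cons_self).trans hx.le
      · exact ih List.mem_cons_self
    rcases List.mem_cons.1 hb with rfl | hb
    · split_ifs with hx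
      · exact ih List.mem_cons_self
      · exact (ih List.mem_cons_self).trans (not_lt.1 hx)
    · exact ih (List.mem_cons_of_mem _ hb)

end ArgminFirst

/-- The point returned by `exploitNC`: the best of the four points `c + θ s` with
`θ ∈ {±12 R, ±9 R}`. -/
def exploitPoint (F : Vec d → ℝ) (c s : Vec d) (R : ℝ) : Vec d :=
  c + argminFirst (fun θ : ℝ => F (c + θ • s)) (12 * R) [9 * R, -9 * R, -12 * R] • s

theorem exploitPoint_le (F : Vec d → ℝ) (c s : Vec d) (R : ℝ) {t : ℝ}
    (ht : t ∈ [12 * R, 9 * R, -9 * R, -12 * R]) : F (exploitPoint F c s R) ≤ F (c + t • s) :=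
  argminFirst_le (fun θ : ℝ => F (c + θ • s)) ht

theorem norm_exploitPoint_sub_le (F : Vec d → ℝ) (c : Vec d) {s : Vec d} {R : ℝ} (hR : 0 ≤ R)
    (hs : ‖s‖ = 1) : ‖exploitPoint F c s R - c‖ ≤ 12 * R := by
  have hmem := argminFirst_mem (fun θ : ℝ => F (c + θ • s)) (12 * R) [9 * R, -9 * R, -12 * R]
  rw [exploitPoint, add_sub_cancel_left, norm_smul, hs, mul_one, Real.norm_eq_abs]
  simp only [List.mem_cons, List.not_mem_nil, or_false] at hmem
  rcases hmem with h | h | h | h <;> rw [h, abs_le] <;> constructor <;> linarith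

theorem exploitPoint_le_of_quadForm {F : Vec d → ℝ} {L R : ℝ} (hF : IsQuarticOnLines (L / 12) F)
    (hL : 0 ≤ L) {u p : Vec d} (hp : ‖p‖ = 1)
    (hcurv : quadForm (hessian F u) p ≤ -(42 * L * R ^ 2)) :
    F (exploitPoint F u p R) ≤ F u - 21 * L * R ^ 4 := by
  have hright := exploitPoint_le F u p R (t := 9 * R) (by simp)
  have hleft := exploitPoint_le F u p R (t := -9 * R) (by simp)
  rw [hF.expansion, hp] at hright hleft
  have hcurvR := mul_le_mul_of_nonneg_right hcurv (sq_nonneg R)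
  have hnonneg : 0 ≤ L * R ^ 4 := by positivity
  linarith

/-- The weights `(1/2 ± x) / 2` at `±12 R` and `(1/2 ∓ y) / 2` at `±9 R` have mean `-k R` and third
moment `(225/2 - 2 k²) k R³`. -/
theorem le_four_point_average {m c₀ c₁ c₂ c₃ c₄ R k : ℝ} (hk0 : 0 ≤ k) (hk1 : k ≤ 1)
    (hm : ∀ t ∈ [12 * R, 9 * R, -9 * R, -12 * R],
      m ≤ c₀ + c₁ * t + c₂ * t ^ 2 + c₃ * t ^ 3 + c₄ * t ^ 4) :
    m ≤ c₀ - c₁ * (k * R) + 225 / 2 * c₂ * R ^ 2 + c₃ * ((225 / 2 - 2 * k ^ 2) * k * R ^ 3)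
      + 27297 / 2 * c₄ * R ^ 4 := by
  have hkk : k ^ 2 ≤ 1 := pow_le_one₀ hk0 hk1
  set x := k * (387 / 2 - 2 * k ^ 2) / 756 with hx
  set y := (k + 12 * x) / 9 with hy
  have hx0 : 0 ≤ x := div_nonneg (mul_nonneg hk0 (by linarith)) (by norm_num)
  have hx1 : x ≤ k * (387 / 2) / 756 := by rw [hx]; gcongr; linarith [sq_nonneg k]
  have h₁ := mul_le_mul_of_nonneg_left (hm (12 * R) (by simp))
    (show 0 ≤ (1 / 2 + x) / 2 by linarith)
  have h₂ := mul_le_mul_of_nonneg_left (hm (9 * R) (by simp))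
    (show 0 ≤ (1 / 2 - y) / 2 by linarith)
  have h₃ := mul_le_mul_of_nonneg_left (hm (-9 * R) (by simp))
    (show 0 ≤ (1 / 2 + y) / 2 by linarith)
  have h₄ := mul_le_mul_of_nonneg_left (hm (-12 * R) (by simp))
    (show 0 ≤ (1 / 2 - x) / 2 by linarith)
  rw [hy, hx] at h₂ h₃
  rw [hx] at h₁ h₄
  linarith

theorem le_sub_of_four_points {m c₀ c₁ c₂ c₃ L R a : ℝ} (hL : 0 ≤ L) (hR : 0 < R) (ha : 0 ≤ a)
    (haR : a ≤ R) (hcurv : c₂ + c₃ * a + L / 6 * a ^ 2 + 21 * L * R ^ 2 ≤ 0)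
    (hm : ∀ t ∈ [12 * R, 9 * R, -9 * R, -12 * R],
      m ≤ c₀ + c₁ * t + c₂ * t ^ 2 + c₃ * t ^ 3 + L / 12 * t ^ 4) :
    m ≤ c₀ + c₁ * (-a) + c₂ * (-a) ^ 2 + c₃ * (-a) ^ 3 + L / 12 * (-a) ^ 4
      - 21 * L * R ^ 4 := by
  obtain ⟨k, rfl⟩ : ∃ k, a = k * R := ⟨a / R, by field_simp⟩
  have hk0 : 0 ≤ k := nonneg_of_mul_nonneg_left ha hR
  have hk1 : k ≤ 1 := le_of_mul_le_mul_right (by linarith) hR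
  have hkk : k ^ 2 ≤ 1 := pow_le_one₀ hk0 hk1
  have haverage := le_four_point_average hk0 hk1 hm
  have hcurvk := mul_le_mul_of_nonneg_left hcurv
    (show 0 ≤ (225 / 2 - k ^ 2) * R ^ 2 from mul_nonneg (by linarith) (sq_nonneg R))
  have hnonneg : 0 ≤ L * R ^ 4 := by positivity
  have hnonneg' : 0 ≤ L * R ^ 4 * k ^ 2 * (225 / 2 - k ^ 2) :=
    mul_nonneg (by positivity) (by linarith)
  have hk2 : L * R ^ 4 * k ^ 2 ≤ L * R ^ 4 := mul_le_of_le_one_right hnonneg hkk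
  linarith

/-! ### Proximal penalization -/

section Penalized

variable {E : Type*} [NormedAddCommGroup E]

/-- The proximally penalized function `F + α / 2 ‖z - ·‖²` to which the trust-region routine applies
the cutting plane method. -/
def penalized (α : ℝ) (F : E → ℝ) (z x : E) : ℝ := F x + α / 2 * ‖z - x‖ ^ 2

theorem le_penalized {α : ℝ} (hα : 0 ≤ α) (F : E → ℝ) (z x : E) : F x ≤ penalized α F z x :=
  le_add_of_nonneg_right (by positivity)

theorem penalized_self (α : ℝ) (F : E → ℝ) (z : E) : penalized α F z z = F z := by
  simp [penalized]

variable [InnerProductSpace ℝ E]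

theorem norm_sub_add_sq (z x w : E) :
    ‖z - (x + w)‖ ^ 2 = ‖z - x‖ ^ 2 + 2 * inner ℝ (x - z) w + ‖w‖ ^ 2 := by
  rw [show z - (x + w) = -((x - z) + w) by abel, norm_neg, norm_add_sq_real, norm_sub_rev x z]

variable [CompleteSpace E]

theorem hasGradientAt_penalized (α : ℝ) {F : E → ℝ} (hF : Differentiable ℝ F) (z x : E) :
    HasGradientAt (penalized α F z) (gradient F x + α • (x - z)) x := by
  have hsub : HasFDerivAt (fun y : E => z - y) (-ContinuousLinearMap.id ℝ E) x :=
    (hasFDerivAt_id x).const_sub z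
  rw [hasGradientAt_iff_hasFDerivAt]
  refine ((hF x).hasGradientAt.hasFDerivAt.add (hsub.norm_sq.const_mul (α / 2))).congr_fderiv ?_
  ext y
  simp
  ring

theorem differentiable_penalized (α : ℝ) {F : E → ℝ} (hF : Differentiable ℝ F) (z : E) :
    Differentiable ℝ (penalized α F z) :=
  fun x => (hasGradientAt_penalized α hF z x).differentiableAt

theorem gradient_penalized (α : ℝ) {F : E → ℝ} (hF : Differentiable ℝ F) (z x : E) :
    gradient (penalized α F z) x = gradient F x + α • (x - z) :=
  (hasGradientAt_penalized α hF z x).gradient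

theorem penalized_add_le (α : ℝ) {F : E → ℝ} (hF : Differentiable ℝ F) {z x w : E} {B : ℝ}
    (h : F (x + w) ≤ F x + inner ℝ (gradient F x) w + B * ‖w‖ ^ 2) :
    penalized α F z (x + w) ≤ penalized α F z x + inner ℝ (gradient (penalized α F z) x) w
      + (2 * B + α) / 2 * ‖w‖ ^ 2 := by
  rw [gradient_penalized α hF, inner_add_left, real_inner_smul_left, penalized, penalized,
    norm_sub_add_sq]
  linarith

end Penalized

/-! ### Certificates of nonconvexity -/

theorem curvature_neg_of_quartic_below_tangent {φ : ℝ → ℝ} {φ' c₀ c₁ c₂ c₃ c₄ a : ℝ}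
    (hφ : ∀ t, φ t = c₀ + c₁ * t + c₂ * t ^ 2 + c₃ * t ^ 3 + c₄ * t ^ 4) (ha : 0 < a)
    (hφ' : HasDerivAt φ φ' a) (hlt : φ (-a) < φ a - 2 * a * φ') :
    c₂ + c₃ * a + 2 * c₄ * a ^ 2 < 0 := by
  have hmono (c : ℝ) (n : ℕ) :
      HasDerivAt (fun t : ℝ => c * t ^ n) (c * (n * a ^ (n - 1))) a :=
    (hasDerivAt_pow n a).const_mul c
  have hderiv : φ' = c₁ + 2 * c₂ * a + 3 * c₃ * a ^ 2 + 4 * c₄ * a ^ 3 := by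
    refine hφ'.unique (((((((hmono c₀ 0).add (hmono c₁ 1)).add (hmono c₂ 2)).add
      (hmono c₃ 3)).add (hmono c₄ 4)).congr_deriv ?_).congr_of_eventuallyEq
      (Filter.Eventually.of_forall fun t => ?_))
    · norm_num
      ring
    · simp [hφ]
  rw [hφ, hφ, hderiv] at hlt
  refine neg_of_mul_neg_right (a := 4 * a ^ 2) ?_ (by positivity)
  linarith

namespace IsQuarticOnLines

variable {F : Vec d → ℝ}

theorem penalized_expansion {c : ℝ} (hF : IsQuarticOnLines c F) (α : ℝ) (z x s : Vec d) (t : ℝ) :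
    penalized α F z (x + t • s) = penalized α F z x
      + (inner ℝ (gradient F x) s + α * inner ℝ (x - z) s) * t
      + (quadForm (hessian F x) s / 2 + α / 2 * ‖s‖ ^ 2) * t ^ 2
      + (iteratedFDeriv ℝ 3 F x fun _ => s) / 6 * t ^ 3 + c * ‖s‖ ^ 4 * t ^ 4 := by
  rw [penalized, penalized, hF.expansion, norm_sub_add_sq, inner_smul_right, norm_smul, mul_pow,
    Real.norm_eq_abs, sq_abs]
  ring

theorem curvature_neg_of_certificate {c : ℝ} (hF : IsQuarticOnLines c F) {α a : ℝ} (ha : 0 < a)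
    {z x s : Vec d}
    (hlt : penalized α F z (x + -a • s) < penalized α F z (x + a • s)
      + inner ℝ (gradient (penalized α F z) (x + a • s)) ((x + -a • s) - (x + a • s))) :
    quadForm (hessian F x) s / 2 + α / 2 * ‖s‖ ^ 2
      + (iteratedFDeriv ℝ 3 F x fun _ => s) / 6 * a + 2 * (c * ‖s‖ ^ 4) * a ^ 2 < 0 := by
  have hdiff := differentiable_penalized α (hF.contDiff.differentiable (by simp)) z
  refine curvature_neg_of_quartic_below_tangent (hF.penalized_expansion α z x s) ha
    (hasDerivAt_comp_add_smul hdiff x s a) (hlt.trans_eq ?_)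
  rw [show (x + -a • s) - (x + a • s) = (-(2 * a)) • s by module, inner_smul_right]
  ring

variable {L R : ℝ}

theorem exploitPoint_le_of_certificate (hF : IsQuarticOnLines (L / 12) F) (hL : 0 ≤ L)
    (hR : 0 < R) {z u v : Vec d} (huv : ‖u - v‖ ≤ 2 * R)
    (hlt : penalized (42 * L * R ^ 2) F z u < penalized (42 * L * R ^ 2) F z v
      + inner ℝ (gradient (penalized (42 * L * R ^ 2) F z) v) (u - v)) :
    F (exploitPoint F ((1 / 2 : ℝ) • (u + v)) ((1 / ‖u - v‖) • (v - u)) R)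
      ≤ F u - 21 * L * R ^ 4 := by
  have hne : u - v ≠ 0 := by
    rintro h
    rw [h, inner_zero_right, sub_eq_zero.1 h, add_zero] at hlt
    exact hlt.false
  set c : Vec d := (1 / 2 : ℝ) • (u + v) with hc
  set s : Vec d := (1 / ‖u - v‖) • (v - u) with hs
  set a := ‖u - v‖ / 2 with ha
  have ha0 : 0 < a := half_pos (norm_pos_iff.2 hne)
  have hs1 : ‖s‖ = 1 := by
    rw [hs, norm_smul, norm_sub_rev v u, norm_div, norm_norm, norm_one,
      one_div_mul_cancel (norm_ne_zero_iff.2 hne)]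
  have has : a • s = (1 / 2 : ℝ) • (v - u) := by
    rw [hs, smul_smul, ha, div_mul_div_comm, mul_one, mul_comm 2, div_mul_cancel_left₀
      (norm_ne_zero_iff.2 hne), one_div]
  have hv : v = c + a • s := by rw [has, hc]; module
  have hu : u = c + -a • s := by rw [neg_smul, has, hc]; module
  rw [hu, hv] at hlt
  have hcurv := hF.curvature_neg_of_certificate ha0 hlt
  rw [hs1] at hcurv
  rw [hu, hF.expansion, hs1, one_pow, mul_one]
  refine le_sub_of_four_points hL hR ha0.le (by linarith) (by linarith) fun t ht => ?_
  refine (exploitPoint_le F c s R ht).trans_eq ?_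
  rw [hF.expansion, hs1, one_pow, mul_one]

end IsQuarticOnLines

/-! ### One step of the trust-region method -/

/-- The point returned by the trust-region routine from the point `u` and the optional certificate
of nonconvexity `v`. -/
def nextPoint (svd : Matrix (Fin d) (Fin d) ℝ → Vec d) (F : Vec d → ℝ) (ε α R : ℝ) (u : Vec d)
    (v : Option (Vec d)) : Vec d :=
  open Classical in
  if ‖gradient F u‖ ≤ ε then
    if -α ≤ quadForm (hessian F u) (svd (hessian F u)) then u
    else exploitPoint F u (svd (hessian F u)) R
  else
    match v with
    | none => u
    | some v => exploitPoint F ((1 / 2 : ℝ) • (u + v)) ((1 / ‖u - v‖) • (v - u)) R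

/-- Approximate second order stationarity; the bound on the quadratic form says that the Hessian
has no eigenvalue below `-δ`. -/
def IsApproxStationary (f : Vec d → ℝ) (ε δ : ℝ) (u : Vec d) : Prop :=
  ‖gradient f u‖ ≤ ε ∧ ∀ s, -δ * ‖s‖ ^ 2 ≤ quadForm (hessian f u) s

/-- The goal of a step from `z` to `y`: either `y` is approximately stationary or the objective has
dropped.  For the radius `R = L⁻¹ᐟ³ ε¹ᐟ³ / 24` the two accuracies are `ε` and `L¹ᐟ³ ε²ᐟ³`. -/
def IsSuccessfulStep (f : Vec d → ℝ) (L R : ℝ) (z y : Vec d) : Prop :=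
  IsApproxStationary f (13824 * L * R ^ 3) (576 * L * R ^ 2) y ∨ f y ≤ f z - 21 * L * R ^ 4

/-- The penalized third order model, with the penalty of the trust-region routine for the constant
`L₃ = 2 L` of the model. -/
def proxModel (L R : ℝ) (f : Vec d → ℝ) (z : Vec d) : Vec d → ℝ :=
  penalized (42 * L * R ^ 2) (taylorModel 3 L f z) z

theorem differentiable_taylorModel_three (L : ℝ) (f : Vec d → ℝ) (z : Vec d) :
    Differentiable ℝ (taylorModel 3 L f z) :=
  (contDiff_taylorModel_three L f z).differentiable (by simp)

theorem differentiable_proxModel (L R : ℝ) (f : Vec d → ℝ) (z : Vec d) :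
    Differentiable ℝ (proxModel L R f z) :=
  differentiable_penalized _ (differentiable_taylorModel_three L f z) z

theorem gradient_proxModel (L R : ℝ) (f : Vec d → ℝ) (z x : Vec d) :
    gradient (proxModel L R f z) x
      = gradient (taylorModel 3 L f z) x + (42 * L * R ^ 2) • (x - z) :=
  gradient_penalized _ (differentiable_taylorModel_three L f z) z x

theorem proxModel_self (L R : ℝ) (f : Vec d → ℝ) (z : Vec d) : proxModel L R f z z = f z := by
  rw [proxModel, penalized_self, taylorModel_self]

section NextPoint

variable {svd : Matrix (Fin d) (Fin d) ℝ → Vec d} {F : Vec d → ℝ} {L R : ℝ}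

theorem IsMinDirection.mul_norm_sq_le_quadForm (hsvd : IsMinDirection svd)
    {A : Matrix (Fin d) (Fin d) ℝ} (hA : A.IsSymm) (s : Vec d) :
    quadForm A (svd A) * ‖s‖ ^ 2 ≤ quadForm A s := by
  rw [quadForm_eq_norm_sq_mul A s, mul_comm]
  rcases eq_or_ne s 0 with rfl | hs
  · simp
  · gcongr
    exact hsvd.isMin A hA _ (NormedSpace.norm_normalize_eq_one_iff.2 hs)

theorem norm_nextPoint_none_sub_le (hR : 0 ≤ R) (hsvd : IsMinDirection svd)
    (hF : ContDiff ℝ 2 F) (ε α : ℝ) (u : Vec d) :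
    ‖nextPoint svd F ε α R u none - u‖ ≤ 12 * R := by
  unfold nextPoint
  split_ifs
  · simpa using hR
  · exact norm_exploitPoint_sub_le F u hR (hsvd.norm_eq _ (hessian_isSymm hF u))
  · simpa using hR

theorem IsQuarticOnLines.exploitPoint_svd_le (hF : IsQuarticOnLines (L / 12) F) (hL : 0 ≤ L)
    (hsvd : IsMinDirection svd) {u : Vec d}
    (hcurv : ¬-(42 * L * R ^ 2) ≤ quadForm (hessian F u) (svd (hessian F u))) :
    F (exploitPoint F u (svd (hessian F u)) R) ≤ F u - 21 * L * R ^ 4 :=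
  exploitPoint_le_of_quadForm hF hL
    (hsvd.norm_eq _ (hessian_isSymm (hF.contDiff.of_le (by norm_cast)) u)) (not_le.1 hcurv).le

theorem IsQuarticOnLines.nextPoint_none_le (hF : IsQuarticOnLines (L / 12) F) (hL : 0 ≤ L)
    (hsvd : IsMinDirection svd) (ε : ℝ) (u : Vec d) :
    F (nextPoint svd F ε (42 * L * R ^ 2) R u none) ≤ F u := by
  unfold nextPoint
  split_ifs with hgrad hcurv
  · exact le_rfl
  · exact (hF.exploitPoint_svd_le hL hsvd hcurv).trans (sub_le_self _ (by positivity))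
  · exact le_rfl

end NextPoint

/-- The standing assumptions on the objective, in terms of the trust-region radius `R`. -/
structure StepAssumptions (f : Vec d → ℝ) (L₁ L R : ℝ) : Prop where
  contDiff : ContDiff ℝ 3 f
  lip₁ : HasLipschitzDerivs 1 L₁ f Set.univ
  lip₃ : HasLipschitzDerivs 3 L f Set.univ
  L_pos : 0 < L
  R_pos : 0 < R
  le_L₁ : 576 * L * R ^ 2 ≤ L₁

namespace StepAssumptions

variable {f : Vec d → ℝ} {L₁ L R : ℝ} {svd : Matrix (Fin d) (Fin d) ℝ → Vec d}
  {z x u e w : Vec d}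

theorem mul_sq_pos (h : StepAssumptions f L₁ L R) : 0 < L * R ^ 2 :=
  mul_pos h.L_pos (pow_pos h.R_pos 2)

theorem L₁_pos (h : StepAssumptions f L₁ L R) : 0 < L₁ := by
  linarith [h.le_L₁, h.mul_sq_pos]

theorem mul_cube_le (h : StepAssumptions f L₁ L R) : 576 * L * R ^ 3 ≤ L₁ * R := by
  linarith [mul_le_mul_of_nonneg_right h.le_L₁ h.R_pos.le]

theorem le_taylorModel (h : StepAssumptions f L₁ L R) (z x : Vec d) :
    f x ≤ taylorModel 3 L f z x :=
  h.lip₃.le_taylorModel h.contDiff h.L_pos.le z x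

theorem taylorModel_le_proxModel (h : StepAssumptions f L₁ L R) (z x : Vec d) :
    taylorModel 3 L f z x ≤ proxModel L R f z x :=
  le_penalized (by linarith [h.mul_sq_pos]) _ _ _

theorem norm_gradient_sub_gradient_taylorModel_le (h : StepAssumptions f L₁ L R)
    (hx : ‖x - z‖ ≤ R) :
    ‖gradient f x - gradient (taylorModel 3 L f z) x‖ ≤ 3 * L * R ^ 3 :=
  h.lip₃.norm_gradient_sub_le h.contDiff h.L_pos.le h.R_pos hx

theorem norm_penalty_gradient_le (h : StepAssumptions f L₁ L R) (hx : ‖x - z‖ ≤ R) :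
    ‖(42 * L * R ^ 2) • (x - z)‖ ≤ 42 * L * R ^ 3 := by
  have hα : 0 ≤ 42 * L * R ^ 2 := by linarith [h.mul_sq_pos]
  rw [norm_smul, Real.norm_of_nonneg hα]
  exact (mul_le_mul_of_nonneg_left hx hα).trans_eq (by ring)

theorem isApproxStationary (h : StepAssumptions f L₁ L R) (hu : ‖u - z‖ ≤ R)
    (hgrad : ‖gradient (taylorModel 3 L f z) u‖ ≤ 6912 * L * R ^ 3)
    (hcurv : ∀ s, -(42 * L * R ^ 2) * ‖s‖ ^ 2 ≤ quadForm (hessian (taylorModel 3 L f z) u) s) :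
    IsApproxStationary f (13824 * L * R ^ 3) (576 * L * R ^ 2) u := by
  constructor
  · have hdiff := h.norm_gradient_sub_gradient_taylorModel_le hu
    have htri := norm_le_norm_add_norm_sub' (gradient f u) (gradient (taylorModel 3 L f z) u)
    linarith [mul_pos h.L_pos (pow_pos h.R_pos 3)]
  · intro s
    have hdiff :=
      (abs_le.1 (h.lip₃.abs_quadForm_hessian_sub_le h.contDiff h.L_pos.le h.R_pos hu s)).2
    linarith [hcurv s, mul_nonneg h.mul_sq_pos.le (sq_nonneg ‖s‖)]

theorem isSuccessfulStep_of_near (h : StepAssumptions f L₁ L R) (hsvd : IsMinDirection svd)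
    {v : Option (Vec d)} (hu : ‖u - z‖ ≤ R) (hle : taylorModel 3 L f z u ≤ f z)
    (hv : ‖gradient (taylorModel 3 L f z) u‖ ≤ 6912 * L * R ^ 3 ∨ ∃ y ∈ v, ‖y - z‖ ≤ R ∧
      proxModel L R f z u
        < proxModel L R f z y + inner ℝ (gradient (proxModel L R f z) y) (u - y)) :
    IsSuccessfulStep f L R z
      (nextPoint svd (taylorModel 3 L f z) (6912 * L * R ^ 3) (42 * L * R ^ 2) R u v) := by
  have hQ := isQuarticOnLines_taylorModel L f z
  unfold nextPoint
  split_ifs with hgrad hcurv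
  · refine Or.inl (h.isApproxStationary hu hgrad fun s => ?_)
    exact (mul_le_mul_of_nonneg_right hcurv (sq_nonneg _)).trans
      (hsvd.mul_norm_sq_le_quadForm (hessian_isSymm (hQ.contDiff.of_le (by norm_cast)) u) s)
  · have hdrop := hQ.exploitPoint_svd_le h.L_pos.le hsvd hcurv
    exact Or.inr ((h.le_taylorModel z _).trans (by linarith))
  · obtain ⟨y, rfl, hyz, hlt⟩ := hv.resolve_left hgrad
    have huy : ‖u - y‖ ≤ 2 * R := by
      linarith [norm_sub_le_norm_sub_add_norm_sub u z y, norm_sub_rev z y]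
    have hdrop := hQ.exploitPoint_le_of_certificate h.L_pos.le h.R_pos huy hlt
    exact Or.inr ((h.le_taylorModel z _).trans (by linarith))

theorem isSuccessfulStep_of_small_gradient (h : StepAssumptions f L₁ L R)
    (hsvd : IsMinDirection svd) (hx : ‖x - z‖ ≤ R) (hle : proxModel L R f z x ≤ f z)
    (hgrad : ‖gradient (proxModel L R f z) x‖ ≤ 3456 * L * R ^ 3) :
    IsSuccessfulStep f L R z
      (nextPoint svd (taylorModel 3 L f z) (6912 * L * R ^ 3) (42 * L * R ^ 2) R x none) := by
  refine h.isSuccessfulStep_of_near hsvd hx ((h.taylorModel_le_proxModel z x).trans hle)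
    (Or.inl ?_)
  have htri := norm_sub_le (gradient (proxModel L R f z) x) ((42 * L * R ^ 2) • (x - z))
  rw [gradient_proxModel, add_sub_cancel_right, ← gradient_proxModel] at htri
  linarith [h.norm_penalty_gradient_le hx, mul_pos h.L_pos (pow_pos h.R_pos 3)]

theorem drop_of_outside_ball (h : StepAssumptions f L₁ L R) (hsvd : IsMinDirection svd) (ε : ℝ)
    (hu : R ≤ ‖u - z‖) (hle : proxModel L R f z u ≤ f z) :
    f (nextPoint svd (taylorModel 3 L f z) ε (42 * L * R ^ 2) R u none)
      ≤ f z - 21 * L * R ^ 4 := by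
  have hmodel := (h.le_taylorModel z _).trans
    ((isQuarticOnLines_taylorModel L f z).nextPoint_none_le (R := R) h.L_pos.le hsvd ε u)
  have hsq : R ^ 2 ≤ ‖z - u‖ ^ 2 := by
    rw [norm_sub_rev]
    exact pow_le_pow_left₀ h.R_pos.le hu 2
  have hpenalty := mul_le_mul_of_nonneg_left hsq h.mul_sq_pos.le
  rw [proxModel, penalized] at hle
  linarith

/-! In the following lemmas the sampled point is `x + w`, where `e` is its offset from the gradient
step at `x`: the step length is `1 / L̂` with `L̂ = 2 L₁ + 42 L R²`, so that
`∇ proxModel (x) = L̂ (e - w)`, and the radius of the sampling ball is `432 L R³ / L̂`. -/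

theorem proxModel_add_lt (h : StepAssumptions f L₁ L R) (hx : ‖x - z‖ ≤ R)
    (hstep : gradient (proxModel L R f z) x = (2 * L₁ + 42 * L * R ^ 2) • (e - w))
    (hgrad : 3456 * L * R ^ 3 < ‖gradient (proxModel L R f z) x‖)
    (he : (2 * L₁ + 42 * L * R ^ 2) * ‖e‖ ≤ 432 * L * R ^ 3) (hw : ‖w‖ ≤ 3 * R) :
    proxModel L R f z (x + w) < proxModel L R f z x := by
  have hLhat : 0 < 2 * L₁ + 42 * L * R ^ 2 := by linarith [h.L₁_pos, h.mul_sq_pos]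
  have hquad := penalized_add_le (z := z) (42 * L * R ^ 2) (differentiable_taylorModel_three L f z)
    (h.lip₃.taylorModel_le_quadratic h.lip₁ h.contDiff h.L_pos.le h.L₁_pos.le (ρ := 4 * R)
      (z := z) (x := x) (w := w) (by linarith [h.R_pos]) (by linarith)
      (by linarith [h.le_L₁, h.mul_sq_pos]))
  change proxModel L R f z (x + w) ≤ proxModel L R f z x
    + inner ℝ (gradient (proxModel L R f z) x) w + _ at hquad
  have hlt : ‖e‖ < ‖e - w‖ := by
    rw [hstep, norm_smul, Real.norm_of_nonneg hLhat.le] at hgrad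
    refine lt_of_mul_lt_mul_left ?_ hLhat.le
    linarith [mul_pos h.L_pos (pow_pos h.R_pos 3)]
  have hinner : 2 * inner ℝ (e - w) w + ‖w‖ ^ 2 < 0 := by
    have hsq : ‖e‖ ^ 2 < ‖e - w‖ ^ 2 := by gcongr
    rw [norm_sub_sq_real] at hsq
    rw [inner_sub_left, real_inner_self_eq_norm_sq]
    linarith
  rw [hstep, real_inner_smul_left] at hquad
  linarith [mul_neg_of_pos_of_neg hLhat hinner]

theorem norm_offset_le (h : StepAssumptions f L₁ L R)
    (he : (2 * L₁ + 42 * L * R ^ 2) * ‖e‖ ≤ 432 * L * R ^ 3) : ‖e‖ ≤ 3 / 8 * R := by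
  have hmul : L₁ * ‖e‖ ≤ L₁ * (3 / 8 * R) := by
    linarith [h.mul_cube_le, mul_nonneg h.mul_sq_pos.le (norm_nonneg e)]
  exact le_of_mul_le_mul_left hmul h.L₁_pos

theorem norm_gradient_sub_gradient_proxModel_le (h : StepAssumptions f L₁ L R)
    (hx : ‖x - z‖ ≤ R) :
    ‖gradient f x - gradient (proxModel L R f z) x‖ ≤ 0.08 * L₁ * R := by
  rw [gradient_proxModel, ← sub_sub]
  have htri := norm_sub_le (gradient f x - gradient (taylorModel 3 L f z) x)
    ((42 * L * R ^ 2) • (x - z))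
  linarith [h.norm_gradient_sub_gradient_taylorModel_le hx, h.norm_penalty_gradient_le hx,
    h.mul_cube_le, mul_pos h.L_pos (pow_pos h.R_pos 3)]

theorem norm_gradient_le_of_far (h : StepAssumptions f L₁ L R) (hx : ‖x - z‖ ≤ R)
    (hstep : gradient (proxModel L R f z) x = (2 * L₁ + 42 * L * R ^ 2) • (e - w))
    (he : (2 * L₁ + 42 * L * R ^ 2) * ‖e‖ ≤ 432 * L * R ^ 3) :
    ‖gradient f x‖ ≤ 2.08 * L₁ * (‖w‖ + 3 / 8 * R) + 0.08 * L₁ * R := by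
  have hLhat : 0 ≤ 2 * L₁ + 42 * L * R ^ 2 := by linarith [h.L₁_pos, h.mul_sq_pos]
  have hLhat_le : 2 * L₁ + 42 * L * R ^ 2 ≤ 2.08 * L₁ := by linarith [h.le_L₁, h.mul_sq_pos]
  have hew : ‖e - w‖ ≤ ‖w‖ + 3 / 8 * R := by linarith [norm_sub_le e w, h.norm_offset_le he]
  have hsmul : ‖gradient (proxModel L R f z) x‖ ≤ 2.08 * L₁ * (‖w‖ + 3 / 8 * R) := by
    rw [hstep, norm_smul, Real.norm_of_nonneg hLhat]
    exact mul_le_mul hLhat_le hew (norm_nonneg _) (hLhat.trans hLhat_le)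
  linarith [norm_le_norm_add_norm_sub' (gradient f x) (gradient (proxModel L R f z) x),
    h.norm_gradient_sub_gradient_proxModel_le hx]

theorem inner_gradient_le_of_far (h : StepAssumptions f L₁ L R) (hx : ‖x - z‖ ≤ R)
    (hstep : gradient (proxModel L R f z) x = (2 * L₁ + 42 * L * R ^ 2) • (e - w))
    (he : (2 * L₁ + 42 * L * R ^ 2) * ‖e‖ ≤ 432 * L * R ^ 3) (hw : 3 * R ≤ ‖w‖) :
    inner ℝ (gradient f x) w ≤ -(2 * L₁) * ‖w‖ ^ 2 + 0.83 * L₁ * R * ‖w‖ := by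
  have hresidual : inner ℝ (gradient f x - gradient (proxModel L R f z) x) w
      ≤ 0.08 * L₁ * R * ‖w‖ :=
    (real_inner_le_norm _ _).trans
      (mul_le_mul_of_nonneg_right (h.norm_gradient_sub_gradient_proxModel_le hx) (norm_nonneg w))
  have hdescent : inner ℝ (e - w) w ≤ -(‖w‖ * (‖w‖ - 3 / 8 * R)) := by
    have hinner := (real_inner_le_norm e w).trans
      (mul_le_mul_of_nonneg_right (h.norm_offset_le he) (norm_nonneg w))
    rw [inner_sub_left, real_inner_self_eq_norm_sq]
    linarith
  have hnonneg : 0 ≤ ‖w‖ * (‖w‖ - 3 / 8 * R) :=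
    mul_nonneg (norm_nonneg w) (by linarith [h.R_pos])
  have hmain : inner ℝ (gradient (proxModel L R f z) x) w
      ≤ -(2 * L₁ * (‖w‖ * (‖w‖ - 3 / 8 * R))) := by
    rw [hstep, real_inner_smul_left]
    have := mul_le_mul_of_nonneg_left hdescent
      (show 0 ≤ 2 * L₁ + 42 * L * R ^ 2 by linarith [h.L₁_pos, h.mul_sq_pos])
    linarith [mul_nonneg h.mul_sq_pos.le hnonneg]
  rw [inner_sub_left] at hresidual
  linarith [mul_nonneg (mul_nonneg h.L₁_pos.le h.R_pos.le) (norm_nonneg w)]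

theorem taylorModel_le_of_far (h : StepAssumptions f L₁ L R) (hx : ‖x - z‖ ≤ R)
    (hstep : gradient (proxModel L R f z) x = (2 * L₁ + 42 * L * R ^ 2) • (e - w))
    (he : (2 * L₁ + 42 * L * R ^ 2) * ‖e‖ ≤ 432 * L * R ^ 3) (hw : 3 * R ≤ ‖w‖)
    (hw' : ‖w‖ ≤ 36 * R) : taylorModel 3 L f z (x + w) ≤ f x - L₁ * R ^ 2 := by
  have hL := h.L_pos
  have hf := h.lip₁.le_quadratic (h.contDiff.of_le (by norm_cast)) x w
  have hmodel := h.lip₃.taylorModel_le h.contDiff z (x + w)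
  have hdist : ‖x + w - z‖ ≤ 4 / 3 * ‖w‖ := by
    rw [add_sub_right_comm]
    linarith [norm_add_le (x - z) w]
  have hquartic : L * ‖x + w - z‖ ^ 4 ≤ L * (4 / 3 * ‖w‖) ^ 4 := by gcongr
  have hLw : L * ‖w‖ ^ 2 ≤ 36 ^ 2 / 576 * L₁ := by
    have hsq : L * ‖w‖ ^ 2 ≤ L * (36 * R) ^ 2 := by gcongr
    linarith [h.le_L₁]
  have hLw4 := mul_le_mul_of_nonneg_right hLw (sq_nonneg ‖w‖)
  have hww : 0 ≤ L₁ * ((‖w‖ - 3 * R) * ‖w‖) :=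
    mul_nonneg h.L₁_pos.le (mul_nonneg (by linarith) (norm_nonneg w))
  have hwR : 0 ≤ L₁ * ((‖w‖ - 3 * R) * R) :=
    mul_nonneg h.L₁_pos.le (mul_nonneg (by linarith) h.R_pos.le)
  have hRR : 0 < L₁ * R ^ 2 := mul_pos h.L₁_pos (pow_pos h.R_pos 2)
  simp only [Nat.factorial] at hmodel
  push_cast at hmodel
  linarith [h.inner_gradient_le_of_far hx hstep he hw]

theorem le_of_very_far (h : StepAssumptions f L₁ L R) (hx : ‖x - z‖ ≤ R)
    (hstep : gradient (proxModel L R f z) x = (2 * L₁ + 42 * L * R ^ 2) • (e - w))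
    (he : (2 * L₁ + 42 * L * R ^ 2) * ‖e‖ ≤ 432 * L * R ^ 3) (hw : 36 * R ≤ ‖w‖) {y : Vec d}
    (hy : ‖y - (x + w)‖ ≤ 12 * R) : f y ≤ f x - L₁ * R ^ 2 := by
  have hR := h.R_pos
  have hL₁ := h.L₁_pos
  set s := y - (x + w) with hs
  have hf := h.lip₁.le_quadratic (h.contDiff.of_le (by norm_cast)) x (w + s)
  rw [show x + (w + s) = y by rw [hs]; abel, inner_add_right] at hf
  have hinner := (real_inner_le_norm (gradient f x) s).trans
    (mul_le_mul (h.norm_gradient_le_of_far hx hstep he) hy (norm_nonneg _) (by positivity))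
  have hsq : L₁ / 2 * ‖w + s‖ ^ 2 ≤ L₁ / 2 * (‖w‖ + 12 * R) ^ 2 := by
    gcongr
    exact (norm_add_le _ _).trans (by linarith)
  have hww : 0 ≤ L₁ * ((‖w‖ - 36 * R) * ‖w‖) :=
    mul_nonneg hL₁.le (mul_nonneg (by linarith) (norm_nonneg w))
  have hwR : 0 ≤ L₁ * ((‖w‖ - 36 * R) * R) :=
    mul_nonneg hL₁.le (mul_nonneg (by linarith) hR.le)
  have hRR : 0 < L₁ * R ^ 2 := by positivity
  linarith [h.inner_gradient_le_of_far hx hstep he (by linarith)]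

theorem drop_of_far (h : StepAssumptions f L₁ L R) (hsvd : IsMinDirection svd) (ε : ℝ)
    (hx : ‖x - z‖ ≤ R) (hle : proxModel L R f z x ≤ f z)
    (hstep : gradient (proxModel L R f z) x = (2 * L₁ + 42 * L * R ^ 2) • (e - w))
    (he : (2 * L₁ + 42 * L * R ^ 2) * ‖e‖ ≤ 432 * L * R ^ 3) (hw : 3 * R ≤ ‖w‖) :
    f (nextPoint svd (taylorModel 3 L f z) ε (42 * L * R ^ 2) R (x + w) none)
      ≤ f z - 21 * L * R ^ 4 := by
  have hQ := isQuarticOnLines_taylorModel L f z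
  have hfx : f x ≤ f z :=
    (h.le_taylorModel z x).trans ((h.taylorModel_le_proxModel z x).trans hle)
  have hdrop : 21 * L * R ^ 4 ≤ L₁ * R ^ 2 := by
    linarith [mul_le_mul_of_nonneg_right h.le_L₁ (sq_nonneg R),
      mul_pos h.L_pos (pow_pos h.R_pos 4)]
  rcases le_total ‖w‖ (36 * R) with hw' | hw'
  · have hmodel := h.taylorModel_le_of_far hx hstep he hw hw'
    have hnext := hQ.nextPoint_none_le (R := R) h.L_pos.le hsvd ε (x + w)
    linarith [h.le_taylorModel z
      (nextPoint svd (taylorModel 3 L f z) ε (42 * L * R ^ 2) R (x + w) none)]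
  · linarith [h.le_of_very_far hx hstep he hw' (norm_nextPoint_none_sub_le h.R_pos.le hsvd
      (hQ.contDiff.of_le (by norm_cast)) ε (42 * L * R ^ 2) (x + w))]

end StepAssumptions

/-! ### The cutting plane method -/

theorem cuttingPlane_fst (centre : Set (Vec d) → Vec d) (h : Vec d → ℝ) (x₀ : Vec d) (R : ℝ)
    (N : ℕ) : (cuttingPlane centre h x₀ R N).1 = Metric.closedBall x₀ R ∩
      ⋂ i : Fin (N + 1), cut (gradient h (cuttingPlane centre h x₀ R i).2)
        (cuttingPlane centre h x₀ R i).2 := by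
  induction N with
  | zero => simp [cuttingPlane, Set.iInter_const]
  | succ N ih =>
    have hsucc : (cuttingPlane centre h x₀ R (N + 1)).1 = (cuttingPlane centre h x₀ R N).1 ∩
        cut (gradient h (cuttingPlane centre h x₀ R (N + 1)).2)
          (cuttingPlane centre h x₀ R (N + 1)).2 := rfl
    rw [hsucc, ih, Set.inter_assoc]
    congr 1
    ext y
    simp only [Set.mem_inter_iff, Set.mem_iInter]
    exact (Fin.forall_fin_succ' (P := fun i : Fin (N + 1 + 1) =>
      y ∈ cut (gradient h (cuttingPlane centre h x₀ R i).2)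
        (cuttingPlane centre h x₀ R i).2)).symm

theorem IsCuttingPlaneCentre.norm_sub_le {centre : Set (Vec d) → Vec d} {τ : ℝ}
    (hc : IsCuttingPlaneCentre centre τ) {h : Vec d → ℝ} (hh : Differentiable ℝ h) (x₀ : Vec d)
    {R : ℝ} (hR : 0 < R) (t : ℕ) : ‖(cuttingPlane centre h x₀ R t).2 - x₀‖ ≤ R := by
  cases t with
  | zero => simpa [cuttingPlane] using hR.le
  | succ t =>
    have hmem := hc.mem h hh x₀ R hR t
    rw [cuttingPlane_fst] at hmem
    exact mem_closedBall_iff_norm.1 hmem.1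

theorem lt_add_inner_of_notMem_cut {g c u : Vec d} {a b : ℝ} (hab : a < b)
    (hu : u ∉ cut g c) : a < b + inner ℝ g (u - c) := by
  by_contra! hle
  refine hu ⟨by linarith, ?_⟩
  rintro rfl
  rw [inner_zero_left] at hle
  linarith

/-! ### The trust-region routine as a function -/

/-- The data of a call of the trust-region routine: the two subroutines, the objective `F`, the
starting point `z`, the accuracy `ε`, the smoothness constant `Lhat` and the weight `α` of the
penalized objective, the radius `R` and the number `N` of cutting plane steps. -/
structure TrustRegionData (d : ℕ) where
  centre : Set (Vec d) → Vec d
  svd : Matrix (Fin d) (Fin d) ℝ → Vec d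
  F : Vec d → ℝ
  z : Vec d
  ε : ℝ
  Lhat : ℝ
  α : ℝ
  R : ℝ
  N : ℕ

namespace TrustRegionData

variable (D : TrustRegionData d)

/-- The penalized objective. -/
def hat : Vec d → ℝ := penalized D.α D.F D.z

/-- The query points of the cutting plane method. -/
def query (t : ℕ) : Vec d := (cuttingPlane D.centre D.hat D.z D.R t).2

/-- The final region of the cutting plane method. -/
def region : Set (Vec d) := (cuttingPlane D.centre D.hat D.z D.R D.N).1

/-- The best query point. -/
def best : Vec d :=
  argminFirst D.hat (D.query 0) ((List.range D.N).map fun t => D.query (t + 1))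

/-- The best query point is almost stationary, so that no sampling is needed. -/
def Accepts : Prop := ‖gradient D.hat D.best‖ ≤ D.ε / 2

/-- The point of the sampling ball that corresponds to the point `w` of the unit ball. -/
def candidate (w : Vec d) : Vec d :=
  D.best - (1 / D.Lhat) • gradient D.hat D.best + (D.ε / 2 / (8 * D.Lhat)) • w

/-- The sampling from the stream `U` terminates. -/
def Escapes (U : ℕ → Vec d) : Prop := ∃ k, D.candidate (U k) ∉ D.region

/-- The index of the first sample outside the region (`0` if there is none). -/
def firstEscape (U : ℕ → Vec d) : ℕ :=
  open Classical in if h : D.Escapes U then Nat.find h else 0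

/-- The number of draws. -/
def draws (U : ℕ → Vec d) : ℕ :=
  open Classical in if D.Accepts then 0 else D.firstEscape U + 1

/-- The point `u` at which the search for a certificate ends. -/
def sample (U : ℕ → Vec d) : Vec d :=
  open Classical in if D.Accepts then D.best else D.candidate (U (D.firstEscape U))

/-- The first query point that, together with `u`, certifies nonconvexity. -/
def violatedQuery (u : Vec d) : Option (Vec d) :=
  open Classical in ((List.range (D.N + 1)).map D.query).find? fun v =>
    decide (D.hat u < D.hat v + inner ℝ (gradient D.hat v) (u - v))

/-- The certificate `v` of nonconvexity for the point `u`. -/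
def certificate (u : Vec d) : Option (Vec d) :=
  open Classical in
  if D.Accepts then none else if ‖u - D.z‖ ≤ D.R then D.violatedQuery u else none

/-- The point returned by the routine. -/
def next (U : ℕ → Vec d) : Vec d :=
  nextPoint D.svd D.F D.ε D.α D.R (D.sample U) (D.certificate (D.sample U))

variable {D} {U : ℕ → Vec d} {u : Vec d}

theorem exists_best_eq_query : ∃ t, D.best = D.query t := by
  rcases List.mem_cons.1 (argminFirst_mem D.hat (D.query 0) _) with hzero | hsucc
  · exact ⟨0, hzero⟩
  · obtain ⟨t, -, ht⟩ := List.mem_map.1 hsucc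
    exact ⟨t + 1, ht.symm⟩

theorem hat_best_le {t : ℕ} (ht : t ≤ D.N) : D.hat D.best ≤ D.hat (D.query t) := by
  refine argminFirst_le D.hat ?_
  cases t with
  | zero => exact List.mem_cons_self
  | succ t => exact List.mem_cons_of_mem _ (List.mem_map.2 ⟨t, List.mem_range.2 ht, rfl⟩)

theorem firstEscape_of_escapes (h : D.Escapes U) :
    D.firstEscape U = open Classical in Nat.find h := dif_pos h

theorem sample_of_accepts (h : D.Accepts) (U : ℕ → Vec d) : D.sample U = D.best := if_pos h

theorem sample_of_not_accepts (h : ¬D.Accepts) (U : ℕ → Vec d) :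
    D.sample U = D.candidate (U (D.firstEscape U)) := if_neg h

theorem draws_of_accepts (h : D.Accepts) (U : ℕ → Vec d) : D.draws U = 0 := if_pos h

theorem draws_of_not_accepts (h : ¬D.Accepts) (U : ℕ → Vec d) :
    D.draws U = D.firstEscape U + 1 := if_neg h

theorem certificate_of_accepts (h : D.Accepts) (u : Vec d) : D.certificate u = none := if_pos h

theorem certificate_of_norm_le (h : ¬D.Accepts) (hu : ‖u - D.z‖ ≤ D.R) :
    D.certificate u = D.violatedQuery u := by
  rw [certificate, if_neg h, if_pos hu]

theorem certificate_of_lt_norm (hu : D.R < ‖u - D.z‖) : D.certificate u = none := by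
  rw [certificate, if_neg (not_le.2 hu), ite_self]

theorem sample_notMem_region (hA : ¬D.Accepts) (h : D.Escapes U) : D.sample U ∉ D.region := by
  classical
  rw [sample_of_not_accepts hA, firstEscape_of_escapes h]
  exact Nat.find_spec h

theorem exists_notMem_cut (hu : ‖u - D.z‖ ≤ D.R) (hS : u ∉ D.region) :
    ∃ t ≤ D.N, u ∉ cut (gradient D.hat (D.query t)) (D.query t) := by
  by_contra! hcut
  refine hS ?_
  rw [region, cuttingPlane_fst]
  exact ⟨mem_closedBall_iff_norm.2 hu,
    Set.mem_iInter.2 fun i => hcut i (Nat.lt_succ_iff.1 i.2)⟩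

theorem exists_mem_violatedQuery (hu : ‖u - D.z‖ ≤ D.R) (hS : u ∉ D.region)
    (hlt : D.hat u < D.hat D.best) :
    ∃ t, D.query t ∈ D.violatedQuery u ∧
      D.hat u < D.hat (D.query t) + inner ℝ (gradient D.hat (D.query t)) (u - D.query t) := by
  classical
  obtain ⟨t, ht, hcut⟩ := exists_notMem_cut hu hS
  have hviolated := lt_add_inner_of_notMem_cut (hlt.trans_le (hat_best_le ht)) hcut
  have hsome : (D.violatedQuery u).isSome := by
    rw [violatedQuery, List.find?_isSome]
    exact ⟨D.query t, List.mem_map_of_mem (List.mem_range.2 (Nat.lt_succ_of_le ht)),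
      by simpa using hviolated⟩
  obtain ⟨v, hv⟩ := Option.isSome_iff_exists.1 hsome
  obtain ⟨s, -, rfl⟩ := List.mem_map.1 (List.mem_of_find?_eq_some hv)
  exact ⟨s, hv, by simpa using List.find?_some hv⟩

end TrustRegionData

/-- The data of the call `cuttingTrustRegion T centre τ svd F z ε L₁ L₃ R U`. -/
def trustRegionData (centre : Set (Vec d) → Vec d) (τ : ℝ)
    (svd : Matrix (Fin d) (Fin d) ℝ → Vec d) (F : Vec d → ℝ) (z : Vec d) (ε L₁ L₃ R : ℝ) :
    TrustRegionData d where
  centre := centre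
  svd := svd
  F := F
  z := z
  ε := ε
  Lhat := L₁ + 21 * L₃ * R ^ 2
  α := 21 * L₃ * R ^ 2
  R := R
  N := ⌈(d : ℝ) / τ * Real.log (16 * (L₁ + 21 * L₃ * R ^ 2) * R / (ε / 2))⌉₊

/-- The data of the call of the trust-region routine on the quartic model of `f` at `z`. In terms
of the radius `R = L⁻¹ᐟ³ ε¹ᐟ³ / 24` its accuracy `ε / 2` is `6912 L R³`. -/
def modelTrustRegionData (centre : Set (Vec d) → Vec d) (τ : ℝ)
    (svd : Matrix (Fin d) (Fin d) ℝ → Vec d) (f : Vec d → ℝ) (L₁ L R : ℝ) (z : Vec d) :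
    TrustRegionData d :=
  trustRegionData centre τ svd (taylorModel 3 L f z) z (6912 * L * R ^ 3) (2 * L₁) (2 * L) R

section ModelTrustRegionData

variable {centre : Set (Vec d) → Vec d} {τ : ℝ} {svd : Matrix (Fin d) (Fin d) ℝ → Vec d}
  {f : Vec d → ℝ} {L₁ L R : ℝ} {z : Vec d} {U : ℕ → Vec d}

local notation "𝒟" => modelTrustRegionData centre τ svd f L₁ L R

theorem modelTrustRegionData_α : (𝒟 z).α = 42 * L * R ^ 2 := by
  rw [modelTrustRegionData, trustRegionData]
  ring

theorem modelTrustRegionData_Lhat : (𝒟 z).Lhat = 2 * L₁ + 42 * L * R ^ 2 := by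
  rw [modelTrustRegionData, trustRegionData]
  ring

theorem modelTrustRegionData_hat : (𝒟 z).hat = proxModel L R f z := by
  rw [TrustRegionData.hat, modelTrustRegionData_α]
  rfl

theorem modelTrustRegionData_accepts_iff :
    (𝒟 z).Accepts ↔ ‖gradient (proxModel L R f z) (𝒟 z).best‖ ≤ 3456 * L * R ^ 3 := by
  rw [TrustRegionData.Accepts, modelTrustRegionData_hat, modelTrustRegionData, trustRegionData]
  ring_nf

theorem modelTrustRegionData_next :
    (𝒟 z).next U =
      nextPoint svd (taylorModel 3 L f z) (6912 * L * R ^ 3) (42 * L * R ^ 2) R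
        ((𝒟 z).sample U) ((𝒟 z).certificate ((𝒟 z).sample U)) := by
  rw [TrustRegionData.next, modelTrustRegionData_α]
  rfl

theorem proxModel_best_le : proxModel L R f z (𝒟 z).best ≤ f z := by
  have hle := (𝒟 z).hat_best_le (Nat.zero_le _)
  rw [modelTrustRegionData_hat] at hle
  exact hle.trans_eq (proxModel_self L R f z)

namespace StepAssumptions

theorem norm_query_sub_le (h : StepAssumptions f L₁ L R) (hc : IsCuttingPlaneCentre centre τ)
    (t : ℕ) : ‖(𝒟 z).query t - z‖ ≤ R := by
  rw [TrustRegionData.query, modelTrustRegionData_hat]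
  exact hc.norm_sub_le (differentiable_proxModel L R f z) z h.R_pos t

theorem norm_best_sub_le (h : StepAssumptions f L₁ L R) (hc : IsCuttingPlaneCentre centre τ) :
    ‖(𝒟 z).best - z‖ ≤ R := by
  obtain ⟨t, ht⟩ := (𝒟 z).exists_best_eq_query
  exact ht ▸ h.norm_query_sub_le hc t

theorem exists_sample_eq_best_add (h : StepAssumptions f L₁ L R) (hU : ∀ k, ‖U k‖ ≤ 1)
    (hA : ¬(𝒟 z).Accepts) :
    ∃ e w, (𝒟 z).sample U = (𝒟 z).best + w ∧
      gradient (proxModel L R f z) (𝒟 z).best = (2 * L₁ + 42 * L * R ^ 2) • (e - w) ∧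
      (2 * L₁ + 42 * L * R ^ 2) * ‖e‖ ≤ 432 * L * R ^ 3 := by
  set D := 𝒟 z with hD
  have hLhat : 0 < 2 * L₁ + 42 * L * R ^ 2 := by linarith [h.L₁_pos, h.mul_sq_pos]
  have hnum : 0 ≤ 432 * L * R ^ 3 := by linarith [mul_pos h.L_pos (pow_pos h.R_pos 3)]
  have hradius : D.ε / 2 / (8 * D.Lhat) = 432 * L * R ^ 3 / (2 * L₁ + 42 * L * R ^ 2) := by
    rw [hD, modelTrustRegionData_Lhat, modelTrustRegionData, trustRegionData]
    field_simp
    ring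
  refine ⟨(D.ε / 2 / (8 * D.Lhat)) • U (D.firstEscape U), (D.ε / 2 / (8 * D.Lhat))
    • U (D.firstEscape U) - (1 / D.Lhat) • gradient D.hat D.best, ?_, ?_, ?_⟩
  · rw [TrustRegionData.sample_of_not_accepts hA, TrustRegionData.candidate]
    abel
  · rw [sub_sub_cancel, hD, modelTrustRegionData_Lhat, modelTrustRegionData_hat, smul_smul,
      mul_one_div_cancel hLhat.ne', one_smul]
  · rw [hradius, norm_smul, Real.norm_of_nonneg (by positivity), ← mul_assoc,
      mul_div_cancel₀ _ hLhat.ne']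
    exact mul_le_of_le_one_right hnum (hU _)

theorem isSuccessfulStep_of_accepts (h : StepAssumptions f L₁ L R)
    (hc : IsCuttingPlaneCentre centre τ) (hsvd : IsMinDirection svd)
    (hA : (𝒟 z).Accepts) (U : ℕ → Vec d) :
    IsSuccessfulStep f L R z ((𝒟 z).next U) := by
  rw [modelTrustRegionData_next, TrustRegionData.sample_of_accepts hA,
    TrustRegionData.certificate_of_accepts hA]
  exact h.isSuccessfulStep_of_small_gradient hsvd (h.norm_best_sub_le hc) proxModel_best_le
    (modelTrustRegionData_accepts_iff.1 hA)

theorem isSuccessfulStep_of_escapes (h : StepAssumptions f L₁ L R)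
    (hc : IsCuttingPlaneCentre centre τ) (hsvd : IsMinDirection svd) (hU : ∀ k, ‖U k‖ ≤ 1)
    (hA : ¬(𝒟 z).Accepts) (hesc : (𝒟 z).Escapes U) :
    IsSuccessfulStep f L R z ((𝒟 z).next U) := by
  have hbest := h.norm_best_sub_le (svd := svd) (z := z) hc
  have hle := proxModel_best_le (centre := centre) (τ := τ) (svd := svd) (f := f) (L₁ := L₁)
    (L := L) (R := R) (z := z)
  have hgrad := not_le.1 (mt modelTrustRegionData_accepts_iff.2 hA)
  have hout := TrustRegionData.sample_notMem_region hA hesc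
  obtain ⟨e, w, hsample, hstep, he⟩ := h.exists_sample_eq_best_add hU hA
  rw [modelTrustRegionData_next]
  set D := 𝒟 z with hD
  have hfar (hu : R < ‖D.sample U - z‖) : D.certificate (D.sample U) = none :=
    TrustRegionData.certificate_of_lt_norm hu
  rw [hsample] at hout hfar ⊢
  rcases le_total ‖w‖ (3 * R) with hw | hw
  · have hlt := h.proxModel_add_lt hbest hstep hgrad he hw
    rcases le_or_gt ‖D.best + w - z‖ R with hin | hin
    · obtain ⟨t, ht, hviolated⟩ :=
        D.exists_mem_violatedQuery hin hout (by rwa [modelTrustRegionData_hat])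
      rw [modelTrustRegionData_hat] at hviolated
      rw [TrustRegionData.certificate_of_norm_le hA hin]
      exact h.isSuccessfulStep_of_near hsvd hin
        ((h.taylorModel_le_proxModel _ _).trans (hlt.le.trans hle))
        (Or.inr ⟨_, ht, h.norm_query_sub_le hc t, hviolated⟩)
    · rw [hfar hin]
      exact Or.inr (h.drop_of_outside_ball hsvd _ hin.le (hlt.le.trans hle))
  · have hin : R < ‖D.best + w - z‖ := by
      have htri := norm_sub_le (D.best + w - z) (D.best - z)
      rw [sub_sub_sub_cancel_right, add_sub_cancel_left] at htri
      linarith [h.R_pos]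
    rw [hfar hin]
    exact Or.inr (h.drop_of_far hsvd _ hbest hle hstep he hw)

theorem isSuccessfulStep_next (h : StepAssumptions f L₁ L R)
    (hc : IsCuttingPlaneCentre centre τ) (hsvd : IsMinDirection svd) (hU : ∀ k, ‖U k‖ ≤ 1)
    (hD : (𝒟 z).Accepts ∨ (𝒟 z).Escapes U) :
    IsSuccessfulStep f L R z ((𝒟 z).next U) := by
  by_cases hA : (𝒟 z).Accepts
  · exact h.isSuccessfulStep_of_accepts hc hsvd hA U
  · exact h.isSuccessfulStep_of_escapes hc hsvd hU hA (hD.resolve_left hA)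

end StepAssumptions

end ModelTrustRegionData

/-! ### Running times -/

/-- The computation `x` returns `a` within time `t`. -/
def Comp.ReturnsWithin {α : Type} (x : Comp α) (a : α) (t : ℝ) : Prop :=
  ∃ s ≤ t, x.Returns a s

namespace Comp.ReturnsWithin

variable {α β : Type} {x y : Comp α} {g : α → Comp β} {a : α} {b : β} {s t : ℝ}

theorem pure (a : α) : (Pure.pure a : Comp α).ReturnsWithin a 0 := ⟨0, le_rfl, rfl⟩

theorem tick (c : ℝ) : (_root_.tick c).ReturnsWithin () c := ⟨c, le_rfl, rfl⟩

theorem mono (hx : x.ReturnsWithin a s) (hst : s ≤ t) : x.ReturnsWithin a t := by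
  obtain ⟨r, hr, hx⟩ := hx
  exact ⟨r, hr.trans hst, hx⟩

theorem bind (hx : x.ReturnsWithin a s) (hg : (g a).ReturnsWithin b t) :
    (x >>= g).ReturnsWithin b (s + t) := by
  obtain ⟨s', hs, hx⟩ := hx
  obtain ⟨t', ht, hg⟩ := hg
  refine ⟨s' + t', add_le_add hs ht, ?_⟩
  unfold Comp.Returns at *
  subst hx
  change Option.bind (g a) _ = _
  rw [hg]
  rfl

theorem ite_pos {p : Prop} [Decidable p] (hp : p) (hx : x.ReturnsWithin a t) :
    (if p then x else y).ReturnsWithin a t := by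
  rwa [if_pos hp]

theorem ite_neg {p : Prop} [Decidable p] (hp : ¬p) (hy : y.ReturnsWithin a t) :
    (if p then x else y).ReturnsWithin a t := by
  rwa [if_neg hp]

end Comp.ReturnsWithin

open Comp

theorem exploitNC_returnsWithin (T : Costs) (F : Vec d → ℝ) (c s : Vec d) (R : ℝ) :
    (exploitNC T F c s R).ReturnsWithin (exploitPoint F c s R) (4 * (T.eval + T.vec)) :=
  .mono (.bind (.tick _) (.pure _)) (add_zero _).le

section TrustRegion

variable {T : Costs} {D : TrustRegionData d} {U : ℕ → Vec d}

theorem sampleOutside_returnsWithin (c : ℝ) (h : D.Escapes U) :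
    (sampleOutside c D.region (D.best - (1 / D.Lhat) • gradient D.hat D.best)
      (D.ε / 2 / (8 * D.Lhat)) U).ReturnsWithin
      (D.candidate (U (D.firstEscape U)), D.firstEscape U + 1)
      (((D.firstEscape U + 1 : ℕ) : ℝ) * c) := by
  classical
  rw [TrustRegionData.firstEscape_of_escapes h]
  refine ⟨_, le_rfl, ?_⟩
  unfold Returns sampleOutside
  exact dif_pos h

theorem nonconvexityCertificate_returnsWithin_of_accepts (hvec : 0 ≤ T.vec) (heval : 0 ≤ T.eval)
    (hA : D.Accepts) (U : ℕ → Vec d) :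
    (nonconvexityCertificate T D.hat D.N (cuttingPlane D.centre D.hat D.z D.R) D.Lhat
      (D.ε / 2) D.R U).ReturnsWithin (D.sample U, D.certificate (D.sample U), D.draws U)
      (T.eval + (2 * D.N + 7) * T.vec + D.draws U * ((D.N + 3) * T.vec)) := by
  classical
  rw [TrustRegionData.sample_of_accepts hA, TrustRegionData.certificate_of_accepts hA,
    TrustRegionData.draws_of_accepts hA]
  refine .mono (.bind (.tick _) (.bind (.tick _) (.ite_pos hA (.pure _)))) ?_
  have hN : 0 ≤ D.N * T.vec := by positivity
  push_cast
  linarith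

theorem nonconvexityCertificate_returnsWithin_of_escapes (hvec : 0 ≤ T.vec) (heval : 0 ≤ T.eval)
    (hA : ¬D.Accepts) (hesc : D.Escapes U) :
    (nonconvexityCertificate T D.hat D.N (cuttingPlane D.centre D.hat D.z D.R) D.Lhat
      (D.ε / 2) D.R U).ReturnsWithin (D.sample U, D.certificate (D.sample U), D.draws U)
      (T.eval + (2 * D.N + 7) * T.vec + D.draws U * ((D.N + 3) * T.vec)) := by
  classical
  have hN : 0 ≤ D.N * T.vec := by positivity
  rw [TrustRegionData.draws_of_not_accepts hA]
  have hsample := TrustRegionData.sample_of_not_accepts hA U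
  rcases le_or_gt ‖D.sample U - D.z‖ D.R with hnear | hfar
  · rw [TrustRegionData.certificate_of_norm_le hA hnear]
    rw [hsample] at hnear ⊢
    refine .mono (.bind (.tick _) (.bind (.tick _) (.ite_neg hA (.bind (.tick _)
      (.bind (sampleOutside_returnsWithin _ hesc) (.bind (.tick _) (.ite_pos hnear
        (.bind (.tick _) (.pure _))))))))) ?_
    linarith
  · rw [TrustRegionData.certificate_of_lt_norm hfar]
    rw [hsample] at hfar ⊢
    refine .mono (.bind (.tick _) (.bind (.tick _) (.ite_neg hA (.bind (.tick _)
      (.bind (sampleOutside_returnsWithin _ hesc) (.bind (.tick _)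
        (.ite_neg (not_le.2 hfar) (.pure _)))))))) ?_
    linarith

theorem nonconvexityCertificate_returnsWithin (hvec : 0 ≤ T.vec) (heval : 0 ≤ T.eval)
    (h : D.Accepts ∨ D.Escapes U) :
    (nonconvexityCertificate T D.hat D.N (cuttingPlane D.centre D.hat D.z D.R) D.Lhat
      (D.ε / 2) D.R U).ReturnsWithin (D.sample U, D.certificate (D.sample U), D.draws U)
      (T.eval + (2 * D.N + 7) * T.vec + D.draws U * ((D.N + 3) * T.vec)) := by
  by_cases hA : D.Accepts
  · exact nonconvexityCertificate_returnsWithin_of_accepts hvec heval hA U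
  · exact nonconvexityCertificate_returnsWithin_of_escapes hvec heval hA (h.resolve_left hA)

theorem cuttingTrustRegion_returnsWithin (hvec : 0 ≤ T.vec) (heval : 0 ≤ T.eval)
    (hsvd : 0 ≤ T.svd) {centre : Set (Vec d) → Vec d} {τ : ℝ}
    {svd : Matrix (Fin d) (Fin d) ℝ → Vec d} {F : Vec d → ℝ} {z : Vec d} {ε L₁ L₃ R : ℝ}
    (hD : D = trustRegionData centre τ svd F z ε L₁ L₃ R) (h : D.Accepts ∨ D.Escapes U) :
    (cuttingTrustRegion T centre τ svd F z ε L₁ L₃ R U).ReturnsWithin (D.next U, D.draws U)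
      (D.N * (T.centre + T.eval + 3 * T.vec) + 7 * T.eval + 13 * T.vec + T.svd
        + D.draws U * ((D.N + 3) * T.vec)) := by
  classical
  have hcertificate := nonconvexityCertificate_returnsWithin hvec heval h
  have hN : ⌈(d : ℝ) / τ * Real.log (16 * (L₁ + 21 * L₃ * R ^ 2) * R / (ε / 2))⌉₊ = D.N := by
    rw [hD, trustRegionData]
  unfold TrustRegionData.next nextPoint
  by_cases hgrad : ‖gradient D.F (D.sample U)‖ ≤ D.ε
  · rw [if_pos hgrad]
    by_cases hcurv : -D.α ≤ quadForm (hessian D.F (D.sample U))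
        (D.svd (hessian D.F (D.sample U)))
    · rw [if_pos hcurv]
      subst hD
      exact .mono (.bind (.tick _) (.bind hcertificate (.bind (.tick _)
        (.ite_pos hgrad (.bind (.tick _) (.ite_pos hcurv (.pure _))))))) (by rw [hN]; linarith)
    · rw [if_neg hcurv]
      subst hD
      exact .mono (.bind (.tick _) (.bind hcertificate (.bind (.tick _)
        (.ite_pos hgrad (.bind (.tick _) (.ite_neg hcurv
          (.bind (exploitNC_returnsWithin _ _ _ _ _) (.pure _)))))))) (by rw [hN]; linarith)
  · rw [if_neg hgrad]
    cases hv : D.certificate (D.sample U) with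
    | none =>
      rw [hv] at hcertificate
      subst hD
      exact .mono (.bind (.tick _) (.bind hcertificate (.bind (.tick _)
        (.ite_neg hgrad (.pure _))))) (by rw [hN]; linarith)
    | some v =>
      rw [hv] at hcertificate
      subst hD
      exact .mono (.bind (.tick _) (.bind hcertificate (.bind (.tick _)
        (.ite_neg hgrad (.bind (exploitNC_returnsWithin _ _ _ _ _) (.pure _))))))
          (by rw [hN]; linarith)

end TrustRegion

open MeasureTheory ProbabilityTheory

/-! ### Measurability of the trust-region step -/

section Measurability

variable {Ω β γ : Type*} [MeasurableSpace Ω] [MeasurableSpace β] [MeasurableSpace γ]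

theorem measurable_argminFirst {β : Type} [MeasurableSpace β] {φ : Ω → β → ℝ}
    (hφ : Measurable (Function.uncurry φ)) {a : Ω → β} (ha : Measurable a) (l : List (Ω → β))
    (hl : ∀ x ∈ l, Measurable x) :
    Measurable fun ω => argminFirst (φ ω) (a ω) (l.map fun x => x ω) := by
  classical
  induction l generalizing a with
  | nil => exact ha
  | cons x l ih =>
    obtain ⟨hx, hl⟩ := List.forall_mem_cons.1 hl
    simp only [List.map_cons, argminFirst, List.foldl_cons]
    exact ih (Measurable.ite (measurableSet_lt (hφ.comp (measurable_id.prodMk hx))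
      (hφ.comp (measurable_id.prodMk ha))) hx ha) hl

theorem measurable_elim_find? {p : Ω → β → Prop} [∀ ω, DecidablePred (p ω)]
    (hp : MeasurableSet {q : Ω × β | p q.1 q.2}) {g₀ : Ω → γ} (hg₀ : Measurable g₀)
    {g : Ω → β → γ} (hg : Measurable (Function.uncurry g)) (l : List (Ω → β))
    (hl : ∀ x ∈ l, Measurable x) :
    Measurable fun ω => ((l.map fun x => x ω).find? fun v => decide (p ω v)).elim (g₀ ω) (g ω) := by
  induction l with
  | nil => exact hg₀
  | cons x l ih =>
    obtain ⟨hx, hl⟩ := List.forall_mem_cons.1 hl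
    have hite : Measurable fun ω => if p ω (x ω) then g ω (x ω)
        else ((l.map fun x => x ω).find? fun v => decide (p ω v)).elim (g₀ ω) (g ω) :=
      Measurable.ite (measurable_id.prodMk hx hp) (hg.comp (measurable_id.prodMk hx)) (ih hl)
    convert hite using 2 with ω
    by_cases hpx : p ω (x ω) <;> simp [hpx]

theorem measurable_gradient_uncurry {E : Type*} [TopologicalSpace E] [MeasurableSpace E]
    [OpensMeasurableSpace E] {F : E → Vec d → ℝ} (hF : Continuous (Function.uncurry F)) :
    Measurable fun q : E × Vec d => gradient (F q.1) q.2 := by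
  unfold gradient
  exact (InnerProductSpace.toDual ℝ (Vec d)).symm.continuous.measurable.comp
    (measurable_fderiv_with_param ℝ hF)

theorem continuous_uncurry_taylorModel {f : Vec d → ℝ} {p : ℕ} (hf : ContDiff ℝ p f) (L : ℝ) :
    Continuous (Function.uncurry (taylorModel p L f)) := by
  unfold taylorModel Function.uncurry
  refine Continuous.add (continuous_finsetSum _ fun k hk => ?_) (by fun_prop)
  have hkp : (k : WithTop ℕ∞) ≤ p := by
    exact_mod_cast Nat.lt_succ_iff.1 (Finset.mem_range.1 hk)
  have happly : Continuous fun q : Vec d × Vec d =>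
      (iteratedFDeriv ℝ k f q.1) fun _ => q.2 - q.1 :=
    ((hf.continuous_iteratedFDeriv hkp).comp continuous_fst).eval (by fun_prop)
  exact happly.div_const _

theorem IsQuarticOnLines.quadForm_hessian_eq {c : ℝ} {F : Vec d → ℝ} (hF : IsQuarticOnLines c F)
    (x s : Vec d) :
    quadForm (hessian F x) s = F (x + s) + F (x - s) - 2 * F x - 2 * c * ‖s‖ ^ 4 := by
  have hforward := hF.expansion x s 1
  have hbackward := hF.expansion x s (-1)
  rw [one_smul] at hforward
  rw [neg_smul, one_smul, ← sub_eq_add_neg] at hbackward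
  rw [hforward, hbackward]
  ring

theorem apply_eq_quadForm_of_isSymm {A : Matrix (Fin d) (Fin d) ℝ} (hA : A.IsSymm)
    (i j : Fin d) : A i j = (quadForm A (EuclideanSpace.single i 1 + EuclideanSpace.single j 1)
      - quadForm A (EuclideanSpace.single i 1) - quadForm A (EuclideanSpace.single j 1)) / 2 := by
  have hswap := hA.apply i j
  have hcoe (k : Fin d) : (fun l => (EuclideanSpace.single k (1 : ℝ) : Vec d) l)
      = Pi.single k (1 : ℝ) := rfl
  have hadd : (fun l => (EuclideanSpace.single i (1 : ℝ) + EuclideanSpace.single j 1 : Vec d) l)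
      = Pi.single i (1 : ℝ) + Pi.single j 1 := rfl
  simp only [quadForm, hcoe, hadd, Matrix.mulVec_add, add_dotProduct, dotProduct_add,
    Matrix.mulVec_single_one, single_one_dotProduct, Matrix.col_apply]
  linarith

theorem measurable_hessian_taylorModel {f : Vec d → ℝ} (hf : ContDiff ℝ 3 f) (L : ℝ)
    (i j : Fin d) :
    Measurable fun q : Vec d × Vec d => hessian (taylorModel 3 L f q.1) q.2 i j := by
  have hQ (z : Vec d) := isQuarticOnLines_taylorModel L f z
  have hsymm (z x : Vec d) := hessian_isSymm ((hQ z).contDiff.of_le (by norm_cast)) x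
  have hmodel := continuous_uncurry_taylorModel hf L
  have hcomp (g : Vec d × Vec d → Vec d) (hg : Continuous g) :
      Continuous fun q : Vec d × Vec d => taylorModel 3 L f q.1 (g q) :=
    hmodel.comp (continuous_fst.prodMk hg)
  have hform (s : Vec d) : Continuous fun q : Vec d × Vec d =>
      quadForm (hessian (taylorModel 3 L f q.1) q.2) s := by
    simp only [(hQ _).quadForm_hessian_eq]
    exact (((hcomp _ (by fun_prop)).add (hcomp _ (by fun_prop))).sub
      ((hcomp _ (by fun_prop)).const_mul 2)).sub continuous_const
  simp only [apply_eq_quadForm_of_isSymm (hsymm _ _)]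
  exact ((((hform _).sub (hform _)).sub (hform _)).div_const 2).measurable

theorem measurable_quadForm {A : Ω → Matrix (Fin d) (Fin d) ℝ}
    (hA : ∀ i j, Measurable fun ω => A ω i j) {s : Ω → Vec d} (hs : Measurable s) :
    Measurable fun ω => quadForm (A ω) (s ω) := by
  have hcoord (i : Fin d) : Measurable fun ω => s ω i :=
    (EuclideanSpace.proj (𝕜 := ℝ) i).continuous.measurable.comp hs
  unfold quadForm dotProduct Matrix.mulVec dotProduct
  exact Finset.measurable_sum _ fun i _ => (hcoord i).mul
    (Finset.measurable_sum _ fun j _ => (hA i j).mul (hcoord j))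

theorem measurable_exploitPoint {F : β → Vec d → ℝ} (hF : Measurable (Function.uncurry F))
    {z : Ω → β} {c s : Ω → Vec d} (hz : Measurable z) (hc : Measurable c) (hs : Measurable s)
    (R : ℝ) : Measurable fun ω => exploitPoint (F (z ω)) (c ω) (s ω) R := by
  unfold exploitPoint
  refine hc.add (Measurable.fun_smul ?_ hs)
  refine measurable_argminFirst (φ := fun ω (θ : ℝ) => F (z ω) (c ω + θ • s ω)) ?_
    measurable_const [fun _ => 9 * R, fun _ => -9 * R, fun _ => -12 * R] ?_
  · exact hF.comp ((hz.comp measurable_fst).prodMk ((hc.comp measurable_fst).add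
      (measurable_snd.smul (hs.comp measurable_fst))))
  · intro x hx
    simp only [List.mem_cons, List.not_mem_nil, or_false] at hx
    rcases hx with rfl | rfl | rfl <;> exact measurable_const

theorem measurableSet_mem_cut {g c x : Ω → Vec d} (hg : Measurable g) (hc : Measurable c)
    (hx : Measurable x) : MeasurableSet {ω | x ω ∈ cut (g ω) (c ω)} := by
  have hhalfspace : MeasurableSet {ω | inner ℝ (g ω) (x ω - c ω) ≤ 0} :=
    measurableSet_le (hg.inner (hx.sub hc)) measurable_const
  have hstationary : MeasurableSet {ω | g ω = 0 → x ω = c ω} := by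
    simp only [imp_iff_not_or]
    exact (measurableSet_eq_fun hg measurable_const).compl.union (measurableSet_eq_fun hx hc)
  exact hhalfspace.inter hstationary

variable {centre : Set (Vec d) → Vec d} {τ : ℝ} {h : Vec d → Vec d → ℝ} {R : ℝ}

theorem IsCuttingPlaneCentre.measurable_centre (hc : IsCuttingPlaneCentre centre τ) (hR : 0 < R)
    {n : ℕ} {z : Ω → Vec d} {c g : Fin (n + 1) → Ω → Vec d} (hz : Measurable z)
    (hcut : ∀ i, Measurable (c i)) (hg : ∀ i, Measurable (g i)) :
    Measurable fun ω => centre (Metric.closedBall (z ω) R ∩ ⋂ i, cut (g i ω) (c i ω)) := by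
  have hdata : Measurable fun ω => (z ω, fun i => (c i ω, g i ω)) :=
    hz.prodMk (measurable_pi_lambda _ fun i => (hcut i).prodMk (hg i))
  simpa only [Function.comp_def] using (hc.measurable n R hR).comp hdata

theorem IsCuttingPlaneCentre.measurable_cuttingPlane (hc : IsCuttingPlaneCentre centre τ)
    (hh : Continuous (Function.uncurry h)) (hR : 0 < R) (t : ℕ) :
    Measurable fun z => (cuttingPlane centre (h z) z R t).2 := by
  induction t using Nat.strong_induction_on with
  | _ t ih =>
    cases t with
    | zero => exact measurable_id
    | succ t =>
      have hsucc : (fun z => (cuttingPlane centre (h z) z R (t + 1)).2)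
          = fun z => centre (cuttingPlane centre (h z) z R t).1 := rfl
      rw [hsucc]
      simp only [cuttingPlane_fst]
      exact hc.measurable_centre hR measurable_id (fun i : Fin (t + 1) => ih i i.2)
        fun i => (measurable_gradient_uncurry hh).comp (measurable_id.prodMk (ih i i.2))

theorem IsCuttingPlaneCentre.measurableSet_mem_cuttingPlane (hc : IsCuttingPlaneCentre centre τ)
    (hh : Continuous (Function.uncurry h)) (hR : 0 < R) (t : ℕ) :
    MeasurableSet {q : Vec d × Vec d | q.2 ∈ (cuttingPlane centre (h q.1) q.1 R t).1} := by
  simp only [cuttingPlane_fst, Set.mem_inter_iff, Set.mem_iInter, Set.ofPred_and,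
    Set.ofPred_forall]
  refine MeasurableSet.inter ?_ (MeasurableSet.iInter fun i => ?_)
  · simp only [mem_closedBall_iff_norm]
    exact measurableSet_le (measurable_snd.sub measurable_fst).norm measurable_const
  · have hquery := (hc.measurable_cuttingPlane hh hR i).comp
      (measurable_fst : Measurable fun q : Vec d × Vec d => q.1)
    exact measurableSet_mem_cut
      ((measurable_gradient_uncurry hh).comp (measurable_fst.prodMk hquery)) hquery measurable_snd

end Measurability

theorem TrustRegionData.firstEscape_eq_iff {D : TrustRegionData d} {U : ℕ → Vec d} {n : ℕ} :
    D.firstEscape U = n ↔ (n = 0 ∧ ∀ k, D.candidate (U k) ∈ D.region) ∨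
      (D.candidate (U n) ∉ D.region ∧ ∀ k < n, D.candidate (U k) ∈ D.region) := by
  classical
  by_cases h : D.Escapes U
  · have hall : ¬∀ k, D.candidate (U k) ∈ D.region := not_forall.2 h
    rw [firstEscape_of_escapes h, Nat.find_eq_iff h]
    simp only [hall, and_false, false_or, not_not]
  · have hall : ∀ k, D.candidate (U k) ∈ D.region := not_exists_not.1 h
    rw [firstEscape, dif_neg h]
    simp only [hall, implies_true, and_true, not_true_eq_false, or_false, eq_comm]

namespace modelTrustRegionData

variable {centre : Set (Vec d) → Vec d} {τ : ℝ} {svd : Matrix (Fin d) (Fin d) ℝ → Vec d}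
  {f : Vec d → ℝ} {L₁ L R : ℝ}

local notation "𝒟" => modelTrustRegionData centre τ svd f L₁ L R

theorem continuous_uncurry_hat (hf : ContDiff ℝ 3 f) :
    Continuous (Function.uncurry fun z => (𝒟 z).hat) := by
  unfold TrustRegionData.hat penalized Function.uncurry modelTrustRegionData trustRegionData
  exact (continuous_uncurry_taylorModel hf L).add (by fun_prop)

theorem measurable_query (hc : IsCuttingPlaneCentre centre τ) (hf : ContDiff ℝ 3 f) (hR : 0 < R)
    (t : ℕ) : Measurable fun z => (𝒟 z).query t :=
  hc.measurable_cuttingPlane (continuous_uncurry_hat hf) hR t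

theorem measurableSet_mem_region (hc : IsCuttingPlaneCentre centre τ) (hf : ContDiff ℝ 3 f)
    (hR : 0 < R) : MeasurableSet {q : Vec d × Vec d | q.2 ∈ (𝒟 q.1).region} :=
  hc.measurableSet_mem_cuttingPlane (continuous_uncurry_hat hf) hR _

theorem measurable_best (hc : IsCuttingPlaneCentre centre τ) (hf : ContDiff ℝ 3 f) (hR : 0 < R) :
    Measurable fun z => (𝒟 z).best := by
  have hargmin := measurable_argminFirst (φ := fun z => (𝒟 z).hat) (a := fun z => (𝒟 z).query 0)
    (continuous_uncurry_hat hf).measurable (measurable_query hc hf hR 0)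
    ((List.range (𝒟 0).N).map fun t z => (𝒟 z).query (t + 1))
    (List.forall_mem_map.2 fun t _ => measurable_query hc hf hR (t + 1))
  simp only [List.map_map] at hargmin
  exact hargmin

theorem measurable_gradient_hat_best (hc : IsCuttingPlaneCentre centre τ)
    (hf : ContDiff ℝ 3 f) (hR : 0 < R) :
    Measurable fun z => gradient (𝒟 z).hat (𝒟 z).best := by
  have hbest : Measurable fun z => (z, (𝒟 z).best) :=
    measurable_id.prodMk (measurable_best hc hf hR)
  have hgradient := measurable_gradient_uncurry (F := fun z => (𝒟 z).hat)
    (continuous_uncurry_hat hf)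
  exact (hgradient.comp hbest :)

theorem measurableSet_accepts (hc : IsCuttingPlaneCentre centre τ) (hf : ContDiff ℝ 3 f)
    (hR : 0 < R) : MeasurableSet {z | (𝒟 z).Accepts} :=
  measurableSet_le (measurable_gradient_hat_best hc hf hR).norm
    (measurable_const (a := (𝒟 0).ε / 2))

theorem measurable_candidate (hc : IsCuttingPlaneCentre centre τ) (hf : ContDiff ℝ 3 f)
    (hR : 0 < R) : Measurable fun q : Vec d × Vec d => (𝒟 q.1).candidate q.2 := by
  have hgradient : Measurable fun z => gradient (𝒟 z).hat (𝒟 z).best :=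
    measurable_gradient_hat_best hc hf hR
  have hcentre : Measurable fun z =>
      (𝒟 z).best - (1 / (𝒟 0).Lhat) • gradient (𝒟 z).hat (𝒟 z).best :=
    (measurable_best hc hf hR).sub (hgradient.fun_const_smul _)
  have hadd : Measurable fun p : Vec d × Vec d =>
      p.1 + ((𝒟 0).ε / 2 / (8 * (𝒟 0).Lhat)) • p.2 :=
    measurable_fst.add (measurable_snd.fun_const_smul _)
  exact (hadd.comp ((hcentre.comp measurable_fst).prodMk measurable_snd) :)

theorem measurableSet_candidate_mem_region (hc : IsCuttingPlaneCentre centre τ)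
    (hf : ContDiff ℝ 3 f) (hR : 0 < R) :
    MeasurableSet {q : Vec d × Vec d | (𝒟 q.1).candidate q.2 ∈ (𝒟 q.1).region} :=
  (measurable_fst.prodMk (measurable_candidate (svd := svd) (L₁ := L₁) (L := L) hc hf hR))
    (measurableSet_mem_region hc hf hR)

theorem measurableSet_candidate_apply_mem_region (hc : IsCuttingPlaneCentre centre τ)
    (hf : ContDiff ℝ 3 f) (hR : 0 < R) (k : ℕ) :
    MeasurableSet {q : Vec d × (ℕ → Vec d) | (𝒟 q.1).candidate (q.2 k) ∈ (𝒟 q.1).region} := by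
  have hdraw : Measurable fun q : Vec d × (ℕ → Vec d) => (q.1, q.2 k) :=
    measurable_fst.prodMk ((measurable_pi_apply k).comp measurable_snd)
  exact hdraw (measurableSet_candidate_mem_region (svd := svd) (L₁ := L₁) (L := L) hc hf hR)

theorem measurable_firstEscape (hc : IsCuttingPlaneCentre centre τ) (hf : ContDiff ℝ 3 f)
    (hR : 0 < R) : Measurable fun q : Vec d × (ℕ → Vec d) => (𝒟 q.1).firstEscape q.2 := by
  have hinside := measurableSet_candidate_apply_mem_region (svd := svd) (L₁ := L₁) (L := L) hc hf hR
  have hall : MeasurableSet {q : Vec d × (ℕ → Vec d) |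
      ∀ k, (𝒟 q.1).candidate (q.2 k) ∈ (𝒟 q.1).region} := by
    rw [Set.ofPred_forall]
    exact .iInter hinside
  have hbefore (n : ℕ) : MeasurableSet {q : Vec d × (ℕ → Vec d) |
      ∀ k < n, (𝒟 q.1).candidate (q.2 k) ∈ (𝒟 q.1).region} := by
    simp only [Set.ofPred_forall]
    exact .iInter fun k => .iInter fun _ => hinside k
  refine measurable_to_countable' fun n => ?_
  simp only [Set.preimage, Set.mem_singleton_iff, TrustRegionData.firstEscape_eq_iff]
  exact ((MeasurableSet.const _).inter hall).union ((hinside n).compl.inter (hbefore n))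

theorem measurable_draws (hc : IsCuttingPlaneCentre centre τ) (hf : ContDiff ℝ 3 f)
    (hR : 0 < R) : Measurable fun q : Vec d × (ℕ → Vec d) => (𝒟 q.1).draws q.2 := by
  classical
  exact Measurable.ite (measurable_fst (measurableSet_accepts hc hf hR)) measurable_const
    ((measurable_firstEscape hc hf hR).add_const 1)

theorem measurable_sample (hc : IsCuttingPlaneCentre centre τ) (hf : ContDiff ℝ 3 f)
    (hR : 0 < R) : Measurable fun q : Vec d × (ℕ → Vec d) => (𝒟 q.1).sample q.2 := by
  classical
  have heval : Measurable fun p : (ℕ → Vec d) × ℕ => p.1 p.2 :=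
    measurable_from_prod_countable_left fun k => measurable_pi_apply k
  have hdraw : Measurable fun q : Vec d × (ℕ → Vec d) => q.2 ((𝒟 q.1).firstEscape q.2) :=
    heval.comp (measurable_snd.prodMk (measurable_firstEscape hc hf hR))
  have hcandidate := (measurable_candidate (svd := svd) (L₁ := L₁) (L := L) hc hf hR).comp
    (measurable_fst.prodMk hdraw)
  have haccepts : MeasurableSet {q : Vec d × (ℕ → Vec d) | (𝒟 q.1).Accepts} :=
    measurable_fst (measurableSet_accepts hc hf hR)
  have hbest : Measurable fun z => (𝒟 z).best := measurable_best hc hf hR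
  exact Measurable.ite haccepts (hbest.comp measurable_fst) hcandidate

theorem measurableSet_violated (hf : ContDiff ℝ 3 f) :
    MeasurableSet {p : (Vec d × Vec d) × Vec d | (𝒟 p.1.1).hat p.1.2
      < (𝒟 p.1.1).hat p.2 + inner ℝ (gradient (𝒟 p.1.1).hat p.2) (p.1.2 - p.2)} := by
  have hhat := (continuous_uncurry_hat (centre := centre) (τ := τ) (svd := svd) (L₁ := L₁)
    (L := L) (R := R) hf)
  have hz : Measurable fun p : (Vec d × Vec d) × Vec d => p.1.1 := measurable_fst.fst
  have hu : Measurable fun p : (Vec d × Vec d) × Vec d => p.1.2 := measurable_fst.snd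
  exact measurableSet_lt (hhat.measurable.comp (hz.prodMk hu))
    ((hhat.measurable.comp (hz.prodMk measurable_snd)).add
      (((measurable_gradient_uncurry hhat).comp (hz.prodMk measurable_snd)).inner
        (hu.sub measurable_snd)))

theorem measurable_elim_violatedQuery {γ : Type*} [MeasurableSpace γ]
    (hc : IsCuttingPlaneCentre centre τ) (hf : ContDiff ℝ 3 f) (hR : 0 < R)
    {g₀ : Vec d × Vec d → γ} (hg₀ : Measurable g₀) {g : Vec d × Vec d → Vec d → γ}
    (hg : Measurable (Function.uncurry g)) :
    Measurable fun q : Vec d × Vec d => ((𝒟 q.1).violatedQuery q.2).elim (g₀ q) (g q) := by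
  classical
  have hfind := measurable_elim_find? (p := fun (q : Vec d × Vec d) v => (𝒟 q.1).hat q.2
      < (𝒟 q.1).hat v + inner ℝ (gradient (𝒟 q.1).hat v) (q.2 - v))
    (measurableSet_violated hf) hg₀ hg
    ((List.range ((𝒟 0).N + 1)).map fun t (q : Vec d × Vec d) => (𝒟 q.1).query t)
    (List.forall_mem_map.2 fun t _ => (measurable_query hc hf hR t).comp measurable_fst)
  simp only [List.map_map] at hfind
  exact hfind

theorem measurable_elim_certificate {γ : Type*} [MeasurableSpace γ]
    (hc : IsCuttingPlaneCentre centre τ) (hf : ContDiff ℝ 3 f) (hR : 0 < R)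
    {g₀ : Vec d × Vec d → γ} (hg₀ : Measurable g₀) {g : Vec d × Vec d → Vec d → γ}
    (hg : Measurable (Function.uncurry g)) :
    Measurable fun q : Vec d × Vec d => ((𝒟 q.1).certificate q.2).elim (g₀ q) (g q) := by
  classical
  have haccepts : MeasurableSet {q : Vec d × Vec d | (𝒟 q.1).Accepts} :=
    measurable_fst (measurableSet_accepts hc hf hR)
  have hnear : MeasurableSet {q : Vec d × Vec d | ‖q.2 - q.1‖ ≤ R} :=
    measurableSet_le (measurable_snd.sub measurable_fst).norm measurable_const
  have hviolated : Measurable fun q : Vec d × Vec d =>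
      ((𝒟 q.1).violatedQuery q.2).elim (g₀ q) (g q) :=
    measurable_elim_violatedQuery hc hf hR hg₀ hg
  have hite : Measurable fun q : Vec d × Vec d => if (𝒟 q.1).Accepts then g₀ q
      else if ‖q.2 - q.1‖ ≤ R then ((𝒟 q.1).violatedQuery q.2).elim (g₀ q) (g q) else g₀ q :=
    Measurable.ite haccepts hg₀ (Measurable.ite hnear hviolated hg₀)
  convert hite using 2 with q
  by_cases hA : (𝒟 q.1).Accepts
  · rw [TrustRegionData.certificate_of_accepts hA, if_pos hA, Option.elim_none]
  rw [if_neg hA]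
  by_cases hq : ‖q.2 - q.1‖ ≤ R
  · rw [TrustRegionData.certificate_of_norm_le hA hq, if_pos hq]
  · have hfar : (𝒟 q.1).R < ‖q.2 - (𝒟 q.1).z‖ := not_le.1 hq
    rw [TrustRegionData.certificate_of_lt_norm hfar, if_neg hq, Option.elim_none]

theorem measurable_exploitPoint_midpoint (hf : ContDiff ℝ 3 f) :
    Measurable fun p : (Vec d × Vec d) × Vec d => exploitPoint (taylorModel 3 L f p.1.1)
      ((1 / 2 : ℝ) • (p.1.2 + p.2)) ((1 / ‖p.1.2 - p.2‖) • (p.2 - p.1.2)) R := by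
  have hu : Measurable fun p : (Vec d × Vec d) × Vec d => p.1.2 := measurable_fst.snd
  exact measurable_exploitPoint (continuous_uncurry_taylorModel hf L).measurable
    measurable_fst.fst ((hu.add measurable_snd).fun_const_smul _)
    ((measurable_const.div (hu.sub measurable_snd).norm).fun_smul (measurable_snd.sub hu)) R

theorem measurable_svd_hessian (hsvd : IsMinDirection svd) (hf : ContDiff ℝ 3 f) :
    Measurable fun q : Vec d × Vec d => svd (hessian (taylorModel 3 L f q.1) q.2) :=
  hsvd.measurable.comp (measurable_pi_lambda (fun (q : Vec d × Vec d) i j =>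
    hessian (taylorModel 3 L f q.1) q.2 i j) fun i =>
      measurable_pi_lambda _ fun j => measurable_hessian_taylorModel hf L i j)

theorem measurable_nextPoint (hc : IsCuttingPlaneCentre centre τ) (hsvd : IsMinDirection svd)
    (hf : ContDiff ℝ 3 f) (hR : 0 < R) (ε α : ℝ) :
    Measurable fun q : Vec d × Vec d =>
      nextPoint svd (taylorModel 3 L f q.1) ε α R q.2 ((𝒟 q.1).certificate q.2) := by
  classical
  have hmodel := continuous_uncurry_taylorModel hf L
  have hdirection := measurable_svd_hessian (L := L) hsvd hf
  have hsmall : MeasurableSet {q : Vec d × Vec d | ‖gradient (taylorModel 3 L f q.1) q.2‖ ≤ ε} :=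
    measurableSet_le (measurable_gradient_uncurry hmodel).norm measurable_const
  have hconvex : MeasurableSet {q : Vec d × Vec d | -α ≤ quadForm
      (hessian (taylorModel 3 L f q.1) q.2) (svd (hessian (taylorModel 3 L f q.1) q.2))} :=
    measurableSet_le measurable_const
      (measurable_quadForm (measurable_hessian_taylorModel hf L) hdirection)
  have hexploit := measurable_exploitPoint hmodel.measurable measurable_fst measurable_snd
    hdirection R
  have hcertificate : Measurable fun q : Vec d × Vec d => ((𝒟 q.1).certificate q.2).elim q.2
      fun v => exploitPoint (taylorModel 3 L f q.1) ((1 / 2 : ℝ) • (q.2 + v))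
        ((1 / ‖q.2 - v‖) • (v - q.2)) R :=
    measurable_elim_certificate hc hf hR measurable_snd (measurable_exploitPoint_midpoint hf)
  convert Measurable.ite hsmall (Measurable.ite hconvex measurable_snd hexploit) hcertificate
    using 2 with q
  cases (𝒟 q.1).certificate q.2 <;> rfl

theorem measurable_next (hc : IsCuttingPlaneCentre centre τ) (hsvd : IsMinDirection svd)
    (hf : ContDiff ℝ 3 f) (hR : 0 < R) :
    Measurable fun q : Vec d × (ℕ → Vec d) => (𝒟 q.1).next q.2 := by
  simp only [modelTrustRegionData_next]
  exact ((measurable_nextPoint hc hsvd hf hR _ _).comp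
    (measurable_fst.prodMk (measurable_sample hc hf hR)) :)

end modelTrustRegionData

/-! ### The sampling step -/

theorem one_sub_pow_mul_half_pow_le {d N : ℕ} (hd : 0 < d) {τ A : ℝ} (hτ : 0 < τ) (hτ' : τ ≤ 1)
    (hA : 0 < A) (hN : (d : ℝ) / τ * Real.log A ≤ N) :
    (1 - τ) ^ N * (A / 2) ^ d ≤ 1 / 2 := by
  have hpow : (1 - τ) ^ N ≤ (A ^ d)⁻¹ := calc
    (1 - τ) ^ N ≤ Real.exp (-τ) ^ N :=
      pow_le_pow_left₀ (by linarith) (Real.one_sub_le_exp_neg τ) N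
    _ = Real.exp (-(N * τ)) := by rw [← Real.exp_nat_mul, mul_neg]
    _ ≤ Real.exp (-(d * Real.log A)) := by
      refine Real.exp_le_exp.2 (neg_le_neg ?_)
      calc d * Real.log A = d / τ * Real.log A * τ := by field_simp
        _ ≤ N * τ := by gcongr
    _ = (A ^ d)⁻¹ := by rw [Real.exp_neg, Real.exp_nat_mul, Real.exp_log hA]
  calc (1 - τ) ^ N * (A / 2) ^ d ≤ (A ^ d)⁻¹ * (A / 2) ^ d := by gcongr
    _ = (1 / 2) ^ d := by
      rw [div_pow, div_pow, one_pow]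
      field_simp
    _ ≤ 1 / 2 := pow_le_of_le_one (by norm_num) (by norm_num) hd.ne'

namespace TrustRegionData

variable {D : TrustRegionData d}

theorem volume_candidate_preimage (S : Set (Vec d)) (hr : D.ε / 2 / (8 * D.Lhat) ≠ 0) :
    volume (D.candidate ⁻¹' S)
      = ENNReal.ofReal |((D.ε / 2 / (8 * D.Lhat)) ^ d)⁻¹| * volume S := by
  have hpreimage : D.candidate ⁻¹' S = (fun w => (D.ε / 2 / (8 * D.Lhat)) • w) ⁻¹'
      ((fun w => (D.best - (1 / D.Lhat) • gradient D.hat D.best) + w) ⁻¹' S) := rfl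
  rw [hpreimage, Measure.addHaar_preimage_smul _ hr, measure_preimage_add, finrank_euclideanSpace,
    Fintype.card_fin]

theorem volume_candidate_preimage_region_le (hd : 0 < d) {τ : ℝ}
    (hc : IsCuttingPlaneCentre D.centre τ) (hhat : Differentiable ℝ D.hat) (hε : 0 < D.ε)
    (hL : 0 < D.Lhat) (hA : 1 < 16 * D.Lhat * D.R / (D.ε / 2))
    (hN : (d : ℝ) / τ * Real.log (16 * D.Lhat * D.R / (D.ε / 2)) ≤ D.N) :
    volume (D.candidate ⁻¹' D.region) ≤ 2⁻¹ * volume (Metric.closedBall (0 : Vec d) 1) := by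
  set A := 16 * D.Lhat * D.R / (D.ε / 2) with hAdef
  set r := D.ε / 2 / (8 * D.Lhat) with hrdef
  have hr : 0 < r := by positivity
  have hτ : 0 ≤ 1 - τ := by linarith [hc.tau_le]
  have hratio : D.R = A / 2 * r := by
    rw [hAdef, hrdef]
    field_simp
    ring
  have hR : 0 < D.R := hratio ▸ mul_pos (by linarith) hr
  have hN_pos : 0 < D.N := by
    have hlog : 0 < (d : ℝ) / τ * Real.log A :=
      mul_pos (div_pos (Nat.cast_pos.2 hd) hc.tau_pos) (Real.log_pos hA)
    exact_mod_cast hlog.trans_le hN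
  have hregion := hc.volume_le D.hat hhat D.z D.R hR D.N hN_pos
  rw [Measure.addHaar_closedBall' _ _ hR.le, finrank_euclideanSpace, Fintype.card_fin] at hregion
  rw [volume_candidate_preimage _ hr.ne', abs_of_pos (by positivity)]
  calc ENNReal.ofReal (r ^ d)⁻¹ * volume D.region
      ≤ ENNReal.ofReal (r ^ d)⁻¹ * (ENNReal.ofReal ((1 - τ) ^ D.N) *
        (ENNReal.ofReal (D.R ^ d) * volume (Metric.closedBall (0 : Vec d) 1))) := by
        gcongr
        exact hregion
    _ = ENNReal.ofReal ((1 - τ) ^ D.N * (A / 2) ^ d)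
        * volume (Metric.closedBall (0 : Vec d) 1) := by
        rw [← mul_assoc, ← mul_assoc, ← ENNReal.ofReal_mul (by positivity),
          ← ENNReal.ofReal_mul (by positivity), hratio, mul_pow]
        congr 2
        field_simp
    _ ≤ ENNReal.ofReal (1 / 2) * volume (Metric.closedBall (0 : Vec d) 1) := by
        gcongr
        exact one_sub_pow_mul_half_pow_le hd hc.tau_pos (by linarith [hc.tau_le])
          (one_pos.trans hA) hN
    _ = 2⁻¹ * volume (Metric.closedBall (0 : Vec d) 1) := by
        rw [one_div, ENNReal.ofReal_inv_of_pos two_pos, ENNReal.ofReal_ofNat]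

theorem candidate_mem_region_of_lt_draws {U : ℕ → Vec d} {j k : ℕ} (hjk : j < k)
    (hk : k < D.draws U) : D.candidate (U j) ∈ D.region := by
  classical
  by_cases hA : D.Accepts
  · rw [draws_of_accepts hA] at hk
    exact absurd hk (Nat.not_lt_zero k)
  rw [draws_of_not_accepts hA] at hk
  by_cases hesc : D.Escapes U
  · rw [firstEscape_of_escapes hesc] at hk
    exact not_not.1 (Nat.find_min hesc (by omega))
  · exact not_exists_not.1 hesc j

end TrustRegionData

theorem StepAssumptions.volume_candidate_preimage_region_le {centre : Set (Vec d) → Vec d} {τ : ℝ}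
    {f : Vec d → ℝ} {L₁ L R : ℝ} (h : StepAssumptions f L₁ L R) (hd : 0 < d)
    (hc : IsCuttingPlaneCentre centre τ) (svd : Matrix (Fin d) (Fin d) ℝ → Vec d) (z : Vec d) :
    volume ((modelTrustRegionData centre τ svd f L₁ L R z).candidate ⁻¹'
        (modelTrustRegionData centre τ svd f L₁ L R z).region)
      ≤ 2⁻¹ * volume (Metric.closedBall (0 : Vec d) 1) := by
  set D := modelTrustRegionData centre τ svd f L₁ L R z with hD
  have hLhat : D.Lhat = 2 * L₁ + 42 * L * R ^ 2 := modelTrustRegionData_Lhat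
  have hLhat_pos : 0 < D.Lhat := by linarith [h.L₁_pos, h.mul_sq_pos]
  have hε : 0 < 6912 * L * R ^ 3 := mul_pos (by linarith [h.L_pos]) (pow_pos h.R_pos 3)
  have hhat : Differentiable ℝ D.hat := by
    rw [hD, modelTrustRegionData_hat]
    exact differentiable_proxModel L R f z
  refine TrustRegionData.volume_candidate_preimage_region_le (D := D) hd hc hhat hε hLhat_pos ?_
    (Nat.le_ceil _)
  have hA : 6912 * L * R ^ 3 / 2 < 16 * D.Lhat * R := by
    have hmul := mul_lt_mul_of_pos_right
      (show 3456 * L * R ^ 2 < 16 * D.Lhat by linarith [h.le_L₁, h.mul_sq_pos]) h.R_pos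
    calc 6912 * L * R ^ 3 / 2 = 3456 * L * R ^ 2 * R := by ring
      _ < 16 * D.Lhat * R := hmul
  exact (one_lt_div (half_pos hε)).2 hA

section Probability

variable {Ω E α β : Type*} [MeasurableSpace Ω] {P : Measure Ω} [MeasurableSpace E]
  [MeasurableSpace α] [MeasurableSpace β]

theorem measure_preimage_le_of_isUniform {X : Ω → E} {s A : Set E} {μ : Measure E} {c : ENNReal}
    (hu : pdf.IsUniform X s P μ) (hs : μ s ≠ 0) (hs' : μ s ≠ ⊤) (hA : MeasurableSet A)
    (h : μ A ≤ c * μ s) : P (X ⁻¹' A) ≤ c := by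
  rw [hu.measure_preimage hs hs' hA]
  exact ENNReal.div_le_of_le_mul ((measure_mono Set.inter_subset_right).trans h)

theorem measure_forall_lt_mem_le {V : ℕ → Ω → E} (hV : iIndepFun V P) {A : Set E}
    (hA : MeasurableSet A) {c : ENNReal} (hc : ∀ k, P (V k ⁻¹' A) ≤ c) (k : ℕ) :
    P {ω | ∀ j < k, V j ω ∈ A} ≤ c ^ k := by
  have hinter : {ω | ∀ j < k, V j ω ∈ A} = ⋂ i ∈ Finset.range k, V i ⁻¹' A := by
    ext ω
    simp
  rw [hinter, hV.measure_inter_preimage_eq_mul (Finset.range k) fun _ _ => hA]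
  exact (Finset.prod_le_pow_card _ _ _ fun i _ => hc i).trans_eq (by rw [Finset.card_range])

theorem measure_prodMk_mem_le_of_indepFun [IsProbabilityMeasure P] {X : Ω → α} {Y : Ω → β}
    (hX : Measurable X) (hY : Measurable Y) (hXY : IndepFun X Y P) {S : Set (α × β)}
    (hS : MeasurableSet S) {c : ENNReal} (hc : ∀ x, P {ω | (x, Y ω) ∈ S} ≤ c) :
    P {ω | (X ω, Y ω) ∈ S} ≤ c := by
  have := Measure.isProbabilityMeasure_map (μ := P) hX.aemeasurable
  have := Measure.isProbabilityMeasure_map (μ := P) hY.aemeasurable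
  have hmap : P {ω | (X ω, Y ω) ∈ S} = P.map (fun ω => (X ω, Y ω)) S :=
    (Measure.map_apply (hX.prodMk hY) hS).symm
  rw [hmap, (indepFun_iff_map_prod_eq_prod_map_map hX.aemeasurable hY.aemeasurable).1 hXY,
    Measure.prod_apply hS]
  calc ∫⁻ x, P.map Y (Prod.mk x ⁻¹' S) ∂P.map X ≤ ∫⁻ _, c ∂P.map X := by
        refine lintegral_mono fun x => ?_
        rw [Measure.map_apply hY (measurable_prodMk_left hS)]
        exact hc x
    _ = c := by rw [lintegral_const, measure_univ, mul_one]

section Sampling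

variable {D : Vec d → TrustRegionData d} {X : Ω → Vec d} {V : ℕ → Ω → Vec d}

theorem measure_lt_draws_le {c : ENNReal} {k : ℕ}
    (h : P {ω | ∀ j < k, (D (X ω)).candidate (V j ω) ∈ (D (X ω)).region} ≤ c) :
    P {ω | k < (D (X ω)).draws fun j => V j ω} ≤ c :=
  (measure_mono (Set.ofPred_subset_ofPred.2 fun _ hω _ hj =>
    TrustRegionData.candidate_mem_region_of_lt_draws hj hω)).trans h

theorem ae_escapes
    (h : ∀ k, P {ω | ∀ j < k, (D (X ω)).candidate (V j ω) ∈ (D (X ω)).region} ≤ 2⁻¹ ^ k) :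
    ∀ᵐ ω ∂P, (D (X ω)).Escapes fun j => V j ω := by
  refine ae_iff.2 (le_bot_iff.1 (ge_of_tendsto' (ENNReal.tendsto_pow_atTop_nhds_zero_of_lt_one
    (ENNReal.inv_lt_one.2 ENNReal.one_lt_two)) fun k =>
      (measure_mono fun ω hω j _ => ?_).trans (h k)))
  exact not_exists_not.1 hω j

end Sampling

variable [IsProbabilityMeasure P] {centre : Set (Vec d) → Vec d} {τ : ℝ}
  {svd : Matrix (Fin d) (Fin d) ℝ → Vec d} {f : Vec d → ℝ} {L₁ L R : ℝ} {X : Ω → Vec d}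
  {V : ℕ → Ω → Vec d}

local notation "𝒟" => modelTrustRegionData centre τ svd f L₁ L R

theorem StepAssumptions.measure_forall_lt_candidate_mem_region_le (h : StepAssumptions f L₁ L R)
    (hd : 0 < d) (hc : IsCuttingPlaneCentre centre τ) (hX : Measurable X)
    (hV : ∀ k, Measurable (V k))
    (hu : ∀ k, pdf.IsUniform (V k) (Metric.closedBall (0 : Vec d) 1) P) (hi : iIndepFun V P)
    (hXV : IndepFun X (fun ω k => V k ω) P) (k : ℕ) :
    P {ω | ∀ j < k, (𝒟 (X ω)).candidate (V j ω) ∈ (𝒟 (X ω)).region} ≤ 2⁻¹ ^ k := by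
  have hinside : MeasurableSet {q : Vec d × (ℕ → Vec d) |
      ∀ j < k, (𝒟 q.1).candidate (q.2 j) ∈ (𝒟 q.1).region} := by
    simp only [Set.ofPred_forall]
    exact .iInter fun j => .iInter fun _ =>
      modelTrustRegionData.measurableSet_candidate_apply_mem_region hc h.contDiff h.R_pos j
  refine measure_prodMk_mem_le_of_indepFun hX (measurable_pi_lambda _ hV) hXV hinside fun x => ?_
  have hpreimage : MeasurableSet ((𝒟 x).candidate ⁻¹' (𝒟 x).region) :=
    measurable_prodMk_left (modelTrustRegionData.measurableSet_candidate_mem_region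
      (svd := svd) (L₁ := L₁) (L := L) hc h.contDiff h.R_pos)
  exact measure_forall_lt_mem_le hi hpreimage (fun k => measure_preimage_le_of_isUniform (hu k)
    (Metric.measure_closedBall_pos _ _ one_pos).ne' measure_closedBall_lt_top.ne hpreimage
    (h.volume_candidate_preimage_region_le hd hc svd x)) k

end Probability

/-! ### Exponential moments -/

theorem exp_quarter_le : Real.exp (1 / 4) ≤ 4 / 3 := by
  have hpow : Real.exp (1 / 4) ^ 4 = Real.exp 1 := by
    rw [← Real.exp_nat_mul]
    norm_num
  refine le_of_pow_le_pow_left₀ four_ne_zero (by norm_num) ?_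
  rw [hpow]
  exact Real.exp_one_lt_d9.le.trans (by norm_num)

theorem exp_div_four_le (n : ℕ) :
    Real.exp (n / 4) ≤ 1 + ∑ k ∈ Finset.range n, 1 / 3 * (4 / 3 : ℝ) ^ k := calc
  Real.exp (n / 4) = Real.exp (1 / 4) ^ n := by rw [← Real.exp_nat_mul, mul_one_div]
  _ ≤ (4 / 3) ^ n := by
    gcongr
    exact exp_quarter_le
  _ = 1 + ∑ k ∈ Finset.range n, 1 / 3 * (4 / 3 : ℝ) ^ k := by
    rw [← Finset.mul_sum, geom_sum_eq (by norm_num)]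
    ring

/-- The variable `Kbar` of the running time: an affine function of the average number of draws in
the first `n` passes, normalized so that it is at least `y` with probability at most
`e^((1 - y) / 10)`. -/
def normalizedDraws (n : ℕ) (K : ℕ → ℕ) : ℝ := ((∑ t ∈ Finset.range n, (K t : ℝ)) / n + 1) / 10

theorem normalizedDraws_pos (n : ℕ) (K : ℕ → ℕ) : 0 < normalizedDraws n K := by
  unfold normalizedDraws
  positivity

theorem sum_le_mul_normalizedDraws {n : ℕ} (hn : 0 < n) (K : ℕ → ℕ) :
    ∑ t ∈ Finset.range n, (K t : ℝ) ≤ 10 * n * normalizedDraws n K := by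
  have hn' : (0 : ℝ) < n := Nat.cast_pos.2 hn
  unfold normalizedDraws
  field_simp
  linarith

section Moments

variable {Ω : Type*} [MeasurableSpace Ω] {P : Measure Ω}

theorem lintegral_sum_range_eq_tsum {K : Ω → ℕ} (hK : Measurable K) (a : ℕ → ENNReal) :
    ∫⁻ ω, ∑ k ∈ Finset.range (K ω), a k ∂P = ∑' k, a k * P {ω | k < K ω} := by
  have hmeas (k : ℕ) : MeasurableSet {ω | k < K ω} := measurableSet_lt measurable_const hK
  have hindicator (ω : Ω) : ∑ k ∈ Finset.range (K ω), a k
      = ∑' k, {ω | k < K ω}.indicator (fun _ => a k) ω := by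
    rw [tsum_eq_sum (s := Finset.range (K ω)) fun k hk => Set.indicator_of_notMem
      (s := {ω | k < K ω}) (mt Finset.mem_range.2 hk) fun _ => a k]
    exact Finset.sum_congr rfl fun k hk =>
      (Set.indicator_of_mem (s := {ω | k < K ω}) (Finset.mem_range.1 hk) fun _ => a k).symm
  simp only [hindicator]
  rw [lintegral_tsum fun k => (measurable_const.indicator (hmeas k)).aemeasurable]
  simp only [lintegral_indicator_const (hmeas _)]

theorem tsum_third_mul_two_thirds_pow :
    ∑' k : ℕ, ENNReal.ofReal (1 / 3 * (2 / 3) ^ k) = 1 := by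
  have hsummable : Summable fun k : ℕ => (1 / 3 : ℝ) * (2 / 3) ^ k :=
    (summable_geometric_of_lt_one (by norm_num) (by norm_num)).mul_left _
  rw [← ENNReal.ofReal_tsum_of_nonneg (fun k => by positivity) hsummable, tsum_mul_left,
    tsum_geometric_of_lt_one (by norm_num) (by norm_num)]
  norm_num

theorem measurable_normalizedDraws (n : ℕ) {K : ℕ → Ω → ℕ} (hK : ∀ t, Measurable (K t)) :
    Measurable fun ω => normalizedDraws n fun t => K t ω := by
  have hcast (t : ℕ) : Measurable fun ω => (K t ω : ℝ) := measurable_from_nat.comp (hK t)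
  unfold normalizedDraws
  fun_prop

variable [IsProbabilityMeasure P]

theorem lintegral_exp_le_two {K : Ω → ℕ} (hK : Measurable K)
    (h : ∀ k, P {ω | k < K ω} ≤ 2⁻¹ ^ k) :
    ∫⁻ ω, ENNReal.ofReal (Real.exp (K ω / 4)) ∂P ≤ 2 := by
  set a : ℕ → ℝ := fun k => 1 / 3 * (4 / 3) ^ k with ha
  have ha_nonneg (k : ℕ) : 0 ≤ a k := by positivity
  calc ∫⁻ ω, ENNReal.ofReal (Real.exp (K ω / 4)) ∂P
      ≤ ∫⁻ ω, 1 + ∑ k ∈ Finset.range (K ω), ENNReal.ofReal (a k) ∂P := by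
        refine lintegral_mono fun ω => ?_
        rw [← ENNReal.ofReal_one, ← ENNReal.ofReal_sum_of_nonneg fun k _ => ha_nonneg k,
          ← ENNReal.ofReal_add zero_le_one (Finset.sum_nonneg fun k _ => ha_nonneg k)]
        exact ENNReal.ofReal_le_ofReal (exp_div_four_le (K ω))
    _ = 1 + ∑' k, ENNReal.ofReal (a k) * P {ω | k < K ω} := by
        rw [lintegral_add_left measurable_const, lintegral_sum_range_eq_tsum hK, lintegral_const,
          measure_univ, one_mul]
    _ ≤ 1 + ∑' k : ℕ, ENNReal.ofReal (1 / 3 * (2 / 3) ^ k) := by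
        gcongr with k
        calc ENNReal.ofReal (a k) * P {ω | k < K ω} ≤ ENNReal.ofReal (a k) * 2⁻¹ ^ k := by
              gcongr
              exact h k
          _ = ENNReal.ofReal (1 / 3 * (2 / 3) ^ k) := by
            rw [← ENNReal.ofReal_ofNat 2, ← ENNReal.ofReal_inv_of_pos two_pos,
              ← ENNReal.ofReal_pow (by norm_num), ← ENNReal.ofReal_mul (ha_nonneg k), ha, mul_assoc,
              ← mul_pow]
            norm_num
    _ = 2 := by rw [tsum_third_mul_two_thirds_pow, one_add_one_eq_two]

theorem exp_average_le {n : ℕ} (hn : 0 < n) (a : ℕ → ℝ) :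
    Real.exp ((∑ t ∈ Finset.range n, a t) / n) ≤ (∑ t ∈ Finset.range n, Real.exp (a t)) / n := by
  have hn' : (n : ℝ) ≠ 0 := Nat.cast_ne_zero.2 hn.ne'
  have hjensen := convexOn_exp.map_sum_le (t := Finset.range n) (w := fun _ => (n : ℝ)⁻¹) (p := a)
    (fun _ _ => by positivity)
    (by rw [Finset.sum_const, Finset.card_range, nsmul_eq_mul, mul_inv_cancel₀ hn'])
    fun _ _ => Set.mem_univ _
  simpa only [smul_eq_mul, inv_mul_eq_div, Finset.sum_div] using hjensen

theorem lintegral_exp_average_le_two {n : ℕ} (hn : 0 < n) {K : ℕ → Ω → ℕ}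
    (hK : ∀ t, Measurable (K t)) (h : ∀ t k, P {ω | k < K t ω} ≤ 2⁻¹ ^ k) :
    ∫⁻ ω, ENNReal.ofReal (Real.exp ((∑ t ∈ Finset.range n, (K t ω : ℝ) / 4) / n)) ∂P ≤ 2 := by
  have hmeas (t : ℕ) : Measurable fun ω => ENNReal.ofReal (Real.exp (K t ω / 4)) := by
    have hcast : Measurable fun ω => (K t ω : ℝ) := measurable_from_nat.comp (hK t)
    fun_prop
  have hn' : (n : ENNReal) ≠ 0 := Nat.cast_ne_zero.2 hn.ne'
  calc ∫⁻ ω, ENNReal.ofReal (Real.exp ((∑ t ∈ Finset.range n, (K t ω : ℝ) / 4) / n)) ∂P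
      ≤ ∫⁻ ω, (n : ENNReal)⁻¹ * ∑ t ∈ Finset.range n, ENNReal.ofReal (Real.exp (K t ω / 4)) ∂P := by
        refine lintegral_mono fun ω => ?_
        rw [← ENNReal.ofReal_sum_of_nonneg fun _ _ => (Real.exp_pos _).le,
          ← ENNReal.ofReal_natCast n, mul_comm, ← div_eq_mul_inv,
          ← ENNReal.ofReal_div_of_pos (Nat.cast_pos.2 hn)]
        exact ENNReal.ofReal_le_ofReal (exp_average_le hn _)
    _ = (n : ENNReal)⁻¹ * ∑ t ∈ Finset.range n,
          ∫⁻ ω, ENNReal.ofReal (Real.exp (K t ω / 4)) ∂P := by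
        rw [lintegral_const_mul _ (Finset.measurable_sum _ fun t _ => hmeas t),
          lintegral_finsetSum _ fun t _ => hmeas t]
    _ ≤ (n : ENNReal)⁻¹ * ∑ _t ∈ Finset.range n, 2 := by
        gcongr with t
        exact lintegral_exp_le_two (hK t) (h t)
    _ = 2 := by
        rw [Finset.sum_const, Finset.card_range, nsmul_eq_mul, ← mul_assoc,
          ENNReal.inv_mul_cancel hn' (ENNReal.natCast_ne_top n), one_mul]

theorem measure_le_normalizedDraws_le {n : ℕ} (hn : 0 < n) {K : ℕ → Ω → ℕ}
    (hK : ∀ t, Measurable (K t)) (h : ∀ t k, P {ω | k < K t ω} ≤ 2⁻¹ ^ k) (y : ℝ) :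
    P {ω | y ≤ normalizedDraws n fun t => K t ω}
      ≤ ENNReal.ofReal (Real.exp ((1 - y) / 10)) := by
  rcases le_total y 1 with hy | hy
  · exact prob_le_one.trans (ENNReal.one_le_ofReal.2 (Real.one_le_exp (by linarith)))
  set G : Ω → ENNReal := fun ω =>
    ENNReal.ofReal (Real.exp ((∑ t ∈ Finset.range n, (K t ω : ℝ) / 4) / n))
  have hG_meas : Measurable G := by
    have hcast (t : ℕ) : Measurable fun ω => (K t ω : ℝ) := measurable_from_nat.comp (hK t)
    fun_prop
  set c : ℝ := Real.exp ((10 * y - 1) / 4) with hc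
  have hc_pos : 0 < c := Real.exp_pos _
  have hsubset : {ω | y ≤ normalizedDraws n fun t => K t ω}
      ⊆ {ω | ENNReal.ofReal c ≤ G ω} := fun ω hω => by
    refine ENNReal.ofReal_le_ofReal (Real.exp_le_exp.2 ?_)
    have hω' : y ≤ ((∑ t ∈ Finset.range n, (K t ω : ℝ)) / n + 1) / 10 := hω
    rw [← Finset.sum_div, div_right_comm]
    linarith
  have htwo : 2 / c ≤ Real.exp ((1 - y) / 10) := by
    rw [div_le_iff₀ hc_pos, hc, ← Real.exp_add]
    linarith [Real.add_one_le_exp ((1 - y) / 10 + (10 * y - 1) / 4)]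
  calc P {ω | y ≤ normalizedDraws n fun t => K t ω}
      ≤ P {ω | ENNReal.ofReal c ≤ G ω} := measure_mono hsubset
    _ ≤ (∫⁻ ω, G ω ∂P) / ENNReal.ofReal c :=
      meas_ge_le_lintegral_div hG_meas.aemeasurable (ENNReal.ofReal_pos.2 hc_pos).ne'
        ENNReal.ofReal_ne_top
    _ ≤ 2 / ENNReal.ofReal c := by
      gcongr
      exact lintegral_exp_average_le_two hn hK h
    _ = ENNReal.ofReal (2 / c) := by rw [ENNReal.ofReal_div_of_pos hc_pos, ENNReal.ofReal_ofNat]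
    _ ≤ ENNReal.ofReal (Real.exp ((1 - y) / 10)) := ENNReal.ofReal_le_ofReal htwo

end Moments

/-! ### The random iterates -/

/-- The iterates `z_{t+1} = step z_t (V t)` of a recursion driven by the sequence `V`. -/
def drivenIterate {α γ : Type*} (step : α → γ → α) (z₀ : α) (V : ℕ → γ) : ℕ → α
  | 0 => z₀
  | t + 1 => step (drivenIterate step z₀ V t) (V t)

section DrivenIterate

variable {Ω α γ E κ : Type*} [MeasurableSpace α]

theorem measurable_drivenIterate [MeasurableSpace Ω] [MeasurableSpace γ] {step : α → γ → α}
    (hstep : Measurable (Function.uncurry step)) (z₀ : α) {V : ℕ → Ω → γ} {t : ℕ}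
    (hV : ∀ s < t, Measurable (V s)) :
    Measurable fun ω => drivenIterate step z₀ (fun s => V s ω) t := by
  induction t with
  | zero => exact measurable_const
  | succ t ih =>
    exact (hstep.comp ((ih fun s hs => hV s (hs.trans t.lt_succ_self)).prodMk
      (hV t t.lt_succ_self)) :)

theorem measurable_iSup_comap_row [MeasurableSpace E] (U : ℕ → κ → Ω → E) {S : Set (ℕ × κ)} {t : ℕ}
    (hS : ∀ k, (t, k) ∈ S) :
    Measurable[⨆ i ∈ S, MeasurableSpace.comap (U i.1 i.2) inferInstance] fun ω k => U t k ω :=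
  @measurable_pi_lambda _ _ _ (_) _ _ fun k => (comap_measurable (U t k)).mono
    (le_biSup (fun i : ℕ × κ => MeasurableSpace.comap (U i.1 i.2) inferInstance) (hS k)) le_rfl

theorem indepFun_drivenIterate [MeasurableSpace Ω] {P : Measure Ω} [MeasurableSpace E]
    {step : α → (κ → E) → α} (hstep : Measurable (Function.uncurry step)) (z₀ : α)
    {U : ℕ → κ → Ω → E} (hU : ∀ t k, Measurable (U t k))
    (hi : iIndepFun (fun tk : ℕ × κ => U tk.1 tk.2) P) (t : ℕ) :
    IndepFun (fun ω => drivenIterate step z₀ (fun s k => U s k ω) t) (fun ω k => U t k ω) P := by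
  have hpast_present : Disjoint {i : ℕ × κ | i.1 < t} {i | i.1 = t} :=
    Set.disjoint_left.2 fun i (hlt : i.1 < t) (heq : i.1 = t) => hlt.ne heq
  have hindep := indep_iSup_of_disjoint (fun i : ℕ × κ => (hU i.1 i.2).comap_le) hi.iIndep
    hpast_present
  refine (IndepFun_iff_Indep _ _ _).2
    (indep_of_indep_of_le_left (indep_of_indep_of_le_right hindep ?_) ?_)
  · exact Measurable.comap_le (measurable_iSup_comap_row U fun _ => rfl)
  · exact Measurable.comap_le (@measurable_drivenIterate _ _ _ _ (_) _ _ hstep z₀ _ t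
      fun s hs => measurable_iSup_comap_row U fun _ => hs)

end DrivenIterate

/-- The random points available to the procedure: the `k`-th draw of pass `t` is `U t k`; all draws
are independent and uniform in the closed unit ball. -/
structure IsUniformNoise {Ω : Type*} [MeasurableSpace Ω] (U : ℕ → ℕ → Ω → Vec d) (P : Measure Ω) :
    Prop where
  measurable : ∀ t k, Measurable (U t k)
  isUniform : ∀ t k, pdf.IsUniform (U t k) (Metric.closedBall (0 : Vec d) 1) P
  iIndepFun : iIndepFun (fun tk : ℕ × ℕ => U tk.1 tk.2) P

theorem ae_mem_of_isUniform {Ω E : Type*} [MeasurableSpace Ω] [MeasurableSpace E] {P : Measure Ω}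
    {μ : Measure E} {X : Ω → E} {s : Set E} (hX : AEMeasurable X P) (hs : MeasurableSet s)
    (hu : pdf.IsUniform X s P μ) : ∀ᵐ ω ∂P, X ω ∈ s := by
  refine ae_of_ae_map hX ?_
  rw [hu]
  exact ae_cond_mem hs

theorem IsUniformNoise.ae_norm_le_one {Ω : Type*} [MeasurableSpace Ω] {P : Measure Ω}
    {U : ℕ → ℕ → Ω → Vec d} (hU : IsUniformNoise U P) : ∀ᵐ ω ∂P, ∀ t k, ‖U t k ω‖ ≤ 1 := by
  refine ae_all_iff.2 fun t => ae_all_iff.2 fun k => ?_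
  filter_upwards [ae_mem_of_isUniform (hU.measurable t k).aemeasurable
    Metric.isClosed_closedBall.measurableSet (hU.isUniform t k)] with ω hω
  exact mem_closedBall_zero_iff.1 hω

/-- The iterates of the procedure when pass `t` uses the stream `V t` of points of the unit
ball. -/
def modelIterate (centre : Set (Vec d) → Vec d) (τ : ℝ) (svd : Matrix (Fin d) (Fin d) ℝ → Vec d)
    (f : Vec d → ℝ) (L₁ L R : ℝ) (z₀ : Vec d) (V : ℕ → ℕ → Vec d) : ℕ → Vec d :=
  drivenIterate (fun z => (modelTrustRegionData centre τ svd f L₁ L R z).next) z₀ V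

/-- The trust-region data of pass `t` of the procedure. -/
def modelPass (centre : Set (Vec d) → Vec d) (τ : ℝ) (svd : Matrix (Fin d) (Fin d) ℝ → Vec d)
    (f : Vec d → ℝ) (L₁ L R : ℝ) (z₀ : Vec d) (V : ℕ → ℕ → Vec d) (t : ℕ) : TrustRegionData d :=
  modelTrustRegionData centre τ svd f L₁ L R (modelIterate centre τ svd f L₁ L R z₀ V t)

section ModelIterate

variable {Ω : Type*} [MeasurableSpace Ω] {P : Measure Ω}
  {centre : Set (Vec d) → Vec d} {τ : ℝ} {svd : Matrix (Fin d) (Fin d) ℝ → Vec d} {f : Vec d → ℝ}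
  {L₁ L R : ℝ} {U : ℕ → ℕ → Ω → Vec d}

local notation "𝒟" => modelTrustRegionData centre τ svd f L₁ L R
local notation "𝒬" => modelPass centre τ svd f L₁ L R

theorem measurable_modelIterate (hc : IsCuttingPlaneCentre centre τ) (hsvd : IsMinDirection svd)
    (hf : ContDiff ℝ 3 f) (hR : 0 < R) (hU : ∀ t k, Measurable (U t k)) (z₀ : Vec d) (t : ℕ) :
    Measurable fun ω => modelIterate centre τ svd f L₁ L R z₀ (fun s k => U s k ω) t :=
  measurable_drivenIterate (modelTrustRegionData.measurable_next hc hsvd hf hR) z₀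
    fun s _ => measurable_pi_lambda _ (hU s)

theorem measurable_modelPass_draws (hc : IsCuttingPlaneCentre centre τ) (hsvd : IsMinDirection svd)
    (hf : ContDiff ℝ 3 f) (hR : 0 < R) (hU : ∀ t k, Measurable (U t k)) (z₀ : Vec d) (t : ℕ) :
    Measurable fun ω => (𝒬 z₀ (fun s k => U s k ω) t).draws fun k => U t k ω :=
  ((modelTrustRegionData.measurable_draws (svd := svd) (L₁ := L₁) (L := L) hc hf hR).comp
    ((measurable_modelIterate hc hsvd hf hR hU z₀ t).prodMk (measurable_pi_lambda _ (hU t))) :)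

namespace StepAssumptions

variable [IsProbabilityMeasure P]

theorem measure_forall_lt_modelPass_candidate_mem_region_le (h : StepAssumptions f L₁ L R)
    (hd : 0 < d) (hc : IsCuttingPlaneCentre centre τ) (hsvd : IsMinDirection svd)
    (hU : IsUniformNoise U P) (z₀ : Vec d) (t k : ℕ) :
    P {ω | ∀ j < k, (𝒬 z₀ (fun s k => U s k ω) t).candidate (U t j ω)
      ∈ (𝒬 z₀ (fun s k => U s k ω) t).region} ≤ 2⁻¹ ^ k := by
  have hrow : iIndepFun (U t) P :=
    hU.iIndepFun.precomp (g := fun k : ℕ => (t, k)) fun _ _ hkl => (Prod.mk.inj hkl).2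
  have hnext : Measurable (Function.uncurry fun z => (𝒟 z).next) :=
    modelTrustRegionData.measurable_next hc hsvd h.contDiff h.R_pos
  exact h.measure_forall_lt_candidate_mem_region_le hd hc
    (measurable_modelIterate hc hsvd h.contDiff h.R_pos hU.measurable z₀ t) (hU.measurable t)
    (hU.isUniform t) hrow (indepFun_drivenIterate hnext z₀ hU.measurable hU.iIndepFun t) k

theorem measure_lt_modelPass_draws_le (h : StepAssumptions f L₁ L R) (hd : 0 < d)
    (hc : IsCuttingPlaneCentre centre τ) (hsvd : IsMinDirection svd) (hU : IsUniformNoise U P)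
    (z₀ : Vec d) (t k : ℕ) :
    P {ω | k < (𝒬 z₀ (fun s k => U s k ω) t).draws fun k => U t k ω} ≤ 2⁻¹ ^ k :=
  measure_lt_draws_le (D := 𝒟)
    (h.measure_forall_lt_modelPass_candidate_mem_region_le hd hc hsvd hU z₀ t k)

theorem ae_forall_modelPass_escapes (h : StepAssumptions f L₁ L R) (hd : 0 < d)
    (hc : IsCuttingPlaneCentre centre τ) (hsvd : IsMinDirection svd) (hU : IsUniformNoise U P)
    (z₀ : Vec d) :
    ∀ᵐ ω ∂P, ∀ t, (𝒬 z₀ (fun s k => U s k ω) t).Escapes fun k => U t k ω :=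
  ae_all_iff.2 fun t => ae_escapes (D := 𝒟)
    (h.measure_forall_lt_modelPass_candidate_mem_region_le hd hc hsvd hU z₀ t)

end StepAssumptions

end ModelIterate

/-! ### Parameters -/

/-- The trust-region radius of the procedure for the accuracy `ε`. -/
def modelRadius (L ε : ℝ) : ℝ := L ^ (-(1 / 3) : ℝ) * ε ^ (1 / 3 : ℝ) / 24

section ModelRadius

variable {L ε : ℝ}

theorem modelRadius_pos (hL : 0 < L) (hε : 0 < ε) : 0 < modelRadius L ε := by
  unfold modelRadius
  positivity

theorem modelRadius_pow (hL : 0 ≤ L) (hε : 0 ≤ ε) (n : ℕ) :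
    modelRadius L ε ^ n = L ^ (-(n / 3) : ℝ) * ε ^ (n / 3 : ℝ) / 24 ^ n := by
  rw [modelRadius, div_pow, mul_pow, ← Real.rpow_mul_natCast hL, ← Real.rpow_mul_natCast hε]
  ring_nf

theorem mul_modelRadius_sq (hL : 0 < L) (hε : 0 ≤ ε) :
    576 * L * modelRadius L ε ^ 2 = L ^ (1 / 3 : ℝ) * ε ^ (2 / 3 : ℝ) := by
  have hrpow : L ^ (1 / 3 : ℝ) = L * L ^ (-(2 / 3) : ℝ) := by
    rw [← Real.rpow_one_add' hL.le (by norm_num)]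
    norm_num
  rw [modelRadius_pow hL.le hε, hrpow]
  push_cast
  ring

theorem mul_modelRadius_cube (hL : 0 < L) (hε : 0 ≤ ε) :
    13824 * L * modelRadius L ε ^ 3 = ε := by
  rw [modelRadius_pow hL.le hε, Nat.cast_ofNat, div_self three_ne_zero, Real.rpow_neg_one,
    Real.rpow_one]
  field_simp
  ring

theorem mul_modelRadius_pow_four (hL : 0 < L) (hε : 0 < ε) :
    331776 * L * modelRadius L ε ^ 4 * (L ^ (1 / 3 : ℝ) * ε ^ (-(4 / 3) : ℝ)) = 1 := by
  have hrpow_L : L * L ^ (-(4 / 3) : ℝ) * L ^ (1 / 3 : ℝ) = 1 := by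
    rw [← Real.rpow_one_add' hL.le (by norm_num), ← Real.rpow_add hL]
    norm_num
  have hrpow_ε : ε ^ (4 / 3 : ℝ) * ε ^ (-(4 / 3) : ℝ) = 1 := by
    rw [← Real.rpow_add hε, add_neg_cancel, Real.rpow_zero]
  rw [modelRadius_pow hL.le hε.le]
  push_cast
  linear_combination ε ^ (4 / 3 : ℝ) * ε ^ (-(4 / 3) : ℝ) * hrpow_L + hrpow_ε

theorem mul_modelRadius_sq_le {L₁ : ℝ} (hL₁ : 0 ≤ L₁) (hL : 0 < L) (hε : 0 ≤ ε)
    (h : ε ≤ L₁ ^ (3 / 2 : ℝ) / L ^ (1 / 2 : ℝ)) : 576 * L * modelRadius L ε ^ 2 ≤ L₁ := by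
  have hrpow : (L₁ ^ (3 / 2 : ℝ) / L ^ (1 / 2 : ℝ)) ^ (2 / 3 : ℝ) = L₁ / L ^ (1 / 3 : ℝ) := by
    rw [Real.div_rpow (by positivity) (by positivity), ← Real.rpow_mul hL₁, ← Real.rpow_mul hL.le]
    norm_num
  calc 576 * L * modelRadius L ε ^ 2 = L ^ (1 / 3 : ℝ) * ε ^ (2 / 3 : ℝ) :=
        mul_modelRadius_sq hL hε
    _ ≤ L ^ (1 / 3 : ℝ) * (L₁ ^ (3 / 2 : ℝ) / L ^ (1 / 2 : ℝ)) ^ (2 / 3 : ℝ) := by gcongr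
    _ = L₁ := by rw [hrpow, mul_div_cancel₀ _ (by positivity)]

theorem mul_modelRadius_sq_cube (hL : 0 < L) (hε : 0 ≤ ε) :
    (576 * L * modelRadius L ε ^ 2) ^ 3 = ε ^ 2 * L := by
  linear_combination L * (13824 * L * modelRadius L ε ^ 3 + ε) * mul_modelRadius_cube hL hε

end ModelRadius

/-! ### The number of cutting planes -/

theorem log_eight_mul_le {r : ℝ} (hr : 1 ≤ r) : Real.log (8 * r) ≤ 3 * logPlus (r ^ 3) := by
  have hlog_eight : Real.log 8 = 3 * Real.log 2 := by
    rw [show (8 : ℝ) = 2 ^ 3 by norm_num, Real.log_pow, Nat.cast_ofNat]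
  have hone : 1 ≤ logPlus (r ^ 3) := le_max_left _ _
  have hlog : 3 * Real.log r ≤ logPlus (r ^ 3) :=
    by
    rw [logPlus, Real.log_pow, Nat.cast_ofNat]
    exact le_max_right _ _
  rw [Real.log_mul (by norm_num) (by linarith), hlog_eight]
  linarith [Real.log_two_lt_d9]

theorem IsCuttingPlaneCentre.one_le_div_mul_logPlus {centre : Set (Vec d) → Vec d} {τ : ℝ}
    (hc : IsCuttingPlaneCentre centre τ) (hd : 0 < d) (x : ℝ) : 1 ≤ d / τ * logPlus x := by
  have hd' : (1 : ℝ) ≤ d := Nat.one_le_cast.2 hd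
  exact one_le_mul_of_one_le_of_one_le
    ((one_le_div hc.tau_pos).2 (by linarith [hc.tau_le])) (le_max_left _ _)

theorem StepAssumptions.modelTrustRegionData_N_le {centre : Set (Vec d) → Vec d} {τ : ℝ}
    {f : Vec d → ℝ} {L₁ L R : ℝ} (h : StepAssumptions f L₁ L R)
    (hc : IsCuttingPlaneCentre centre τ) (hd : 0 < d)
    (svd : Matrix (Fin d) (Fin d) ℝ → Vec d) (z : Vec d) :
    ((modelTrustRegionData centre τ svd f L₁ L R z).N : ℝ)
      ≤ 4 * (d / τ * logPlus ((L₁ / (576 * L * R ^ 2)) ^ 3)) := by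
  have hL := h.L_pos
  have hR := h.R_pos
  set r := L₁ / (576 * L * R ^ 2) with hr
  set A := 16 * (2 * L₁ + 21 * (2 * L) * R ^ 2) * R / (6912 * L * R ^ 3 / 2) with hA
  have hr_one : 1 ≤ r := (one_le_div (by positivity)).2 h.le_L₁
  have hA_eq : A = 16 / 3 * r + 7 / 36 := by
    rw [hA, hr]
    field_simp
    ring
  have hlog : Real.log A ≤ 3 * logPlus (r ^ 3) :=
    (Real.log_le_log (by linarith) (by linarith)).trans (log_eight_mul_le hr_one)
  have hone := hc.one_le_div_mul_logPlus hd (r ^ 3)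
  have hτ := hc.tau_pos
  have harg : d / τ * Real.log A ≤ 3 * (d / τ * logPlus (r ^ 3)) := calc
    d / τ * Real.log A ≤ d / τ * (3 * logPlus (r ^ 3)) := by gcongr
    _ = 3 * (d / τ * logPlus (r ^ 3)) := by ring
  calc ((modelTrustRegionData centre τ svd f L₁ L R z).N : ℝ) = ⌈d / τ * Real.log A⌉₊ := rfl
    _ ≤ ⌈3 * (d / τ * logPlus (r ^ 3))⌉₊ := Nat.cast_le.2 (Nat.ceil_mono harg)
    _ ≤ 3 * (d / τ * logPlus (r ^ 3)) + 1 := (Nat.ceil_lt_add_one (by linarith)).le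
    _ ≤ 4 * (d / τ * logPlus (r ^ 3)) := by linarith

/-! ### The smallest eigenvalue -/

theorem quadForm_of_mulVec_eq_smul {A : Matrix (Fin d) (Fin d) ℝ} {μ : ℝ} {v : Fin d → ℝ}
    (hv : A.mulVec v = μ • v) : quadForm A (WithLp.toLp 2 v) = μ * ‖WithLp.toLp 2 v‖ ^ 2 := by
  change v ⬝ᵥ A.mulVec v = _
  rw [hv, dotProduct_smul, smul_eq_mul, EuclideanSpace.real_norm_sq_eq]
  simp only [dotProduct, sq]

theorem le_lambdaMin {A : Matrix (Fin d) (Fin d) ℝ} {δ : ℝ} (hδ : δ ≤ 0)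
    (h : ∀ s : Vec d, δ * ‖s‖ ^ 2 ≤ quadForm A s) : δ ≤ lambdaMin A := by
  unfold lambdaMin
  rcases (spectrum ℝ A).eq_empty_or_nonempty with hempty | hnonempty
  · rwa [hempty, Real.sInf_empty]
  refine le_csInf hnonempty fun μ hμ => ?_
  rw [← Matrix.spectrum_toLin', ← Module.End.hasEigenvalue_iff_mem_spectrum] at hμ
  obtain ⟨v, hv⟩ := hμ.exists_hasEigenvector
  have hv_ne : WithLp.toLp 2 v ≠ 0 := (WithLp.toLp_eq_zero 2).not.2 hv.2
  have hquad := h (WithLp.toLp 2 v)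
  rw [quadForm_of_mulVec_eq_smul hv.apply_eq_smul] at hquad
  exact le_of_mul_le_mul_right hquad (pow_pos (norm_pos_iff.2 hv_ne) 2)

/-! ### The number of passes -/

theorem exists_le_of_forall_or_le_sub {Q : ℕ → Prop} {a : ℕ → ℝ} {b c : ℝ} {n : ℕ}
    (h : ∀ m, Q (m + 1) ∨ a (m + 1) ≤ a m - c) (hb : ∀ m, b ≤ a m) (hn : a 0 - b < n * c) :
    ∃ m ≤ n, Q m := by
  by_contra! hQ
  have hdecrease : ∀ m ≤ n, a m ≤ a 0 - m * c := by
    intro m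
    induction m with
    | zero => simp
    | succ m ih =>
      intro hm
      have hstep := (h m).resolve_left (hQ _ hm)
      push_cast
      linarith [ih (m.le_succ.trans hm)]
  linarith [hdecrease n le_rfl, hb n]

/-- The number of passes after which decreasing `f` by `21 * L * modelRadius L ε ^ 4` in each pass
would have exhausted the initial gap `Δ`. -/
def passCount (L ε Δ : ℝ) : ℕ := ⌊Δ / (21 * L * modelRadius L ε ^ 4)⌋₊ + 1

theorem lt_passCount_mul {L ε : ℝ} (hL : 0 < L) (hε : 0 < ε) (Δ : ℝ) :
    Δ < passCount L ε Δ * (21 * L * modelRadius L ε ^ 4) := by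
  have hR := modelRadius_pos hL hε
  rw [← div_lt_iff₀ (by positivity), passCount, Nat.cast_succ]
  exact Nat.lt_floor_add_one _

theorem passCount_le {L ε Δ : ℝ} (hL : 0 < L) (hε : 0 < ε) (hΔ : 0 ≤ Δ) :
    (passCount L ε Δ : ℝ) ≤ 15800 * (Δ * L ^ (1 / 3 : ℝ) * ε ^ (-(4 / 3) : ℝ) + 1) := by
  have hR := modelRadius_pos hL hε
  have hdiv : Δ / (21 * L * modelRadius L ε ^ 4)
      = 331776 / 21 * (Δ * L ^ (1 / 3 : ℝ) * ε ^ (-(4 / 3) : ℝ)) := by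
    rw [div_eq_iff (by positivity)]
    linear_combination -Δ * mul_modelRadius_pow_four hL hε
  have hgap : 0 ≤ Δ * L ^ (1 / 3 : ℝ) * ε ^ (-(4 / 3) : ℝ) := by positivity
  have hfloor : (⌊Δ / (21 * L * modelRadius L ε ^ 4)⌋₊ : ℝ) ≤ Δ / (21 * L * modelRadius L ε ^ 4) :=
    Nat.floor_le (by positivity)
  rw [hdiv] at hfloor
  rw [passCount, hdiv, Nat.cast_succ]
  linarith

theorem stepAssumptions_modelRadius {f : Vec d → ℝ} {L₁ L ε : ℝ} (hf : ContDiff ℝ 3 f)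
    (hf₁ : HasLipschitzDerivs 1 L₁ f Set.univ) (hf₃ : HasLipschitzDerivs 3 L f Set.univ)
    (hL₁ : 0 ≤ L₁) (hL : 0 < L) (hε : 0 < ε) (h : ε ≤ L₁ ^ (3 / 2 : ℝ) / L ^ (1 / 2 : ℝ)) :
    StepAssumptions f L₁ L (modelRadius L ε) where
  contDiff := hf
  lip₁ := hf₁
  lip₃ := hf₃
  L_pos := hL
  R_pos := modelRadius_pos hL hε
  le_L₁ := mul_modelRadius_sq_le hL₁ hL hε.le h

section Procedure

variable {centre : Set (Vec d) → Vec d} {τ : ℝ} {svd : Matrix (Fin d) (Fin d) ℝ → Vec d}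
  {f : Vec d → ℝ} {L₁ L R ε Δ κ T₃ TC : ℝ} {z₀ : Vec d} {V : ℕ → ℕ → Vec d}

local notation "𝒟" => modelTrustRegionData centre τ svd f L₁ L R
local notation "𝒵" => modelIterate centre τ svd f L₁ L (modelRadius L ε) z₀ V
local notation "𝒬" => modelPass centre τ svd f L₁ L (modelRadius L ε) z₀ V
local notation "Λ" => d / τ * logPlus (L₁ ^ 3 / (ε ^ 2 * L))

theorem StepAssumptions.exists_isApproxStationary (h : StepAssumptions f L₁ L (modelRadius L ε))
    (hc : IsCuttingPlaneCentre centre τ) (hsvd : IsMinDirection svd) (hε : 0 < ε)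
    (hbdd : BddBelow (Set.range f)) (hΔ : f z₀ - ⨅ x, f x ≤ Δ) (hV : ∀ t k, ‖V t k‖ ≤ 1)
    (hesc : ∀ t, (𝒬 t).Escapes (V t)) :
    ∃ m ≤ passCount L ε Δ, IsApproxStationary f ε (L ^ (1 / 3 : ℝ) * ε ^ (2 / 3 : ℝ)) (𝒵 m) := by
  have hL := h.L_pos
  have hstep (m : ℕ) : IsSuccessfulStep f L (modelRadius L ε) (𝒵 m) (𝒵 (m + 1)) :=
    h.isSuccessfulStep_next hc hsvd (hV m) (.inr (hesc m))
  simp only [IsSuccessfulStep, mul_modelRadius_cube hL hε.le, mul_modelRadius_sq hL hε.le]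
    at hstep
  exact exists_le_of_forall_or_le_sub (a := fun m => f (𝒵 m)) hstep (fun m => ciInf_le hbdd _)
    (hΔ.trans_lt (lt_passCount_mul hL hε Δ))

/-! ### The total time -/

theorem StepAssumptions.cuttingTrustRegion_returnsWithin (h : StepAssumptions f L₁ L R)
    (hc : IsCuttingPlaneCentre centre τ) (hd : 0 < d) {T : Costs} (hcentre : 0 ≤ T.centre)
    (hvec : 0 ≤ T.vec) (hvec_le : T.vec ≤ T.eval) (hsvd : 0 ≤ T.svd) (hsvd_le : T.svd ≤ T.eval)
    {z : Vec d} {U : ℕ → Vec d} (hU : (𝒟 z).Escapes U) :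
    (cuttingTrustRegion T centre τ svd (taylorModel 3 L f z) z (6912 * L * R ^ 3) (2 * L₁) (2 * L)
      R U).ReturnsWithin ((𝒟 z).next U, (𝒟 z).draws U)
      (d / τ * logPlus ((L₁ / (576 * L * R ^ 2)) ^ 3)
        * (4 * T.centre + 37 * T.eval + 7 * T.vec * (𝒟 z).draws U)) := by
  refine (_root_.cuttingTrustRegion_returnsWithin hvec (hvec.trans hvec_le) hsvd rfl
    (.inr hU)).mono ?_
  change (𝒟 z).N * (T.centre + T.eval + 3 * T.vec) + 7 * T.eval + 13 * T.vec + T.svd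
    + (𝒟 z).draws U * (((𝒟 z).N + 3) * T.vec) ≤ _
  have hN := h.modelTrustRegionData_N_le hc hd svd z
  have hone := hc.one_le_div_mul_logPlus hd ((L₁ / (576 * L * R ^ 2)) ^ 3)
  set B := d / τ * logPlus ((L₁ / (576 * L * R ^ 2)) ^ 3)
  have heval : T.eval ≤ B * T.eval := le_mul_of_one_le_left (hvec.trans hvec_le) hone
  calc (𝒟 z).N * (T.centre + T.eval + 3 * T.vec) + 7 * T.eval + 13 * T.vec + T.svd
        + (𝒟 z).draws U * (((𝒟 z).N + 3) * T.vec)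
      ≤ 4 * B * (T.centre + T.eval + 3 * T.eval) + 7 * T.eval + 13 * T.eval + T.eval
        + (𝒟 z).draws U * ((4 * B + 3 * B) * T.vec) := by
        have := hvec.trans hvec_le
        gcongr
        linarith
    _ ≤ B * (4 * T.centre + 37 * T.eval + 7 * T.vec * (𝒟 z).draws U) := by linarith

theorem StepAssumptions.quarticIterates_returnsWithin
    (h : StepAssumptions f L₁ L (modelRadius L ε)) (hc : IsCuttingPlaneCentre centre τ)
    (hd : 0 < d) (hε : 0 < ε) (hκ : 0 ≤ κ) (hTC : 0 ≤ TC) (hesc : ∀ t, (𝒬 t).Escapes (V t))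
    (m : ℕ) :
    (quarticIterates κ T₃ TC centre τ svd f z₀ ε L₁ L V m).ReturnsWithin (𝒵 m)
      (∑ t ∈ Finset.range m,
        (T₃ + Λ * (4 * TC + 37 * (κ * d ^ 3) + 7 * (κ * d) * (𝒬 t).draws (V t)))) := by
  induction m with
  | zero => exact .pure z₀
  | succ m ih =>
    have hL := h.L_pos
    have hd_le : κ * d ≤ κ * d ^ 3 := by
      gcongr
      exact_mod_cast Nat.le_self_pow three_ne_zero d
    have hpass := h.cuttingTrustRegion_returnsWithin hc hd (T := ⟨TC, κ * d ^ 3, κ * d ^ 3, κ * d⟩)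
      hTC (by positivity) hd_le (by positivity) le_rfl (hesc m)
    have hε_half : 6912 * L * modelRadius L ε ^ 3 = ε / 2 := by
      linear_combination mul_modelRadius_cube hL hε.le / 2
    rw [hε_half, div_pow, mul_modelRadius_sq_cube hL hε.le] at hpass
    rw [Finset.sum_range_succ]
    exact .mono (.bind ih (.bind (.tick _) (.bind hpass (.pure _)))) (by rw [add_zero]; rfl)

theorem sum_time_le {n m : ℕ} (hm : m ≤ n) (hn : 0 < n) {D : ℕ → ℕ} {K : ℝ}
    (hK : 0 ≤ K) (hD : ∑ t ∈ Finset.range n, (D t : ℝ) ≤ 10 * n * K) (hκ : 0 ≤ κ) (hT₃ : 0 ≤ T₃)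
    (hTC : 0 ≤ TC) {B : ℝ} (hB : 0 ≤ B) :
    ∑ t ∈ Finset.range m, (T₃ + B * (4 * TC + 37 * (κ * d ^ 3) + 7 * (κ * d) * D t)) + T₃
      ≤ n * ((4 + 70 * κ) * (T₃ + B * (TC + d ^ 3 + K * d))) := by
  have hslack : 0 ≤ n * ((2 + 70 * κ) * T₃
      + B * (70 * κ * TC + (4 + 33 * κ) * d ^ 3 + 4 * K * d)) := by positivity
  calc ∑ t ∈ Finset.range m, (T₃ + B * (4 * TC + 37 * (κ * d ^ 3) + 7 * (κ * d) * D t)) + T₃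
      ≤ ∑ t ∈ Finset.range n, (T₃ + B * (4 * TC + 37 * (κ * d ^ 3) + 7 * (κ * d) * D t))
        + n * T₃ := by
        gcongr
        exact le_mul_of_one_le_left hT₃ (Nat.one_le_cast.2 hn)
    _ = 2 * n * T₃ + B * (n * (4 * TC + 37 * (κ * d ^ 3))
        + 7 * (κ * d) * ∑ t ∈ Finset.range n, (D t : ℝ)) := by
        simp only [Finset.sum_add_distrib, ← Finset.mul_sum, Finset.sum_const, Finset.card_range,
          nsmul_eq_mul]
        ring
    _ ≤ 2 * n * T₃ + B * (n * (4 * TC + 37 * (κ * d ^ 3)) + 7 * (κ * d) * (10 * n * K)) := by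
        gcongr
    _ ≤ n * ((4 + 70 * κ) * (T₃ + B * (TC + d ^ 3 + K * d))) := by linarith

theorem StepAssumptions.exists_returns_time_le (h : StepAssumptions f L₁ L (modelRadius L ε))
    (hc : IsCuttingPlaneCentre centre τ) (hsvd : IsMinDirection svd) (hd : 0 < d) (hε : 0 < ε)
    (hκ : 0 ≤ κ) (hT₃ : 0 ≤ T₃) (hTC : 0 ≤ TC) (hbdd : BddBelow (Set.range f))
    (hΔ : f z₀ - ⨅ x, f x ≤ Δ) (hV : ∀ t k, ‖V t k‖ ≤ 1) (hesc : ∀ t, (𝒬 t).Escapes (V t)) :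
    ∃ m z time, (quarticIterates κ T₃ TC centre τ svd f z₀ ε L₁ L V m).Returns z time ∧
      IsApproxStationary f ε (L ^ (1 / 3 : ℝ) * ε ^ (2 / 3 : ℝ)) z ∧
      time + T₃ ≤ 15800 * (4 + 70 * κ) * timeBound d T₃ TC τ L₁ L ε Δ
        (normalizedDraws (passCount L ε Δ) fun t => (𝒬 t).draws (V t)) := by
  obtain ⟨m, hm, hstationary⟩ := h.exists_isApproxStationary hc hsvd hε hbdd hΔ hV hesc
  obtain ⟨time, htime, hreturns⟩ :=
    h.quarticIterates_returnsWithin (T₃ := T₃) hc hd hε hκ hTC hesc m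
  have hB := hc.one_le_div_mul_logPlus hd (L₁ ^ 3 / (ε ^ 2 * L))
  have hΔ_nonneg : 0 ≤ Δ := (sub_nonneg.2 (ciInf_le hbdd z₀)).trans hΔ
  have hn : 0 < passCount L ε Δ := Nat.succ_pos _
  refine ⟨m, 𝒵 m, time, hreturns, hstationary, ?_⟩
  set K := normalizedDraws (passCount L ε Δ) fun t => (𝒬 t).draws (V t)
  have hK : 0 ≤ K := (normalizedDraws_pos _ _).le
  calc time + T₃ ≤ passCount L ε Δ * ((4 + 70 * κ) * (T₃ + Λ * (TC + d ^ 3 + K * d))) :=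
        (add_le_add_left htime T₃).trans
          (sum_time_le hm hn hK (sum_le_mul_normalizedDraws hn _) hκ hT₃ hTC
            (zero_le_one.trans hB))
    _ ≤ 15800 * (Δ * L ^ (1 / 3 : ℝ) * ε ^ (-(4 / 3) : ℝ) + 1)
        * ((4 + 70 * κ) * (T₃ + Λ * (TC + d ^ 3 + K * d))) := by
        gcongr
        exact passCount_le h.L_pos hε hΔ_nonneg
    _ = 15800 * (4 + 70 * κ) * timeBound d T₃ TC τ L₁ L ε Δ K := by
        rw [timeBound]
        ring

end Procedure

end

theorem mainTheorem2 (κ : ℝ) (hκ : 0 < κ) :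
    ∃ C : ℝ, 0 < C ∧
      ∀ (d : ℕ) (_ : 0 < d)
        (centre : Set (Vec d) → Vec d) (τ : ℝ) (_ : IsCuttingPlaneCentre centre τ)
        (svd : Matrix (Fin d) (Fin d) ℝ → Vec d) (_ : IsMinDirection svd)
        (T₃ TC : ℝ) (_ : 0 ≤ T₃) (_ : 0 ≤ TC)
        (L₁ L₃ ε Δ : ℝ) (_ : 0 < L₁) (_ : 0 < L₃)
        (_ : 0 < ε) (_ : ε ≤ L₁ ^ (3 / 2 : ℝ) / L₃ ^ (1 / 2 : ℝ))
        (f : Vec d → ℝ) (_ : ContDiff ℝ 3 f)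
        (_ : HasLipschitzDerivs 1 L₁ f Set.univ) (_ : HasLipschitzDerivs 3 L₃ f Set.univ)
        (z₀ : Vec d) (_ : BddBelow (Set.range f)) (_ : f z₀ - ⨅ x, f x ≤ Δ)
        (Ω : Type*) (_ : MeasurableSpace Ω) (P : MeasureTheory.Measure Ω)
        (_ : MeasureTheory.IsProbabilityMeasure P)
        (U : ℕ → ℕ → Ω → Vec d) (_ : ∀ t k, Measurable (U t k))
        (_ : ∀ t k, MeasureTheory.pdf.IsUniform (U t k) (Metric.closedBall (0 : Vec d) 1) P)
        (_ : ProbabilityTheory.iIndepFun (fun tk : ℕ × ℕ => U tk.1 tk.2) P),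
        ∃ Kbar : Ω → ℝ, Measurable Kbar ∧ (∀ ω, 0 < Kbar ω) ∧
          (∀ y : ℝ, P {ω | y ≤ Kbar ω} ≤ ENNReal.ofReal (Real.exp ((1 - y) / 10))) ∧
          ∀ᵐ ω ∂P, ∃ (m : ℕ) (z : Vec d) (time : ℝ),
            (quarticIterates κ T₃ TC centre τ svd f z₀ ε L₁ L₃ (fun t k => U t k ω) m).Returns
              z time ∧
            ‖gradient f z‖ ≤ ε ∧
            -(L₃ ^ (1 / 3 : ℝ) * ε ^ (2 / 3 : ℝ)) ≤ lambdaMin (hessian f z) ∧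
            -- the time includes an evaluation of `f` and its derivatives at the final point
            time + T₃ ≤ C * timeBound d T₃ TC τ L₁ L₃ ε Δ (Kbar ω) := by
  refine ⟨15800 * (4 + 70 * κ), by positivity, ?_⟩
  intro d hd centre τ hc svd hsvd T₃ TC hT₃ hTC L₁ L₃ ε Δ hL₁ hL₃ hε hε_le f hf hf₁ hf₃ z₀ hbdd hΔ
    Ω _ P _ U hU_meas hU_unif hU_indep
  have hU : IsUniformNoise U P := ⟨hU_meas, hU_unif, hU_indep⟩
  have h := stepAssumptions_modelRadius hf hf₁ hf₃ hL₁.le hL₃ hε hε_le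
  set n := passCount L₃ ε Δ
  have hn : 0 < n := Nat.succ_pos _
  let draws (t : ℕ) (ω : Ω) : ℕ :=
    (modelPass centre τ svd f L₁ L₃ (modelRadius L₃ ε) z₀ (fun s k => U s k ω) t).draws
      fun k => U t k ω
  have hdraws (t : ℕ) : Measurable (draws t) :=
    measurable_modelPass_draws hc hsvd hf h.R_pos hU_meas z₀ t
  refine ⟨fun ω => normalizedDraws n fun t => draws t ω, measurable_normalizedDraws n hdraws,
    fun ω => normalizedDraws_pos n _, measure_le_normalizedDraws_le hn hdraws
      (h.measure_lt_modelPass_draws_le hd hc hsvd hU z₀), ?_⟩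
  filter_upwards [hU.ae_norm_le_one, h.ae_forall_modelPass_escapes hd hc hsvd hU z₀]
    with ω hω_norm hω_escapes
  obtain ⟨m, z, time, hreturns, ⟨hgrad, hcurv⟩, htime⟩ := h.exists_returns_time_le hc hsvd hd hε
    hκ.le hT₃ hTC hbdd hΔ hω_norm hω_escapes
  have hδ : 0 ≤ L₃ ^ (1 / 3 : ℝ) * ε ^ (2 / 3 : ℝ) := by positivity
  exact ⟨m, z, time, hreturns, hgrad, le_lambdaMin (neg_nonpos.2 hδ) hcurv, htime⟩
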